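/- **Setting.** Let $n,T\ge 1$, let $G=([T],\mathcal E)$ be a graph with (arbitrarily oriented) incidence matrix $D\in\{-1,0,1\}^{|\mathcal E|\times T}$, and put $M=D\otimes I_n$. Let $x=(x_1,\dots,x_T)\in\mathbb R^{nT}$ with each $x_t\in\mathbb R^n$ centered ($\mathbf 1_n^\top x_t=0$) and $\|Mx\|_2^2=\sum_{\{t,t'\}\in\mathcal E}\|x_t-x_{t'}\|_2^2\le S_T$, where $S_T>0$. Let $G_t\sim\mathcal G(n,p_t)$, $t\in[T]$, be independent Erdős–Rényi graphs on $[n]$ ($p_t\in[0,1]$), let $C_t$ be the incidence matrix of any orientation of the edges of $G_t$, and let $C=\mathrm{diag}(C_1,\dots,C_T)$ (block diagonal). One observes $y=Cx+\eta$, where, given the graphs $(G_t)_t$, the noise vector $\eta$ is $\sigma$-subgaussian, $\sigma\ge 0$: $\mathbb E[e^{s\,u^\top\eta}\mid (G_t)_t]\le e^{s^2\sigma^2/2}$ for all $s\in\mathbb R$ and all unit vectors $u$ (for instance, $\eta$ is $\sigma$-subgaussian and independent of the graphs). With $P=I_T\otimes(I_n-\tfrac1n\mathbf 1_n\mathbf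 1_n^\top)$ and $\dagger$ the Moore–Penrose pseudoinverse, the centered estimator with parameter $\mu$ is $$\hat x=\big(P(\mu M^\top M+C^\top C)P\big)^\dagger C^\top y .$$ Write $p_{\rm sum}=\sum_t p_t$, $p_{\max}=\max_t p_t$ and $$\gamma_{n,T}=\min\Big\{\sqrt{2np_{\max}}+\big(2n\log\tfrac{nT}{\delta}\big)^{1/4},\ \sqrt{2n}\Big\}.$$ **Theorem.** There are universal constants $c_1,c_2,c_3>0$ such that the following holds. (A) *Error bounds.* For every $\delta\in(0,e^{-1})$ with $p_{\rm sum}\ge c_1\frac{\log(n/\delta)}{n}$: 1. If $G$ is the complete graph and $$\mu=\max\Big\{n^{2/3}\sigma^{2/3}\gamma_{n,T}^{2/3}\Big(\frac{p_{\rm sum}}{T^2S_T}\Big)^{1/3}-\frac{np_{\rm sum}}{T^2},\ \frac{c_2}{T}\Big(\frac{np_{\rm sum}}{T}+\gamma_{n,T}^2\Big)\Big\},$$ then with probability at least $1-3\delta$ $$\|\hat x-x\|_2^2\le c_3\Big(\frac{S_T}{T}+\frac{\gamma_{n,T}^2}{np_{\rm sum}}S_T+\Big[\frac{\sigma^{2/3}\gamma_{n,T}^{2/3}T^{1/3}S_T^{2/3}}{n^{1/3}p_{\rm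 sum}^{2/3}}+\frac{\sigma^2\gamma_{n,T}^2T^2}{np_{\rm sum}^2}\Big]\log\frac1\delta\Big).$$ 2. If $G$ is a star graph (with any center) and $$\mu=\max\Big\{n^{2/3}\sigma^{2/3}\gamma_{n,T}^{2/3}\Big(\frac{p_{\rm sum}}{S_T}\Big)^{1/3}-\frac{np_{\rm sum}}{T},\ c_2\Big(\frac{np_{\rm sum}}{T}+\gamma_{n,T}^2\Big)\Big\},$$ then with probability at least $1-3\delta$ $$\|\hat x-x\|_2^2\le c_3\Big(S_T+\frac{\gamma_{n,T}^2}{np_{\rm sum}}TS_T+\Big[\frac{\sigma^{2/3}\gamma_{n,T}^{2/3}TS_T^{2/3}}{n^{1/3}p_{\rm sum}^{2/3}}+\frac{\sigma^2\gamma_{n,T}^2T^2}{np_{\rm sum}^2}\Big]\log\frac1\delta\Big).$$ (B) *Weak consistency.* Fix $n$, $\sigma$ and $\delta\in(0,e^{-1})$, and consider any sequence of such problems with $T\to\infty$ (with $x$, $S_T$, the $p_t$, the graphs and the noise depending on $T$). With $\mu$ as in (A), the mean squared error $\frac1T\|\hat x-x\|_2^2$ tends to $0$ in probability, provided 1. $p_{\rm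 sum}=\omega\big(\max\{S_T/T,\sqrt T\}\big)$, if $G$ is the complete graph; 2. $p_{\rm sum}=\omega\big(\max\{S_T,\sqrt T\}\big)$, if $G$ is a star graph. Nothing is assumed about the individual $p_t$, so each $G_t$ may lie below the connectivity threshold. -/

import Mathlib

open MeasureTheory ProbabilityTheory Filter Topology
open scoped Matrix Kronecker NNReal Asymptotics

namespace TransSync

/-! ### The Moore-Penrose pseudoinverse of a real matrix -/

/-- The four Penrose equations: `X` is the Moore-Penrose pseudoinverse of `A`. -/
structure IsMoorePenrose {m k : Type*} [Fintype m] [Fintype k]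
    (A : Matrix m k ℝ) (X : Matrix k m ℝ) : Prop where
  mul_mul_left : A * X * A = A
  mul_mul_right : X * A * X = X
  left_symm : (A * X)ᵀ = A * X
  right_symm : (X * A)ᵀ = X * A

theorem IsMoorePenrose.unique {m k : Type*} [Fintype m] [Fintype k]
    {A : Matrix m k ℝ} {X Y : Matrix k m ℝ}
    (hX : IsMoorePenrose A X) (hY : IsMoorePenrose A Y) : X = Y := by
  have h1 : A * X = A * Y := by
    have e1 : (A * Y) * (A * X) = A * X := by
      rw [← Matrix.mul_assoc (A * Y) A X, hY.mul_mul_left]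
    have e2 : (A * X) * (A * Y) = A * Y := by
      rw [← Matrix.mul_assoc (A * X) A Y, hX.mul_mul_left]
    have e3 := congrArg Matrix.transpose e1
    rw [Matrix.transpose_mul, hX.left_symm, hY.left_symm, e2] at e3
    exact e3.symm
  have h2 : X * A = Y * A := by
    have e1 : (X * A) * (Y * A) = X * A := by
      rw [Matrix.mul_assoc X A (Y * A), ← Matrix.mul_assoc A Y A, hY.mul_mul_left]
    have e2 : (Y * A) * (X * A) = Y * A := by
      rw [Matrix.mul_assoc Y A (X * A), ← Matrix.mul_assoc A X A, hX.mul_mul_left]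
    have e3 := congrArg Matrix.transpose e1
    rw [Matrix.transpose_mul, hX.right_symm, hY.right_symm, e2] at e3
    exact e3.symm
  calc X = X * A * X := hX.mul_mul_right.symm
    _ = Y * A * Y := by rw [h2, Matrix.mul_assoc, h1, ← Matrix.mul_assoc]
    _ = Y := hY.mul_mul_right

/-- Existence for symmetric matrices: invert the nonzero eigenvalues. -/
theorem exists_isMoorePenrose_of_isHermitian {k : Type*} [Fintype k]
    {B : Matrix k k ℝ} (hB : B.IsHermitian) :
    ∃ X : Matrix k k ℝ, IsMoorePenrose B X ∧ Xᵀ = X := by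
  classical
  set U : Matrix k k ℝ := (hB.eigenvectorUnitary : Matrix k k ℝ) with hU
  have hUU : Uᵀ * U = 1 := by
    have := Unitary.coe_star_mul_self hB.eigenvectorUnitary
    simpa [Matrix.star_eq_conjTranspose] using this
  set d : k → ℝ := hB.eigenvalues
  have hBd : B = U * Matrix.diagonal d * Uᵀ := by
    have h := hB.spectral_theorem
    rw [Unitary.conjStarAlgAut_apply] at h
    simpa [Matrix.star_eq_conjTranspose, Function.comp_def] using h
  have key : ∀ a b : k → ℝ, (U * Matrix.diagonal a * Uᵀ) * (U * Matrix.diagonal b * Uᵀ)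
      = U * Matrix.diagonal (fun i => a i * b i) * Uᵀ := by
    intro a b
    calc (U * Matrix.diagonal a * Uᵀ) * (U * Matrix.diagonal b * Uᵀ)
        = U * Matrix.diagonal a * (Uᵀ * U) * Matrix.diagonal b * Uᵀ := by
          simp only [Matrix.mul_assoc]
      _ = _ := by rw [hUU, Matrix.mul_one, Matrix.mul_assoc U, Matrix.diagonal_mul_diagonal]
  have symm : ∀ a : k → ℝ, (U * Matrix.diagonal a * Uᵀ)ᵀ = U * Matrix.diagonal a * Uᵀ := by
    intro a
    simp [Matrix.transpose_mul, Matrix.mul_assoc]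
  refine ⟨U * Matrix.diagonal (fun i => (d i)⁻¹) * Uᵀ, ⟨?_, ?_, ?_, ?_⟩, symm _⟩
  · rw [hBd, key, key]
    congr 3
    funext i
    exact mul_inv_mul_cancel (d i)
  · rw [hBd, key, key]
    congr 3
    funext i
    by_cases h : d i = 0 <;> simp [h]
  · rw [hBd, key, symm]
  · rw [hBd, key, symm]

theorem exists_isMoorePenrose {m k : Type*} [Fintype m] [Fintype k]
    (A : Matrix m k ℝ) : ∃ X : Matrix k m ℝ, IsMoorePenrose A X := by
  classical
  have hB : (Aᵀ * A).IsHermitian := by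
    simpa using Matrix.isHermitian_conjTranspose_mul_self A
  obtain ⟨Y, hY, hYs⟩ := exists_isMoorePenrose_of_isHermitian hB
  have hA : A * (Y * (Aᵀ * A)) = A := by
    have h0 : (Aᵀ * A) * (Y * (Aᵀ * A) - 1) = 0 := by
      rw [Matrix.mul_sub, Matrix.mul_one, ← Matrix.mul_assoc, hY.mul_mul_left, sub_self]
    have h1 : A * (Y * (Aᵀ * A) - 1) = 0 := by
      have := (Matrix.conjTranspose_mul_self_mul_eq_zero A (Y * (Aᵀ * A) - 1)).1
        (by simpa using h0)
      exact this
    rwa [Matrix.mul_sub, Matrix.mul_one, sub_eq_zero] at h1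
  refine ⟨Y * Aᵀ, ⟨?_, ?_, ?_, ?_⟩⟩
  · simpa only [Matrix.mul_assoc] using hA
  · have := congrArg (fun Z => Z * Aᵀ) hY.mul_mul_right
    simpa only [Matrix.mul_assoc] using this
  · simp [Matrix.transpose_mul, hYs, Matrix.mul_assoc]
  · have := hY.right_symm
    simpa only [Matrix.mul_assoc] using this

/-- The Moore-Penrose pseudoinverse `A†`. -/
noncomputable def pinv {m k : Type*} [Fintype m] [Fintype k] (A : Matrix m k ℝ) :
    Matrix k m ℝ :=
  (exists_isMoorePenrose A).choose

theorem pinv_spec {m k : Type*} [Fintype m] [Fintype k] (A : Matrix m k ℝ) :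
    IsMoorePenrose A (pinv A) :=
  (exists_isMoorePenrose A).choose_spec

/-! ### Incidence matrices -/

/-- An orientation of the edges of a graph: for each edge, the endpoint which is its head. -/
structure EdgeOrientation {V : Type*} (H : SimpleGraph V) where
  head : H.edgeSet → V
  head_mem : ∀ e : H.edgeSet, head e ∈ (e : Sym2 V)

open scoped Classical in
/-- The oriented incidence matrix: `+1` at the head, `-1` at the other endpoint. -/
noncomputable def incidence {V : Type*} (H : SimpleGraph V) (o : EdgeOrientation H) :
    Matrix H.edgeSet V ℝ :=
  Matrix.of fun e v => if v = o.head e then 1 else if v ∈ (e : Sym2 V) then -1 else 0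

open scoped Classical in
/-- The matrix `M = D ⊗ I_n`, where `D` is the incidence matrix of `G`. -/
noncomputable def smoothMat {T : ℕ} (n : ℕ) (G : SimpleGraph (Fin T)) (o : EdgeOrientation G) :
    Matrix (G.edgeSet × Fin n) (Fin T × Fin n) ℝ :=
  incidence G o ⊗ₖ (1 : Matrix (Fin n) (Fin n) ℝ)

/-- The indices of the measurements: pairs (layer `t`, edge of `H t`). -/
abbrev MeasIdx {n T : ℕ} (H : Fin T → SimpleGraph (Fin n)) : Type :=
  Σ t : Fin T, (H t).edgeSet

/-- The block-diagonal matrix `C = diag(C_1, …, C_T)`, with `C_t` the incidence matrix of `H t`. -/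
noncomputable def measMat {n T : ℕ} (H : Fin T → SimpleGraph (Fin n))
    (o : ∀ t, EdgeOrientation (H t)) : Matrix (MeasIdx H) (Fin T × Fin n) ℝ :=
  Matrix.of fun r c => if r.1 = c.1 then incidence (H r.1) (o r.1) r.2 c.2 else 0

/-- The block-wise centering projection `P = I_T ⊗ (I_n - (1/n) 1 1ᵀ)`. -/
noncomputable def centerMat (n T : ℕ) : Matrix (Fin T × Fin n) (Fin T × Fin n) ℝ :=
  (1 : Matrix (Fin T) (Fin T) ℝ) ⊗ₖ
    ((1 : Matrix (Fin n) (Fin n) ℝ) - (1 / (n : ℝ)) • Matrix.of fun _ _ => (1 : ℝ))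

/-! ### The observations and the estimator -/

/-- The squared Euclidean norm. -/
def sqNorm {ι : Type*} [Fintype ι] (v : ι → ℝ) : ℝ := ∑ i, v i ^ 2

open scoped Classical in
/-- The estimator `(P (μ Mᵀ M + Cᵀ C) P)† Cᵀ y`. -/
noncomputable def estimator {n T : ℕ} (G : SimpleGraph (Fin T)) (oG : EdgeOrientation G)
    (H : Fin T → SimpleGraph (Fin n)) (o : ∀ t, EdgeOrientation (H t))
    (μ : ℝ) (y : MeasIdx H → ℝ) : Fin T × Fin n → ℝ :=
  (pinv (centerMat n T *
      (μ • ((smoothMat n G oG)ᵀ * smoothMat n G oG) + (measMat H o)ᵀ * measMat H o) *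
      centerMat n T) * (measMat H o)ᵀ) *ᵥ y

/-- The part of a noise array (indexed by layers and pairs of items) which is carried by the
edges of the measurement graphs. -/
def noiseVec {n T : ℕ} (H : Fin T → SimpleGraph (Fin n)) (η : Fin T → Sym2 (Fin n) → ℝ) :
    MeasIdx H → ℝ :=
  fun r => η r.1 r.2

/-- The observations `y = C x + η`. -/
noncomputable def observation {n T : ℕ} (H : Fin T → SimpleGraph (Fin n))
    (o : ∀ t, EdgeOrientation (H t)) (x : Fin T × Fin n → ℝ)
    (η : Fin T → Sym2 (Fin n) → ℝ) : MeasIdx H → ℝ :=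
  measMat H o *ᵥ x + noiseVec H η

/-- The squared error `‖x̂ - x‖²` of the estimator. -/
noncomputable def sqError {n T : ℕ} (G : SimpleGraph (Fin T)) (oG : EdgeOrientation G)
    (o : ∀ (_ : Fin T) (K : SimpleGraph (Fin n)), EdgeOrientation K) (μ : ℝ)
    (x : Fin T × Fin n → ℝ) (H : Fin T → SimpleGraph (Fin n))
    (η : Fin T → Sym2 (Fin n) → ℝ) : ℝ :=
  sqNorm (estimator G oG H (fun t => o t (H t)) μ
    (observation H (fun t => o t (H t)) x η) - x)

/-! ### The probabilistic model -/

/-- `𝒢 0, …, 𝒢 (T-1)` are independent Erdős-Rényi graphs, `𝒢 t ∼ G(n, p t)`: the events that the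
pair `e` is an edge of `𝒢 t` have probability `p t` and are mutually independent, over all layers
`t` and all pairs `e` of distinct items. -/
structure IsErdosRenyiFamily {Ω : Type*} [MeasurableSpace Ω] (P : Measure Ω) {n T : ℕ}
    (𝒢 : Ω → Fin T → SimpleGraph (Fin n)) (p : Fin T → ℝ) : Prop where
  p_mem : ∀ t, p t ∈ Set.Icc (0 : ℝ) 1
  measurableSet_edge : ∀ t (e : (⊤ : SimpleGraph (Fin n)).edgeSet),
    MeasurableSet {ω | (e : Sym2 (Fin n)) ∈ (𝒢 ω t).edgeSet}
  prob_edge : ∀ t (e : (⊤ : SimpleGraph (Fin n)).edgeSet),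
    P.real {ω | (e : Sym2 (Fin n)) ∈ (𝒢 ω t).edgeSet} = p t
  indep : iIndepSet (fun q : Fin T × (⊤ : SimpleGraph (Fin n)).edgeSet =>
    {ω | (q.2 : Sym2 (Fin n)) ∈ (𝒢 ω q.1).edgeSet}) P

open scoped Classical in
/-- A random vector `Y` is `σ`-subgaussian: `E exp(s ⟨u, Y⟩) ≤ exp(s² σ² / 2)` for all real `s` and
all unit vectors `u`. -/
def IsSubgaussianVec {Ω ι : Type*} [MeasurableSpace Ω] [Fintype ι] (Y : Ω → ι → ℝ) (σ : ℝ≥0)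
    (P : Measure Ω) : Prop :=
  ∀ u : ι → ℝ, sqNorm u = 1 → HasSubgaussianMGF (fun ω => u ⬝ᵥ Y ω) (σ ^ 2) P

open scoped Classical in
/-- Given the measurement graphs, the noise vector is `σ`-subgaussian. -/
structure IsSubgaussianNoise {Ω : Type*} [MeasurableSpace Ω] (P : Measure Ω) {n T : ℕ}
    (𝒢 : Ω → Fin T → SimpleGraph (Fin n)) (η : Ω → Fin T → Sym2 (Fin n) → ℝ) (σ : ℝ≥0) :
    Prop where
  measurable : ∀ t e, Measurable fun ω => η ω t e
  subgaussian : ∀ H : Fin T → SimpleGraph (Fin n), P {ω | 𝒢 ω = H} ≠ 0 →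
    IsSubgaussianVec (fun ω => noiseVec H (η ω)) σ (ProbabilityTheory.cond P {ω | 𝒢 ω = H})

open scoped Classical in
/-- All assumptions of the model: each `x_t` is centered, `‖M x‖² ≤ S` with `S > 0`, the
measurement graphs are independent Erdős-Rényi graphs, and the noise is `σ`-subgaussian. -/
structure Model {Ω : Type*} [MeasurableSpace Ω] (P : Measure Ω) {n T : ℕ}
    (G : SimpleGraph (Fin T)) (oG : EdgeOrientation G)
    (𝒢 : Ω → Fin T → SimpleGraph (Fin n)) (p : Fin T → ℝ)
    (η : Ω → Fin T → Sym2 (Fin n) → ℝ) (σ : ℝ≥0)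
    (x : Fin T × Fin n → ℝ) (S : ℝ) : Prop where
  S_pos : 0 < S
  centered : ∀ t, ∑ i, x (t, i) = 0
  smooth : sqNorm (smoothMat n G oG *ᵥ x) ≤ S
  erdosRenyi : IsErdosRenyiFamily P 𝒢 p
  noise : IsSubgaussianNoise P 𝒢 η σ

/-! ### The explicit quantities in the bounds -/

/-- `p_sum = ∑ₜ pₜ`. -/
def pSum {T : ℕ} (p : Fin T → ℝ) : ℝ := ∑ t, p t

/-- `p_max = maxₜ pₜ`. -/
noncomputable def pMax {T : ℕ} (p : Fin T → ℝ) : ℝ := ⨆ t, p t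

/-- `γ = min {√(2 n p_max) + (2 n log (n T / δ))^{1/4}, √(2 n)}`. -/
noncomputable def gam (n : ℕ) {T : ℕ} (p : Fin T → ℝ) (δ : ℝ) : ℝ :=
  min (√(2 * n * pMax p) + (2 * n * Real.log (n * T / δ)) ^ (1 / 4 : ℝ)) √(2 * n)

/-- The regularization parameter for the complete graph. -/
noncomputable def muComplete (c₂ : ℝ) (n : ℕ) {T : ℕ} (p : Fin T → ℝ) (σ S δ : ℝ) : ℝ :=
  max ((n : ℝ) ^ (2 / 3 : ℝ) * σ ^ (2 / 3 : ℝ) * gam n p δ ^ (2 / 3 : ℝ) *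
        (pSum p / ((T : ℝ) ^ 2 * S)) ^ (1 / 3 : ℝ) - n * pSum p / (T : ℝ) ^ 2)
    (c₂ / T * (n * pSum p / T + gam n p δ ^ 2))

/-- The regularization parameter for the star graph. -/
noncomputable def muStar (c₂ : ℝ) (n : ℕ) {T : ℕ} (p : Fin T → ℝ) (σ S δ : ℝ) : ℝ :=
  max ((n : ℝ) ^ (2 / 3 : ℝ) * σ ^ (2 / 3 : ℝ) * gam n p δ ^ (2 / 3 : ℝ) *
        (pSum p / S) ^ (1 / 3 : ℝ) - n * pSum p / T)
    (c₂ * (n * pSum p / T + gam n p δ ^ 2))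

/-- The error bound for the complete graph (without the factor `c₃`). -/
noncomputable def boundComplete (n : ℕ) {T : ℕ} (p : Fin T → ℝ) (σ S δ : ℝ) : ℝ :=
  S / T + gam n p δ ^ 2 / (n * pSum p) * S +
    (σ ^ (2 / 3 : ℝ) * gam n p δ ^ (2 / 3 : ℝ) * (T : ℝ) ^ (1 / 3 : ℝ) * S ^ (2 / 3 : ℝ) /
        ((n : ℝ) ^ (1 / 3 : ℝ) * pSum p ^ (2 / 3 : ℝ)) +
      σ ^ 2 * gam n p δ ^ 2 * (T : ℝ) ^ 2 / (n * pSum p ^ 2)) * Real.log (1 / δ)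

/-- The error bound for the star graph (without the factor `c₃`). -/
noncomputable def boundStar (n : ℕ) {T : ℕ} (p : Fin T → ℝ) (σ S δ : ℝ) : ℝ :=
  S + gam n p δ ^ 2 / (n * pSum p) * T * S +
    (σ ^ (2 / 3 : ℝ) * gam n p δ ^ (2 / 3 : ℝ) * T * S ^ (2 / 3 : ℝ) /
        ((n : ℝ) ^ (1 / 3 : ℝ) * pSum p ^ (2 / 3 : ℝ)) +
      σ ^ 2 * gam n p δ ^ 2 * (T : ℝ) ^ 2 / (n * pSum p ^ 2)) * Real.log (1 / δ)

end TransSync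

namespace TransSync

/-! ### Linear algebra: the pseudoinverse on the range of a projection -/

section LinearAlgebra

variable {ι m k : Type*} [Fintype ι] [Fintype m] [Fintype k]

/-! Split the centered signals into those that are constant across the layers (range of `meanProj`)
and those whose average over the layers vanishes (range of `devProj`). The penalty `μ MᵀM` vanishes
on the first part and is at least `μ λ` on the second, where `λ` is a lower bound for the spectral
gap of the layer graph: `T` for the complete graph, `1` for the star. On a constant signal `(z, …,
z)` the data term `CᵀC` is the quadratic form of the Laplacian of the union of all layers, whose
expected degrees are about `n p_sum`. Hence only the union has to be well connected, never a single
layer.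

Deterministic part (`penalized_lsq_error`). Suppose every layer Laplacian is at most `g`, their sum
is at least `κ` on centered vectors, and `2g ≤ μλ`. Then the regularised matrix `A` is at least
`κ/(2T)` on the first part and `μλ/2` on the second, cross terms included. The error is a bias `b`
plus a linear image `R η` of the noise. Testing the equation for `b` against `b` and against its
constant part gives `‖b‖² ≤ (S/λ)(1 + gT/κ)`, independently of `μ`. Moreover `‖R‖_F² ≤ g tr(A†²)`,
where at most `n` directions contribute `4(T/κ)²` each and at most `nT` directions contribute
`4/(μλ)²` each.

Probabilistic part, where each of three events fails with probability at most `δ`. One may take `g =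
γ²`, by Hoeffding's inequality for the degrees or trivially when `γ² = 2n`. One may take `κ = n
p_sum / 512` by Cheeger's inequality (`cheeger`): the cuts of the union are controlled by Chernoff's
bound and a union bound over all vertex sets. Conditionally on the graphs `R` is a fixed matrix, and
`‖Rη‖²` is at most `8σ²‖R‖_F² log(1/δ)` by a Gaussian-averaging bound on `E exp(Y²/(4σ²))`.

The first entry of the maximum defining `μ` brings the `(μλ)⁻²` term to the stated rate; the second
ensures `2g ≤ μλ` and compensates the quantity subtracted in the first.

Weak consistency: for fixed `n` and large `T` one has `γ = √(2n)` whatever `δ` is, so the estimator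
stops depending on `δ`, and the error bound may be applied to it with arbitrarily small failure
probability. -/

theorem sqNorm_eq_dotProduct (v : ι → ℝ) : sqNorm v = v ⬝ᵥ v := by
  simp [sqNorm, dotProduct, sq]

theorem sqNorm_nonneg (v : ι → ℝ) : 0 ≤ sqNorm v :=
  Finset.sum_nonneg fun _ _ => sq_nonneg _

theorem mulVec_dotProduct_eq (A : Matrix m ι ℝ) (u : ι → ℝ) (w : m → ℝ) :
    (A *ᵥ u) ⬝ᵥ w = u ⬝ᵥ (Aᵀ *ᵥ w) := by
  rw [dotProduct_comm, Matrix.dotProduct_mulVec, Matrix.mulVec_transpose, dotProduct_comm]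

theorem dotProduct_mulVec_eq (A : Matrix m ι ℝ) (u : ι → ℝ) (w : m → ℝ) :
    w ⬝ᵥ (A *ᵥ u) = (Aᵀ *ᵥ w) ⬝ᵥ u := by
  rw [dotProduct_comm, mulVec_dotProduct_eq, dotProduct_comm]

theorem sqNorm_add (u v : ι → ℝ) : sqNorm (u + v) = sqNorm u + 2 * (u ⬝ᵥ v) + sqNorm v := by
  simp only [sqNorm_eq_dotProduct, add_dotProduct, dotProduct_add]
  rw [dotProduct_comm v u]
  ring

theorem sqNorm_smul (c : ℝ) (v : ι → ℝ) : sqNorm (c • v) = c ^ 2 * sqNorm v := by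
  simp [sqNorm, mul_pow, Finset.mul_sum]

theorem two_mul_dotProduct_le (u v : ι → ℝ) {c : ℝ} (hc : 0 < c) :
    2 * (u ⬝ᵥ v) ≤ sqNorm u / c + c * sqNorm v := by
  have h := sqNorm_nonneg (u + (-c) • v)
  rw [sqNorm_add, sqNorm_smul, dotProduct_smul, smul_eq_mul] at h
  have : 0 ≤ (sqNorm u + 2 * (-c * (u ⬝ᵥ v)) + (-c) ^ 2 * sqNorm v) / c := by positivity
  have e : (sqNorm u + 2 * (-c * (u ⬝ᵥ v)) + (-c) ^ 2 * sqNorm v) / c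
      = sqNorm u / c + c * sqNorm v - 2 * (u ⬝ᵥ v) := by
    field_simp
    ring
  linarith

theorem sqNorm_add_le (u v : ι → ℝ) : sqNorm (u + v) ≤ 2 * sqNorm u + 2 * sqNorm v := by
  have := two_mul_dotProduct_le u v one_pos
  rw [sqNorm_add]
  linarith

theorem half_sqNorm_sub_le (u v : ι → ℝ) : sqNorm u / 2 - sqNorm v ≤ sqNorm (u + v) := by
  have := two_mul_dotProduct_le (-u) v (c := 2) two_pos
  have h2 : sqNorm (-u) = sqNorm u := by simp [sqNorm]
  rw [neg_dotProduct, h2] at this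
  rw [sqNorm_add]
  linarith

theorem eq_zero_of_sqNorm_eq_zero {v : ι → ℝ} (h : sqNorm v = 0) : v = 0 := by
  rw [sqNorm_eq_dotProduct] at h
  exact dotProduct_self_eq_zero.1 h

theorem dotProduct_gram_mulVec (A : Matrix m ι ℝ) (u w : ι → ℝ) :
    u ⬝ᵥ ((Aᵀ * A) *ᵥ w) = (A *ᵥ u) ⬝ᵥ (A *ᵥ w) := by
  rw [mulVec_dotProduct_eq, Matrix.mulVec_mulVec]

open scoped MatrixOrder in
-- Writing `A = K* K`, the trace equals that of the positive semidefinite matrix `K B K*`.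
theorem trace_mul_nonneg [DecidableEq ι] {A B : Matrix ι ι ℝ} (hA : A.PosSemidef)
    (hB : B.PosSemidef) : 0 ≤ (A * B).trace := by
  obtain ⟨K, rfl⟩ := CStarAlgebra.nonneg_iff_eq_star_mul_self.1 hA.nonneg
  rw [Matrix.star_eq_conjTranspose]
  rw [Matrix.mul_assoc, Matrix.trace_mul_comm]
  exact (hB.mul_mul_conjTranspose_same K).trace_nonneg

theorem pinv_transpose {A : Matrix ι ι ℝ} (hA : Aᵀ = A) : (pinv A)ᵀ = pinv A := by
  have h := pinv_spec A
  refine IsMoorePenrose.unique (A := A) ⟨?_, ?_, ?_, ?_⟩ h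
  · have := congrArg Matrix.transpose h.mul_mul_left
    simpa only [Matrix.transpose_mul, hA, Matrix.mul_assoc] using this
  · have := congrArg Matrix.transpose h.mul_mul_right
    simpa only [Matrix.transpose_mul, hA, Matrix.mul_assoc] using this
  · have := h.right_symm
    rw [Matrix.transpose_mul, hA] at this
    rw [this, h.right_symm]
  · have := h.left_symm
    rw [Matrix.transpose_mul, hA] at this
    rw [this, h.left_symm]

/-- A symmetric matrix living on the range of `P` and definite there is inverted on that range by
its pseudoinverse. Indeed `A` kills the columns of `P (1 - A†A)`, which lie in the range of `P`, so
these vanish; transposing `P A†A = P` removes the outer `P`. -/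
theorem pinv_mul_eq [DecidableEq ι] {A P : Matrix ι ι ℝ} (hA : Aᵀ = A) (hP : Pᵀ = P)
    (hPP : P * P = P) (hPA : P * A = A)
    (hker : ∀ u, P *ᵥ u = u → u ⬝ᵥ (A *ᵥ u) = 0 → u = 0) :
    pinv A * A = P ∧ A * pinv A = P := by
  have h := pinv_spec A
  have hAP : A * P = A := by
    have := congrArg Matrix.transpose hPA
    rwa [Matrix.transpose_mul, hA, hP] at this
  have hN : P * (1 - pinv A * A) = 0 := by
    have h0 : A * (P * (1 - pinv A * A)) = 0 := by
      rw [← Matrix.mul_assoc, hAP, Matrix.mul_sub, Matrix.mul_one, ← Matrix.mul_assoc,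
        h.mul_mul_left, sub_self]
    have h1 : P * (P * (1 - pinv A * A)) = P * (1 - pinv A * A) := by
      rw [← Matrix.mul_assoc, hPP]
    ext i j
    have hcol := hker (fun i => (P * (1 - pinv A * A)) i j)
      (by funext i; exact congrFun (congrFun h1 i) j)
      (by
        have : A *ᵥ (fun i => (P * (1 - pinv A * A)) i j) = 0 := by
          funext i; exact congrFun (congrFun h0 i) j
        rw [this, dotProduct_zero])
    exact congrFun hcol i
  have h1 : P * (pinv A * A) = P := by
    rw [Matrix.mul_sub, Matrix.mul_one, sub_eq_zero] at hN
    exact hN.symm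
  have h2 : pinv A * A = P := by
    have := congrArg Matrix.transpose h1
    rwa [Matrix.transpose_mul, h.right_symm, hP, Matrix.mul_assoc, hAP] at this
  refine ⟨h2, ?_⟩
  have := congrArg Matrix.transpose h2
  rwa [Matrix.transpose_mul, hA, pinv_transpose hA, hP] at this

/-- A comparison `a Q + b Q' ≤ A` on the range of `Q + Q'` controls the Frobenius norm of `A†`. -/
theorem trace_pinv_sq_le [DecidableEq ι] {A Q Q' : Matrix ι ι ℝ} {a b : ℝ} (ha : 0 < a)
    (hb : 0 < b) (hA : Aᵀ = A) (hQ : Qᵀ = Q) (hQ' : Q'ᵀ = Q') (hQQ : Q * Q = Q)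
    (hQQ' : Q' * Q' = Q') (hQ0 : Q * Q' = 0) (hXA : pinv A * A = Q + Q')
    (hlow : ∀ u, a * sqNorm (Q *ᵥ u) + b * sqNorm (Q' *ᵥ u) ≤ u ⬝ᵥ (A *ᵥ u)) :
    (pinv A * pinv A).trace ≤ Q.trace / a ^ 2 + Q'.trace / b ^ 2 := by
  set X := pinv A with hX
  have hXs : Xᵀ = X := pinv_transpose hA
  have hQ0' : Q' * Q = 0 := by
    have := congrArg Matrix.transpose hQ0
    rwa [Matrix.transpose_mul, hQ, hQ', Matrix.transpose_zero] at this
  set Z : Matrix ι ι ℝ := a⁻¹ • Q + b⁻¹ • Q' with hZ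
  have hqQ : ∀ e u : ι → ℝ, e ⬝ᵥ (Q *ᵥ u) = (Q *ᵥ e) ⬝ᵥ (Q *ᵥ u) := by
    intro e u
    rw [mulVec_dotProduct_eq, hQ, Matrix.mulVec_mulVec, hQQ]
  have hqQ' : ∀ e u : ι → ℝ, e ⬝ᵥ (Q' *ᵥ u) = (Q' *ᵥ e) ⬝ᵥ (Q' *ᵥ u) := by
    intro e u
    rw [mulVec_dotProduct_eq, hQ', Matrix.mulVec_mulVec, hQQ']
  have hquad : ∀ e, e ⬝ᵥ (X *ᵥ e) = (X *ᵥ e) ⬝ᵥ (A *ᵥ (X *ᵥ e)) := by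
    intro e
    rw [mulVec_dotProduct_eq, hXs, Matrix.mulVec_mulVec, Matrix.mulVec_mulVec,
      (pinv_spec A).mul_mul_right]
  have hXpsd : X.PosSemidef := by
    refine Matrix.PosSemidef.of_dotProduct_mulVec_nonneg (by simpa [Matrix.IsHermitian] using hXs) ?_
    intro e
    rw [star_trivial, hquad]
    exact le_trans (add_nonneg (mul_nonneg ha.le (sqNorm_nonneg _))
      (mul_nonneg hb.le (sqNorm_nonneg _))) (hlow _)
  have hZe : ∀ e, e ⬝ᵥ (Z *ᵥ e) = sqNorm (Q *ᵥ e) / a + sqNorm (Q' *ᵥ e) / b := by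
    intro e
    rw [hZ, Matrix.add_mulVec, dotProduct_add, Matrix.smul_mulVec, Matrix.smul_mulVec,
      dotProduct_smul, dotProduct_smul, hqQ, hqQ', ← sqNorm_eq_dotProduct, ← sqNorm_eq_dotProduct,
      smul_eq_mul, smul_eq_mul]
    ring
  have hZs : Zᵀ = Z := by simp [hZ, hQ, hQ']
  have hZpsd : Z.PosSemidef := by
    refine Matrix.PosSemidef.of_dotProduct_mulVec_nonneg (by simpa [Matrix.IsHermitian] using hZs) ?_
    intro e
    rw [star_trivial, hZe]
    have := sqNorm_nonneg (Q *ᵥ e)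
    have := sqNorm_nonneg (Q' *ᵥ e)
    positivity
  -- Inversion reverses the operator order: `X ≤ Z`. Young's inequality with weights `a`, `b` bounds
  -- `2⟨e, Xe⟩` by `⟨e, Ze⟩` plus a form which `hlow`, evaluated at `Xe`, bounds by `⟨e, Xe⟩`.
  have hDpsd : (Z - X).PosSemidef := by
    refine Matrix.PosSemidef.of_dotProduct_mulVec_nonneg
      (by simp [Matrix.IsHermitian, hXs, hZs]) ?_
    intro e
    rw [star_trivial, Matrix.sub_mulVec, dotProduct_sub, hZe]
    have h1 : e ⬝ᵥ (X *ᵥ e) = (Q *ᵥ e) ⬝ᵥ (Q *ᵥ (X *ᵥ e)) + (Q' *ᵥ e) ⬝ᵥ (Q' *ᵥ (X *ᵥ e)) := by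
      rw [← hqQ, ← hqQ', ← dotProduct_add, ← Matrix.add_mulVec, ← hXA, Matrix.mulVec_mulVec,
        (pinv_spec A).mul_mul_right]
    have h2 := hlow (X *ᵥ e)
    rw [← hquad] at h2
    have h3 := two_mul_dotProduct_le (Q *ᵥ e) (Q *ᵥ (X *ᵥ e)) ha
    have h4 := two_mul_dotProduct_le (Q' *ᵥ e) (Q' *ᵥ (X *ᵥ e)) hb
    linarith
  -- Squaring is not operator monotone, but the traces are ordered: `tr X² ≤ tr XZ ≤ tr Z²`.
  have t1 := trace_mul_nonneg hXpsd hDpsd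
  have t2 := trace_mul_nonneg hZpsd hDpsd
  rw [Matrix.mul_sub, Matrix.trace_sub] at t1 t2
  have t3 : (X * Z).trace = (Z * X).trace := Matrix.trace_mul_comm _ _
  have t4 : (Z * Z).trace = Q.trace / a ^ 2 + Q'.trace / b ^ 2 := by
    rw [hZ]
    simp only [Matrix.add_mul, Matrix.mul_add, Matrix.smul_mul, Matrix.mul_smul, hQQ, hQQ', hQ0,
      hQ0', smul_zero, Matrix.trace_add, Matrix.trace_smul, smul_eq_mul, Matrix.trace_zero]
    field_simp
    ring
  linarith

/-- The sum of the squared norms of the rows of a matrix. -/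
def frobSq (R : Matrix ι m ℝ) : ℝ := ∑ i, sqNorm (R i)

/-- Row `i` of `X Cᵀ` is `C` applied to row `i` of `X`, and for symmetric `X` the squared norms of
the rows add up to `tr X²`. -/
theorem frobSq_mul_transpose_le {X : Matrix ι ι ℝ} {C : Matrix m ι ℝ} {g : ℝ} (hX : Xᵀ = X)
    (hC : ∀ u, sqNorm (C *ᵥ u) ≤ g * sqNorm u) :
    frobSq (X * Cᵀ) ≤ g * (X * X).trace := by
  have hrow : ∀ i, (X * Cᵀ) i = C *ᵥ (X i) := by
    intro i
    funext j
    simp [Matrix.mul_apply, Matrix.mulVec, dotProduct, mul_comm]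
  have htr : (X * X).trace = ∑ i, sqNorm (X i) := by
    simp only [Matrix.trace, Matrix.diag, Matrix.mul_apply, sqNorm]
    refine Finset.sum_congr rfl fun i _ => Finset.sum_congr rfl fun j _ => ?_
    rw [sq]
    congr 1
    exact congrFun (congrFun hX.symm j) i
  rw [htr, Finset.mul_sum, frobSq]
  refine Finset.sum_le_sum fun i _ => ?_
  rw [hrow]
  exact hC _

/-- Deterministic error analysis of the penalised least squares estimator: a bias term, plus a
linear image of the noise whose Frobenius norm is controlled. -/
theorem penalized_lsq_error [DecidableEq ι] {P Q Q' : Matrix ι ι ℝ} {M : Matrix k ι ℝ}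
    {C : Matrix m ι ℝ} {μ lam g κ S : ℝ} (hlam : 0 < lam) (hκ : 0 < κ) (hμ : 0 < μ)
    (hg0 : 0 ≤ g) (hg : 2 * g ≤ μ * lam) (hQ : Qᵀ = Q) (hQ' : Q'ᵀ = Q') (hQQ : Q * Q = Q)
    (hQQ' : Q' * Q' = Q') (hQ0 : Q * Q' = 0) (hP : P = Q + Q') (hCP : C * P = C)
    (hMQ : M * Q = 0) (hM : ∀ u, P *ᵥ u = u → lam * sqNorm (Q' *ᵥ u) ≤ sqNorm (M *ᵥ u))
    (hC : ∀ u, sqNorm (C *ᵥ u) ≤ g * sqNorm u)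
    (hCQ : ∀ u, κ * sqNorm (Q *ᵥ u) ≤ sqNorm (C *ᵥ (Q *ᵥ u)))
    {x : ι → ℝ} (hx : P *ᵥ x = x) (hS : sqNorm (M *ᵥ x) ≤ S) :
    ∃ b : ι → ℝ, sqNorm b ≤ S / lam * (1 + g / κ) ∧
      ∃ R : Matrix ι m ℝ,
        R = pinv (P * (μ • (Mᵀ * M) + Cᵀ * C) * P) * Cᵀ ∧
        (∀ η : m → ℝ, R *ᵥ (C *ᵥ x + η) - x = b + R *ᵥ η) ∧
        frobSq R ≤ g * (4 * Q.trace / κ ^ 2 + 4 * Q'.trace / (μ * lam) ^ 2) := by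
  have hQ0' : Q' * Q = 0 := by
    have := congrArg Matrix.transpose hQ0
    rwa [Matrix.transpose_mul, hQ, hQ', Matrix.transpose_zero] at this
  have hPs : Pᵀ = P := by rw [hP, Matrix.transpose_add, hQ, hQ']
  have hPP : P * P = P := by
    rw [hP, Matrix.mul_add, Matrix.add_mul, Matrix.add_mul, hQQ, hQQ', hQ0, hQ0', add_zero,
      zero_add]
  have hQP : Q * P = Q := by rw [hP, Matrix.mul_add, hQQ, hQ0, add_zero]
  have hQP' : Q' * P = Q' := by rw [hP, Matrix.mul_add, hQQ', hQ0', zero_add]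
  have hPQ : P * Q = Q := by rw [hP, Matrix.add_mul, hQQ, hQ0', add_zero]
  have hPCt : P * Cᵀ = Cᵀ := by
    have := congrArg Matrix.transpose hCP
    rwa [Matrix.transpose_mul, hPs] at this
  set A := P * (μ • (Mᵀ * M) + Cᵀ * C) * P with hAdef
  have hAs : Aᵀ = A := by
    simp only [hAdef, Matrix.transpose_mul, Matrix.transpose_add, Matrix.transpose_smul, hPs,
      Matrix.transpose_transpose, Matrix.mul_assoc]
  have hPA : P * A = A := by
    rw [hAdef, ← Matrix.mul_assoc, ← Matrix.mul_assoc, hPP]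
  have hAbil : ∀ u w, u ⬝ᵥ (A *ᵥ w) =
      μ * ((M *ᵥ (P *ᵥ u)) ⬝ᵥ (M *ᵥ (P *ᵥ w))) + (C *ᵥ u) ⬝ᵥ (C *ᵥ w) := by
    intro u w
    have hc : ∀ u, C *ᵥ u = C *ᵥ (P *ᵥ u) := fun u => by rw [Matrix.mulVec_mulVec, hCP]
    rw [hc u, hc w, hAdef, ← Matrix.mulVec_mulVec, ← Matrix.mulVec_mulVec, dotProduct_mulVec_eq,
      hPs, Matrix.add_mulVec, dotProduct_add, Matrix.smul_mulVec, dotProduct_smul,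
      dotProduct_gram_mulVec, dotProduct_gram_mulVec, smul_eq_mul]
  have hsplit : ∀ u, C *ᵥ u = C *ᵥ (Q *ᵥ u) + C *ᵥ (Q' *ᵥ u) := by
    intro u
    rw [← Matrix.mulVec_add, ← Matrix.add_mulVec, ← hP, Matrix.mulVec_mulVec, hCP]
  have hnQ' : ∀ u, sqNorm (C *ᵥ (Q' *ᵥ u)) ≤ g * sqNorm (Q' *ᵥ u) := fun u => hC _
  -- The cross term between `CQu` and `CQ'u` costs half of `‖CQu‖²` and at most `g‖Q'u‖²`; the
  -- latter is half of what the penalty provides, by `2g ≤ μλ`.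
  have hlow : ∀ u, κ / 2 * sqNorm (Q *ᵥ u) + μ * lam / 2 * sqNorm (Q' *ᵥ u) ≤
      u ⬝ᵥ (A *ᵥ u) := by
    intro u
    rw [hAbil, ← sqNorm_eq_dotProduct, ← sqNorm_eq_dotProduct]
    have h1 := hM (P *ᵥ u) (by rw [Matrix.mulVec_mulVec, hPP])
    rw [Matrix.mulVec_mulVec u Q' P, hQP'] at h1
    have h2 := half_sqNorm_sub_le (C *ᵥ (Q *ᵥ u)) (C *ᵥ (Q' *ᵥ u))
    rw [← hsplit] at h2
    have h3 := hnQ' u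
    have h4 := hCQ u
    have h5 := mul_le_mul_of_nonneg_left h1 hμ.le
    have h6 := mul_le_mul_of_nonneg_right hg (sqNorm_nonneg (Q' *ᵥ u))
    linarith
  have hμl : 0 < μ * lam := mul_pos hμ hlam
  have hker : ∀ u, P *ᵥ u = u → u ⬝ᵥ (A *ᵥ u) = 0 → u = 0 := by
    intro u hu h0
    have h1 := hlow u
    rw [h0] at h1
    have n1 := mul_nonneg (half_pos hκ).le (sqNorm_nonneg (Q *ᵥ u))
    have n2 := mul_nonneg (half_pos hμl).le (sqNorm_nonneg (Q' *ᵥ u))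
    have z1 : sqNorm (Q *ᵥ u) = 0 := by
      have : κ / 2 * sqNorm (Q *ᵥ u) = 0 := by linarith
      exact (mul_eq_zero.1 this).resolve_left (half_pos hκ).ne'
    have z2 : sqNorm (Q' *ᵥ u) = 0 := by
      have : μ * lam / 2 * sqNorm (Q' *ᵥ u) = 0 := by linarith
      exact (mul_eq_zero.1 this).resolve_left (half_pos hμl).ne'
    rw [← hu, hP, Matrix.add_mulVec, eq_zero_of_sqNorm_eq_zero z1, eq_zero_of_sqNorm_eq_zero z2,
      add_zero]
  obtain ⟨hXA, hAX⟩ := pinv_mul_eq hAs hPs hPP hPA hker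
  have hXs := pinv_transpose hAs
  set X := pinv A with hX
  have hXP : X * P = X := by rw [← hAX, ← Matrix.mul_assoc]; exact (pinv_spec A).mul_mul_right
  have hPX : P * X = X := by rw [← hXA]; exact (pinv_spec A).mul_mul_right
  -- The bias: `b` solves `A b = -μ P MᵀM x`, which `hAb` records in weak form.
  set b : ι → ℝ := -(μ • (X *ᵥ (Mᵀ *ᵥ (M *ᵥ x)))) with hb
  have hPb : P *ᵥ b = b := by
    rw [hb, Matrix.mulVec_neg, Matrix.mulVec_smul, Matrix.mulVec_mulVec, hPX]
  have hAb : ∀ w, P *ᵥ w = w → w ⬝ᵥ (A *ᵥ b) = -(μ * ((M *ᵥ w) ⬝ᵥ (M *ᵥ x))) := by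
    intro w hw
    rw [hb, Matrix.mulVec_neg, Matrix.mulVec_smul, Matrix.mulVec_mulVec, hAX, dotProduct_neg,
      dotProduct_smul, smul_eq_mul, dotProduct_mulVec_eq, hPs, hw, mulVec_dotProduct_eq]
  refine ⟨b, ?_, X * Cᵀ, rfl, ?_, ?_⟩
  -- Testing against `b` itself: `μ‖Mb‖² + ‖Cb‖² = -μ⟨Mb, Mx⟩`, so `‖Mb‖² ≤ S`, and the gap of `M`
  -- controls `Q'b`.
  · have e1 := hAb b hPb
    rw [hAbil, hPb, ← sqNorm_eq_dotProduct, ← sqNorm_eq_dotProduct] at e1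
    have hMb : sqNorm (M *ᵥ b) ≤ S := by
      have h1 := two_mul_dotProduct_le (-(M *ᵥ b)) (M *ᵥ x) one_pos
      have h2 : sqNorm (-(M *ᵥ b)) = sqNorm (M *ᵥ b) := by simp [sqNorm]
      rw [h2, neg_dotProduct] at h1
      have h3 : μ * (sqNorm (M *ᵥ b) + (M *ᵥ b) ⬝ᵥ (M *ᵥ x)) ≤ 0 := by
        have := sqNorm_nonneg (C *ᵥ b)
        linarith
      have h4 : sqNorm (M *ᵥ b) + (M *ᵥ b) ⬝ᵥ (M *ᵥ x) ≤ 0 := by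
        by_contra hcon
        have := mul_pos hμ (not_le.1 hcon)
        linarith
      linarith
    have hb1 : sqNorm (Q' *ᵥ b) ≤ S / lam := by
      rw [le_div_iff₀ hlam]
      linarith [hM b hPb]
    -- Testing against `Qb`, which `M` kills: `CQb` is orthogonal to `CQb + CQ'b`. Hence `‖CQb‖² ≤
    -- ‖CQ'b‖²`, which transfers the bound on `Q'b` to `Qb`.
    have e2 := hAb (Q *ᵥ b) (by rw [Matrix.mulVec_mulVec, hPQ])
    rw [hAbil, Matrix.mulVec_mulVec b P Q, hPQ, Matrix.mulVec_mulVec b M Q, hMQ,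
      Matrix.zero_mulVec, zero_dotProduct, zero_dotProduct, mul_zero, neg_zero, zero_add,
      hsplit b, dotProduct_add, ← sqNorm_eq_dotProduct] at e2
    have hCQb : sqNorm (C *ᵥ (Q *ᵥ b)) ≤ g * sqNorm (Q' *ᵥ b) := by
      have h1 := two_mul_dotProduct_le (-(C *ᵥ (Q *ᵥ b))) (C *ᵥ (Q' *ᵥ b)) one_pos
      have h2 : sqNorm (-(C *ᵥ (Q *ᵥ b))) = sqNorm (C *ᵥ (Q *ᵥ b)) := by simp [sqNorm]
      rw [h2, neg_dotProduct] at h1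
      have := hnQ' b
      linarith
    have hb2 : sqNorm (Q *ᵥ b) ≤ g / κ * sqNorm (Q' *ᵥ b) := by
      rw [div_mul_eq_mul_div, le_div_iff₀ hκ]
      linarith [hCQ b]
    have hbb : sqNorm b = sqNorm (Q *ᵥ b) + sqNorm (Q' *ᵥ b) := by
      conv_lhs => rw [← hPb, hP, Matrix.add_mulVec]
      rw [sqNorm_add, mulVec_dotProduct_eq, hQ, Matrix.mulVec_mulVec, hQ0, Matrix.zero_mulVec,
        dotProduct_zero]
      ring
    have : g / κ * sqNorm (Q' *ᵥ b) ≤ g / κ * (S / lam) :=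
      mul_le_mul_of_nonneg_left hb1 (by positivity)
    rw [hbb]
    linarith
  · intro η
    -- Expanding `x = X A x` gives `X CᵀC x - x = -μ X MᵀM x = b`.
    have hAx : X *ᵥ (A *ᵥ x) = x := by rw [Matrix.mulVec_mulVec, hXA, hx]
    have hA2 : X *ᵥ (A *ᵥ x) = μ • (X *ᵥ (Mᵀ *ᵥ (M *ᵥ x))) + (X * Cᵀ) *ᵥ (C *ᵥ x) := by
      rw [hAdef, ← Matrix.mulVec_mulVec, hx, ← Matrix.mulVec_mulVec, Matrix.mulVec_mulVec, hXP,
        Matrix.add_mulVec, Matrix.mulVec_add, Matrix.smul_mulVec, Matrix.mulVec_smul]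
      simp only [Matrix.mulVec_mulVec, Matrix.mul_assoc]
    rw [Matrix.mulVec_add, hb, ← sub_eq_zero]
    rw [hAx] at hA2
    conv_lhs => rw [add_sub_right_comm]
    nth_rewrite 2 [hA2]
    abel
  · refine (frobSq_mul_transpose_le hXs hC).trans (mul_le_mul_of_nonneg_left ?_ hg0)
    have h1 := trace_pinv_sq_le (half_pos hκ) (half_pos hμl) hAs hQ hQ' hQQ hQQ' hQ0
      (hXA.trans hP) hlow
    have e : ∀ c t : ℝ, t / (c / 2) ^ 2 = 4 * t / c ^ 2 := by
      intro c t
      rw [div_pow, div_div_eq_mul_div, mul_comm]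
      norm_num
    rwa [e, e] at h1

end LinearAlgebra

/-! ### Cheeger's inequality for weighted graphs -/

section Cheeger

variable {V : Type*} [Fintype V] [DecidableEq V]

/-- The co-area inequality: a lower bound on the cuts of small sets bounds the total variation of
nonnegative functions with small support. -/
theorem coarea_le {w : V → V → ℝ} (hsymm : ∀ u v, w u v = w v u) {h : ℝ}
    (hcut : ∀ A : Finset V, 2 * A.card ≤ Fintype.card V →
      h * A.card ≤ ∑ u ∈ A, ∑ v ∈ Aᶜ, w u v) (k : ℕ) :
    ∀ φ : V → ℝ, (∀ u, 0 ≤ φ u) → (Finset.univ.filter fun u => 0 < φ u).card ≤ k →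
      2 * (Finset.univ.filter fun u => 0 < φ u).card ≤ Fintype.card V →
      2 * (h * ∑ u, φ u) ≤ ∑ u, ∑ v, w u v * |φ u - φ v| := by
  induction k with
  | zero =>
    intro φ h0 hk _
    have hz : ∀ u, φ u = 0 := by
      intro u
      by_contra hne
      have hmem : u ∈ Finset.univ.filter fun u => 0 < φ u := by
        simpa using lt_of_le_of_ne (h0 u) (Ne.symm hne)
      rw [Finset.card_eq_zero.1 (Nat.le_zero.1 hk)] at hmem
      simp at hmem
    simp [hz]
  | succ k ih =>
    intro φ h0 hk hhalf
    set A := Finset.univ.filter fun u => 0 < φ u with hA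
    have hmA : ∀ u, u ∈ A ↔ 0 < φ u := by simp [hA]
    rcases A.eq_empty_or_nonempty with hemp | hne
    · have hz : ∀ u, φ u = 0 := by
        intro u
        by_contra hne
        have : u ∈ A := (hmA u).2 (lt_of_le_of_ne (h0 u) (Ne.symm hne))
        simp [hemp] at this
      simp [hz]
    obtain ⟨a, haA, hmin⟩ := A.exists_min_image φ hne
    have hout : ∀ u, u ∉ A → φ u = 0 := fun u hu =>
      le_antisymm (not_lt.1 fun hc => hu ((hmA u).2 hc)) (h0 u)
    have ha0 : 0 < φ a := (hmA a).1 haA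
    -- Peel off the lowest level set: `φ = ψ + φ(a) 1_A`, where `ψ ≥ 0` has strictly smaller
    -- support. Total variation is additive in this decomposition (`habs`), and that of `1_A` is
    -- twice the cut of `A`, since ordered pairs count every edge twice.
    set ψ : V → ℝ := fun u => φ u - if u ∈ A then φ a else 0 with hψ
    have hψ0 : ∀ u, 0 ≤ ψ u := by
      intro u
      by_cases hu : u ∈ A
      · simpa [hψ, hu] using hmin u hu
      · simp [hψ, hu, h0 u]
    have hsub : (Finset.univ.filter fun u => 0 < ψ u) ⊆ A.erase a := by
      intro u hu
      have hu : 0 < ψ u := by simpa using hu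
      by_cases huA : u ∈ A
      · refine Finset.mem_erase.2 ⟨?_, huA⟩
        rintro rfl
        simp [hψ, huA] at hu
      · simp [hψ, huA, hout u huA] at hu
    have hcard := Finset.card_le_card hsub
    rw [Finset.card_erase_of_mem haA] at hcard
    have hApos : 0 < A.card := hne.card_pos
    have key := ih ψ hψ0 (by omega) (by omega)
    have habs : ∀ u v, |φ u - φ v| = |ψ u - ψ v| +
        φ a * ((if u ∈ A then if v ∈ A then 0 else 1 else 0) +
          (if v ∈ A then if u ∈ A then 0 else 1 else 0)) := by
      intro u v
      by_cases hu : u ∈ A <;> by_cases hv : v ∈ A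
      · simp [hψ, hu, hv]
      · have := hmin u hu
        simp only [hψ, hu, hv, hout v hv, if_true, if_false]
        rw [abs_of_nonneg (by linarith), abs_of_nonneg (by linarith)]
        ring
      · have := hmin v hv
        simp only [hψ, hu, hv, hout u hu, if_true, if_false]
        rw [abs_of_nonpos (by linarith), abs_of_nonpos (by linarith)]
        ring
      · simp [hψ, hu, hv]
    have hind : ∑ u, ∑ v, w u v * (if u ∈ A then if v ∈ A then (0 : ℝ) else 1 else 0)
        = ∑ u ∈ A, ∑ v ∈ Aᶜ, w u v := by
      rw [← Finset.sum_filter_add_sum_filter_not Finset.univ (fun u => u ∈ A)]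
      have e1 : (Finset.univ.filter fun u => u ∈ A) = A := by ext; simp
      rw [e1, Finset.sum_eq_zero (s := Finset.univ.filter fun u => u ∉ A), add_zero]
      · refine Finset.sum_congr rfl fun u hu => ?_
        rw [← Finset.sum_filter_add_sum_filter_not Finset.univ (fun u => u ∈ A)]
        have e2 : (Finset.univ.filter fun u => u ∉ A) = Aᶜ := by ext; simp
        rw [e1, e2, Finset.sum_eq_zero (s := A), zero_add]
        · refine Finset.sum_congr rfl fun v hv => ?_
          have := Finset.mem_compl.1 hv
          simp [hu, this]
        · intro v hv
          simp [hu, hv]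
      · intro u hu
        have : u ∉ A := by simpa using hu
        simp [this]
    have hind' : ∑ u, ∑ v, w u v * (if v ∈ A then if u ∈ A then (0 : ℝ) else 1 else 0)
        = ∑ u ∈ A, ∑ v ∈ Aᶜ, w u v := by
      rw [Finset.sum_comm, ← hind]
      exact Finset.sum_congr rfl fun u _ => Finset.sum_congr rfl fun v _ => by rw [hsymm]
    have hsum : ∑ u, φ u = ∑ u, ψ u + φ a * A.card := by
      simp [hψ, Finset.sum_sub_distrib, Finset.sum_ite_mem, mul_comm]
    have htv : ∑ u, ∑ v, w u v * |φ u - φ v| = ∑ u, ∑ v, w u v * |ψ u - ψ v| +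
        2 * (φ a * ∑ u ∈ A, ∑ v ∈ Aᶜ, w u v) := by
      rw [two_mul]
      nth_rewrite 1 [← hind]
      rw [← hind', Finset.mul_sum, Finset.mul_sum, ← Finset.sum_add_distrib,
        ← Finset.sum_add_distrib]
      refine Finset.sum_congr rfl fun u _ => ?_
      rw [Finset.mul_sum, Finset.mul_sum, ← Finset.sum_add_distrib, ← Finset.sum_add_distrib]
      refine Finset.sum_congr rfl fun v _ => ?_
      rw [habs]
      ring
    have hc := mul_le_mul_of_nonneg_left (hcut A hhalf) ha0.le
    rw [htv, hsum]
    linarith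

/-- Apply the co-area inequality to `g²`. Since `|g u² - g v²| = |g u - g v| |g u + g v|`,
Cauchy-Schwarz bounds its total variation by the energy of `g` times `4 d ∑ g²`; one factor `∑ g²`
then cancels. -/
theorem energy_ge_of_small_support {w : V → V → ℝ} (hw : ∀ u v, 0 ≤ w u v)
    (hsymm : ∀ u v, w u v = w v u) {h d : ℝ} (hh : 0 ≤ h)
    (hcut : ∀ A : Finset V, 2 * A.card ≤ Fintype.card V →
      h * A.card ≤ ∑ u ∈ A, ∑ v ∈ Aᶜ, w u v) (hdeg : ∀ u, ∑ v, w u v ≤ d)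
    {g : V → ℝ} (hg : ∀ u, 0 ≤ g u)
    (hsupp : 2 * (Finset.univ.filter fun u => 0 < g u).card ≤ Fintype.card V) :
    h ^ 2 * ∑ u, g u ^ 2 ≤ d * ∑ u, ∑ v, w u v * (g u - g v) ^ 2 := by
  have hsupp' : (Finset.univ.filter fun u => 0 < g u ^ 2) = Finset.univ.filter fun u => 0 < g u := by
    ext u
    simp only [Finset.mem_filter, Finset.mem_univ, true_and]
    exact ⟨fun hu => lt_of_le_of_ne (hg u) fun h0 => by simp [← h0] at hu, fun hu => by positivity⟩
  have h1 := coarea_le hsymm hcut _ (fun u => g u ^ 2) (fun u => sq_nonneg _) le_rfl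
    (by rw [hsupp']; exact hsupp)
  set N := ∑ u, g u ^ 2
  have hN : 0 ≤ N := Finset.sum_nonneg fun _ _ => sq_nonneg _
  set E := ∑ u, ∑ v, w u v * (g u - g v) ^ 2
  have hE : 0 ≤ E := Finset.sum_nonneg fun _ _ => Finset.sum_nonneg fun _ _ =>
    mul_nonneg (hw _ _) (sq_nonneg _)
  set B := ∑ u, ∑ v, w u v * |g u ^ 2 - g v ^ 2|
  have hCS : B ^ 2 ≤ E * ∑ u, ∑ v, w u v * (g u + g v) ^ 2 := by
    simp only [B, E, ← Finset.sum_product']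
    refine Finset.sum_sq_le_sum_mul_sum_of_sq_le_mul _ (fun i _ => mul_nonneg (hw _ _) (sq_nonneg _))
      (fun i _ => mul_nonneg (hw _ _) (sq_nonneg _)) fun i _ => ?_
    rw [mul_pow, sq_abs]
    exact le_of_eq (by ring)
  have hsum : ∑ u, ∑ v, w u v * (g u + g v) ^ 2 ≤ 4 * d * N := by
    have e1 : ∑ u, ∑ v, w u v * g u ^ 2 ≤ d * N := by
      rw [Finset.mul_sum]
      refine Finset.sum_le_sum fun u _ => ?_
      rw [← Finset.sum_mul]
      exact mul_le_mul_of_nonneg_right (hdeg u) (sq_nonneg _)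
    have e2 : ∑ u, ∑ v, w u v * g v ^ 2 ≤ d * N := by
      rw [Finset.sum_comm]
      refine le_trans (le_of_eq ?_) e1
      exact Finset.sum_congr rfl fun u _ => Finset.sum_congr rfl fun v _ => by rw [hsymm]
    calc ∑ u, ∑ v, w u v * (g u + g v) ^ 2
        ≤ ∑ u, ∑ v, (2 * (w u v * g u ^ 2) + 2 * (w u v * g v ^ 2)) := by
          refine Finset.sum_le_sum fun u _ => Finset.sum_le_sum fun v _ => ?_
          have := mul_nonneg (hw u v) (sq_nonneg (g u - g v))
          linarith
      _ = 2 * ∑ u, ∑ v, w u v * g u ^ 2 + 2 * ∑ u, ∑ v, w u v * g v ^ 2 := by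
          simp only [Finset.sum_add_distrib, Finset.mul_sum]
      _ ≤ 4 * d * N := by linarith
  rcases hN.eq_or_lt with h0 | hNpos
  -- No cancellation is possible here; it remains to see that `d ≥ 0`, which follows from any single
  -- degree bound.
  · rw [← h0, mul_zero]
    have hd : N = 0 := h0.symm
    by_cases hemp : IsEmpty V
    · simp [E]
    · rw [not_isEmpty_iff] at hemp
      exact mul_nonneg ((Finset.sum_nonneg fun v _ => hw hemp.some v).trans (hdeg hemp.some)) hE
  · have h3 : (2 * (h * N)) ^ 2 ≤ E * (4 * d * N) :=
      (pow_le_pow_left₀ (by positivity) h1 2).trans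
        (hCS.trans (mul_le_mul_of_nonneg_left hsum hE))
    have h4 : (h ^ 2 * N) * (4 * N) ≤ (d * E) * (4 * N) := by linarith
    exact le_of_mul_le_mul_right h4 (by positivity)

-- Take the least value `f a` below or at which at least half of the points lie. If more than half
-- lay strictly below it, the largest value among those would be a smaller admissible choice.
omit [DecidableEq V] in
theorem exists_median (f : V → ℝ) : ∃ m : ℝ,
    2 * (Finset.univ.filter fun u => m < f u).card ≤ Fintype.card V ∧
    2 * (Finset.univ.filter fun u => f u < m).card ≤ Fintype.card V := by
  rcases isEmpty_or_nonempty V with hV | hV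
  · exact ⟨0, by simp, by simp⟩
  set s := Finset.univ.filter fun u =>
    Fintype.card V ≤ 2 * (Finset.univ.filter fun v => f v ≤ f u).card with hs
  have hne : s.Nonempty := by
    obtain ⟨a, -, ha⟩ := Finset.univ.exists_max_image f Finset.univ_nonempty
    refine ⟨a, ?_⟩
    have : (Finset.univ.filter fun v => f v ≤ f a) = Finset.univ :=
      Finset.filter_true_of_mem fun v hv => ha v hv
    simp only [hs, Finset.mem_filter, Finset.mem_univ, true_and, this, Finset.card_univ]
    omega
  obtain ⟨a, has, hmin⟩ := s.exists_min_image f hne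
  refine ⟨f a, ?_, ?_⟩
  · have h1 : Fintype.card V ≤ 2 * (Finset.univ.filter fun v => f v ≤ f a).card := by
      simpa [hs] using has
    have h2 := Finset.card_filter_add_card_filter_not (s := (Finset.univ : Finset V))
      (fun v => f v ≤ f a)
    simp only [not_le, Finset.card_univ] at h2
    omega
  · by_contra hcon
    have hne2 : (Finset.univ.filter fun u => f u < f a).Nonempty := by
      rw [← Finset.card_pos]
      omega
    obtain ⟨b, hb, hmax⟩ := Finset.exists_max_image _ f hne2
    have hba : f b < f a := by simpa using hb
    have hsub : (Finset.univ.filter fun u => f u < f a) ⊆ Finset.univ.filter fun u => f u ≤ f b :=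
      fun u hu => by simpa using hmax u hu
    have := Finset.card_le_card hsub
    have hbs : b ∈ s := by
      simp only [hs, Finset.mem_filter, Finset.mem_univ, true_and]
      omega
    exact absurd (hmin b hbs) (not_le.2 hba)

/-- **Cheeger's inequality**, for a weighted graph with edge expansion at least `h` and weighted
degrees at most `d`. -/
theorem cheeger {w : V → V → ℝ} (hw : ∀ u v, 0 ≤ w u v)
    (hsymm : ∀ u v, w u v = w v u) {h d : ℝ} (hh : 0 ≤ h) (hd : 0 ≤ d)
    (hcut : ∀ A : Finset V, 2 * A.card ≤ Fintype.card V →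
      h * A.card ≤ ∑ u ∈ A, ∑ v ∈ Aᶜ, w u v) (hdeg : ∀ u, ∑ v, w u v ≤ d)
    {f : V → ℝ} (hf : ∑ u, f u = 0) :
    h ^ 2 * ∑ u, f u ^ 2 ≤ d * ∑ u, ∑ v, w u v * (f u - f v) ^ 2 := by
  -- The positive and negative parts of `f - m` are both supported on at most half of the vertices.
  -- Their energies add up to at most that of `f`, and since `f` has mean zero, shifting by `m` can
  -- only increase `∑ f²`.
  obtain ⟨m, hm1, hm2⟩ := exists_median f
  have h1 := energy_ge_of_small_support hw hsymm hh hcut hdeg (g := fun u => max (f u - m) 0)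
    (fun u => le_max_right _ _) (by simpa using hm1)
  have h2 := energy_ge_of_small_support hw hsymm hh hcut hdeg (g := fun u => max (m - f u) 0)
    (fun u => le_max_right _ _) (by simpa using hm2)
  have hsq : ∀ u, (f u - m) ^ 2 = max (f u - m) 0 ^ 2 + max (m - f u) 0 ^ 2 := by
    intro u
    rcases le_total (f u) m with hu | hu
    · rw [max_eq_right (by linarith), max_eq_left (by linarith)]; ring
    · rw [max_eq_left (by linarith), max_eq_right (by linarith)]; ring
  have hpt : ∀ u v, (max (f u - m) 0 - max (f v - m) 0) ^ 2 + (max (m - f u) 0 - max (m - f v) 0) ^ 2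
      ≤ (f u - f v) ^ 2 := by
    intro u v
    rcases le_total (f u) m with hu | hu <;> rcases le_total (f v) m with hv | hv
    · rw [max_eq_right (by linarith), max_eq_right (by linarith), max_eq_left (by linarith),
        max_eq_left (by linarith)]
      apply le_of_eq; ring
    · rw [max_eq_right (by linarith), max_eq_left (by linarith), max_eq_left (by linarith),
        max_eq_right (by linarith)]
      nlinarith [mul_nonneg (sub_nonneg.2 hu) (sub_nonneg.2 hv)]
    · rw [max_eq_left (by linarith), max_eq_right (by linarith), max_eq_right (by linarith),
        max_eq_left (by linarith)]
      nlinarith [mul_nonneg (sub_nonneg.2 hu) (sub_nonneg.2 hv)]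
    · rw [max_eq_left (by linarith), max_eq_left (by linarith), max_eq_right (by linarith),
        max_eq_right (by linarith)]
      apply le_of_eq; ring
  have hshift : ∑ u, f u ^ 2 ≤ ∑ u, (f u - m) ^ 2 := by
    have : ∑ u, (f u - m) ^ 2 = ∑ u, f u ^ 2 - 2 * m * ∑ u, f u + ∑ _u : V, m ^ 2 := by
      rw [Finset.mul_sum, ← Finset.sum_sub_distrib, ← Finset.sum_add_distrib]
      exact Finset.sum_congr rfl fun u _ => by ring
    rw [this, hf]
    have : 0 ≤ ∑ _u : V, m ^ 2 := Finset.sum_nonneg fun _ _ => sq_nonneg _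
    linarith
  have hE : ∑ u, ∑ v, w u v * (max (f u - m) 0 - max (f v - m) 0) ^ 2 +
      ∑ u, ∑ v, w u v * (max (m - f u) 0 - max (m - f v) 0) ^ 2 ≤
      ∑ u, ∑ v, w u v * (f u - f v) ^ 2 := by
    simp only [← Finset.sum_add_distrib, ← mul_add]
    exact Finset.sum_le_sum fun u _ => Finset.sum_le_sum fun v _ =>
      mul_le_mul_of_nonneg_left (hpt u v) (hw u v)
  have hS : ∑ u, (f u - m) ^ 2 = ∑ u, max (f u - m) 0 ^ 2 + ∑ u, max (m - f u) 0 ^ 2 := by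
    rw [← Finset.sum_add_distrib]
    exact Finset.sum_congr rfl fun u _ => hsq u
  have h3 := mul_le_mul_of_nonneg_left hE hd
  have h4 := mul_le_mul_of_nonneg_left hshift (sq_nonneg h)
  rw [hS] at h4
  linarith

end Cheeger

/-! ### Incidence matrices and the matrices of the model -/

section Incidence

variable {V : Type*} [Fintype V]

theorem incidence_mulVec_sq (H : SimpleGraph V) (o : EdgeOrientation H) (z : V → ℝ) {a b : V}
    (hab : s(a, b) ∈ H.edgeSet) :
    ((incidence H o *ᵥ z) ⟨s(a, b), hab⟩) ^ 2 = (z a - z b) ^ 2 := by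
  classical
  have hne : a ≠ b := (show H.Adj a b from hab).ne
  have hmem := o.head_mem ⟨s(a, b), hab⟩
  have key : ∀ c d : V, c ≠ d → s(a, b) = s(c, d) → o.head ⟨s(a, b), hab⟩ = c →
      (incidence H o *ᵥ z) ⟨s(a, b), hab⟩ = z c - z d := by
    intro c d hcd he hc
    have hiff : ∀ v, v ∈ s(a, b) ↔ v = c ∨ v = d := fun v => by rw [he, Sym2.mem_iff]
    have hrow : ∀ v, incidence H o ⟨s(a, b), hab⟩ v * z v =
        (if v = c then z c else 0) + (if v = d then -z d else 0) := by
      intro v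
      simp only [incidence, Matrix.of_apply, hc, hiff]
      by_cases h1 : v = c
      · subst h1
        simp [hcd]
      · by_cases h2 : v = d
        · subst h2
          simp [h1]
        · simp [h1, h2]
    simp only [Matrix.mulVec, dotProduct, hrow, Finset.sum_add_distrib, Finset.sum_ite_eq',
      Finset.mem_univ, if_true]
    ring
  rcases Sym2.mem_iff.1 hmem with h | h
  · rw [key a b hne rfl h]
  · rw [key b a hne.symm Sym2.eq_swap h]
    ring

/-- The factor two is the double counting of edges by ordered pairs; squaring removes the dependence
on the orientation. -/
theorem two_mul_sqNorm_incidence_mulVec (H : SimpleGraph V) [Fintype H.edgeSet]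
    [DecidableRel H.Adj] (o : EdgeOrientation H) (z : V → ℝ) :
    2 * sqNorm (incidence H o *ᵥ z) =
      ∑ u, ∑ v, (if H.Adj u v then (1 : ℝ) else 0) * (z u - z v) ^ 2 := by
  classical
  have h1 : ∀ p : V × V, (if H.Adj p.1 p.2 then (1 : ℝ) else 0) * (z p.1 - z p.2) ^ 2 =
      ∑ e : H.edgeSet, if (e : Sym2 V) = s(p.1, p.2) then (z p.1 - z p.2) ^ 2 else 0 := by
    intro p
    by_cases hp : H.Adj p.1 p.2
    · rw [if_pos hp, one_mul, Finset.sum_eq_single (⟨s(p.1, p.2), hp⟩ : H.edgeSet)]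
      · simp
      · intro e _ hne
        rw [if_neg]
        exact fun h => hne (Subtype.ext h)
      · simp
    · rw [if_neg hp, zero_mul, Finset.sum_eq_zero]
      intro e _
      rw [if_neg]
      intro h
      have := e.2
      rw [h] at this
      exact hp this
  rw [← Finset.sum_product', Finset.univ_product_univ, Finset.sum_congr rfl fun p _ => h1 p,
    Finset.sum_comm, sqNorm, Finset.mul_sum]
  refine Finset.sum_congr rfl fun e _ => ?_
  obtain ⟨e, he⟩ := e
  induction e using Sym2.ind with
  | _ a b =>
    have hne : a ≠ b := (show H.Adj a b from he).ne
    rw [incidence_mulVec_sq, ← Finset.sum_filter]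
    have : (Finset.univ.filter fun p : V × V => s(a, b) = s(p.1, p.2)) = {(a, b), (b, a)} := by
      ext ⟨c, d⟩
      simp only [Finset.mem_filter, Finset.mem_univ, true_and, Finset.mem_insert,
        Finset.mem_singleton, Prod.mk.injEq, Sym2.eq_iff]
      constructor
      · rintro (⟨rfl, rfl⟩ | ⟨rfl, rfl⟩) <;> simp
      · rintro (⟨rfl, rfl⟩ | ⟨rfl, rfl⟩) <;> simp
    rw [this, Finset.sum_pair (by simp [hne])]
    ring

theorem incidence_mulVec_const (H : SimpleGraph V) (o : EdgeOrientation H) (c : ℝ) :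
    incidence H o *ᵥ (fun _ => c) = 0 := by
  classical
  refine eq_zero_of_sqNorm_eq_zero ?_
  have := two_mul_sqNorm_incidence_mulVec H o fun _ => c
  simpa using this

end Incidence

/-! ### Kronecker structure of `M`, `C` and the centering projections -/

section Blocks

variable {n T : ℕ}

theorem kronecker_mulVec_apply {l m k r : Type*} [Fintype m] [Fintype r] (A : Matrix l m ℝ)
    (B : Matrix k r ℝ) (v : m × r → ℝ) (t : l) (i : k) :
    ((A ⊗ₖ B) *ᵥ v) (t, i) = ∑ t', A t t' * (B *ᵥ fun j => v (t', j)) i := by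
  simp only [Matrix.mulVec, dotProduct, Matrix.kroneckerMap_apply, Fintype.sum_prod_type,
    Finset.mul_sum, mul_assoc]

theorem sqNorm_smoothMat_mulVec (G : SimpleGraph (Fin T)) [Fintype G.edgeSet]
    (oG : EdgeOrientation G) (v : Fin T × Fin n → ℝ) :
    sqNorm (smoothMat n G oG *ᵥ v) = ∑ i, sqNorm (incidence G oG *ᵥ fun t => v (t, i)) := by
  simp only [sqNorm]
  rw [Fintype.sum_prod_type, Finset.sum_comm]
  refine Finset.sum_congr rfl fun i _ => Finset.sum_congr rfl fun e _ => ?_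
  rw [smoothMat, kronecker_mulVec_apply]
  simp only [Matrix.one_mulVec]
  rfl

theorem sqNorm_measMat_mulVec (H : Fin T → SimpleGraph (Fin n)) [∀ t, Fintype (H t).edgeSet]
    (o : ∀ t, EdgeOrientation (H t)) (v : Fin T × Fin n → ℝ) :
    sqNorm (measMat H o *ᵥ v) = ∑ t, sqNorm (incidence (H t) (o t) *ᵥ fun i => v (t, i)) := by
  simp only [sqNorm]
  rw [Fintype.sum_sigma]
  refine Finset.sum_congr rfl fun t _ => Finset.sum_congr rfl fun e _ => ?_
  congr 1
  simp only [Matrix.mulVec, dotProduct, measMat, Matrix.of_apply, Fintype.sum_prod_type]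
  rw [Finset.sum_eq_single t]
  · simp
  · intro s _ hs
    simp [Ne.symm hs]
  · simp

/-- The averaging matrix, all of whose entries are `1 / k`. -/
noncomputable def avgMat (k : ℕ) : Matrix (Fin k) (Fin k) ℝ :=
  (1 / (k : ℝ)) • Matrix.of fun _ _ => (1 : ℝ)

theorem avgMat_apply (k : ℕ) (i j : Fin k) : avgMat k i j = 1 / (k : ℝ) := by
  simp [avgMat]

theorem avgMat_mulVec (k : ℕ) (v : Fin k → ℝ) (i : Fin k) :
    (avgMat k *ᵥ v) i = (∑ j, v j) / k := by
  simp only [Matrix.mulVec, dotProduct, avgMat_apply, ← Finset.mul_sum]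
  ring

theorem avgMat_transpose (k : ℕ) : (avgMat k)ᵀ = avgMat k := by
  ext i j
  simp [avgMat_apply]

theorem avgMat_mul_self (k : ℕ) : avgMat k * avgMat k = avgMat k := by
  ext i j
  have hk : (k : ℝ) ≠ 0 := by
    have : 0 < k := i.pos
    positivity
  simp only [Matrix.mul_apply, avgMat_apply, Finset.sum_const, Finset.card_univ, Fintype.card_fin,
    nsmul_eq_mul]
  field_simp

theorem trace_avgMat_le (k : ℕ) : (avgMat k).trace ≤ 1 := by
  simp only [Matrix.trace, Matrix.diag, avgMat_apply, Finset.sum_const, Finset.card_univ,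
    Fintype.card_fin, nsmul_eq_mul, mul_one_div]
  exact div_self_le_one _

theorem trace_avgMat_nonneg (k : ℕ) : 0 ≤ (avgMat k).trace :=
  Finset.sum_nonneg fun i _ => by
    rw [Matrix.diag_apply, avgMat_apply]
    positivity

theorem one_sub_avgMat_mul_self (k : ℕ) :
    (1 - avgMat k) * (1 - avgMat k) = 1 - avgMat k := by
  rw [Matrix.mul_sub, Matrix.mul_one, Matrix.sub_mul, Matrix.one_mul, avgMat_mul_self, sub_self,
    sub_zero]

theorem one_sub_avgMat_transpose (k : ℕ) : (1 - avgMat k)ᵀ = 1 - avgMat k := by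
  rw [Matrix.transpose_sub, avgMat_transpose, Matrix.transpose_one]

theorem trace_one_sub_avgMat_le (k : ℕ) : (1 - avgMat k).trace ≤ k := by
  rw [Matrix.trace_sub, Matrix.trace_one, Fintype.card_fin]
  linarith [trace_avgMat_nonneg k]

theorem trace_one_sub_avgMat_nonneg (k : ℕ) : 0 ≤ (1 - avgMat k).trace := by
  rw [Matrix.trace_sub, Matrix.trace_one, Fintype.card_fin]
  rcases Nat.eq_zero_or_pos k with rfl | hk
  · simp
  · have : (1 : ℝ) ≤ k := by exact_mod_cast hk
    linarith [trace_avgMat_le k]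

/-- The projection onto the signals which are centered and constant across the layers. -/
noncomputable def meanProj (n T : ℕ) : Matrix (Fin T × Fin n) (Fin T × Fin n) ℝ :=
  avgMat T ⊗ₖ (1 - avgMat n)

/-- The projection onto the centered signals whose mean over the layers vanishes. -/
noncomputable def devProj (n T : ℕ) : Matrix (Fin T × Fin n) (Fin T × Fin n) ℝ :=
  (1 - avgMat T) ⊗ₖ (1 - avgMat n)

theorem centerMat_eq_kronecker (n T : ℕ) :
    centerMat n T = (1 : Matrix (Fin T) (Fin T) ℝ) ⊗ₖ (1 - avgMat n) :=
  rfl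

theorem centerMat_eq (n T : ℕ) : centerMat n T = meanProj n T + devProj n T := by
  rw [meanProj, devProj, ← Matrix.add_kronecker]
  simp [centerMat, avgMat]

theorem meanProj_transpose (n T : ℕ) : (meanProj n T)ᵀ = meanProj n T := by
  rw [meanProj, ← Matrix.kroneckerMap_transpose, avgMat_transpose, one_sub_avgMat_transpose]

theorem devProj_transpose (n T : ℕ) : (devProj n T)ᵀ = devProj n T := by
  rw [devProj, ← Matrix.kroneckerMap_transpose, one_sub_avgMat_transpose, one_sub_avgMat_transpose]

theorem meanProj_mul_self (n T : ℕ) : meanProj n T * meanProj n T = meanProj n T := by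
  rw [meanProj, ← Matrix.mul_kronecker_mul, avgMat_mul_self, one_sub_avgMat_mul_self]

theorem devProj_mul_self (n T : ℕ) : devProj n T * devProj n T = devProj n T := by
  rw [devProj, ← Matrix.mul_kronecker_mul, one_sub_avgMat_mul_self, one_sub_avgMat_mul_self]

theorem meanProj_mul_devProj (n T : ℕ) : meanProj n T * devProj n T = 0 := by
  rw [meanProj, devProj, ← Matrix.mul_kronecker_mul, Matrix.mul_sub, Matrix.mul_one,
    avgMat_mul_self, sub_self, Matrix.zero_kronecker]

theorem trace_meanProj_le (n T : ℕ) : (meanProj n T).trace ≤ n := by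
  rw [meanProj, Matrix.trace_kronecker]
  calc (avgMat T).trace * (1 - avgMat n).trace ≤ 1 * n :=
        mul_le_mul (trace_avgMat_le T) (trace_one_sub_avgMat_le n) (trace_one_sub_avgMat_nonneg n)
          zero_le_one
    _ = n := one_mul _

theorem trace_devProj_le (n T : ℕ) : (devProj n T).trace ≤ n * T := by
  rw [devProj, Matrix.trace_kronecker, mul_comm (n : ℝ)]
  exact mul_le_mul (trace_one_sub_avgMat_le T) (trace_one_sub_avgMat_le n)
    (trace_one_sub_avgMat_nonneg n) (Nat.cast_nonneg _)

theorem centerMat_mulVec_apply (v : Fin T × Fin n → ℝ) (t : Fin T) (i : Fin n) :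
    (centerMat n T *ᵥ v) (t, i) = v (t, i) - (∑ j, v (t, j)) / n := by
  rw [centerMat_eq_kronecker, kronecker_mulVec_apply, Finset.sum_eq_single t]
  · rw [Matrix.one_apply_eq, one_mul, Matrix.sub_mulVec, Pi.sub_apply, Matrix.one_mulVec,
      avgMat_mulVec]
  · intro s _ hs
    rw [Matrix.one_apply_ne (Ne.symm hs), zero_mul]
  · simp

theorem sum_centered (v : Fin n → ℝ) : ∑ i, ((1 - avgMat n) *ᵥ v) i = 0 := by
  rcases Nat.eq_zero_or_pos n with rfl | hn
  · simp
  have : (n : ℝ) ≠ 0 := by positivity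
  simp only [Matrix.sub_mulVec, Pi.sub_apply, Matrix.one_mulVec, avgMat_mulVec,
    Finset.sum_sub_distrib, Finset.sum_const, Finset.card_univ, Fintype.card_fin, nsmul_eq_mul]
  field_simp
  ring

theorem exists_meanProj_mulVec_eq (v : Fin T × Fin n → ℝ) :
    ∃ z : Fin n → ℝ, ∑ i, z i = 0 ∧ meanProj n T *ᵥ v = fun q => z q.2 := by
  refine ⟨fun i => ∑ t', 1 / (T : ℝ) * ((1 - avgMat n) *ᵥ fun j => v (t', j)) i, ?_, ?_⟩
  · rw [Finset.sum_comm]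
    refine Finset.sum_eq_zero fun t _ => ?_
    rw [← Finset.mul_sum, sum_centered, mul_zero]
  · funext ⟨t, i⟩
    rw [meanProj, kronecker_mulVec_apply]
    simp only [avgMat_apply]

/-- On signals already centered within each layer, `devProj` only subtracts the average over the
layers. -/
theorem devProj_mulVec_apply {v : Fin T × Fin n → ℝ} (hv : centerMat n T *ᵥ v = v) (t : Fin T)
    (i : Fin n) : (devProj n T *ᵥ v) (t, i) = v (t, i) - (∑ s, v (s, i)) / T := by
  have h1 : devProj n T = ((1 - avgMat T) ⊗ₖ (1 : Matrix (Fin n) (Fin n) ℝ)) * centerMat n T := by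
    rw [centerMat_eq_kronecker, ← Matrix.mul_kronecker_mul, Matrix.mul_one, Matrix.one_mul, devProj]
  rw [h1, ← Matrix.mulVec_mulVec, hv, kronecker_mulVec_apply]
  simp only [Matrix.one_mulVec]
  change ((1 - avgMat T) *ᵥ fun s => v (s, i)) t = _
  rw [Matrix.sub_mulVec, Pi.sub_apply, Matrix.one_mulVec, avgMat_mulVec]

theorem smoothMat_mul_meanProj (G : SimpleGraph (Fin T)) (oG : EdgeOrientation G) :
    smoothMat n G oG * meanProj n T = 0 := by
  rw [smoothMat, meanProj, ← Matrix.mul_kronecker_mul]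
  have : incidence G oG * avgMat T = 0 := by
    ext e t
    have := congrFun (incidence_mulVec_const G oG (1 / (T : ℝ))) e
    simpa [Matrix.mul_apply, Matrix.mulVec, dotProduct, avgMat_apply] using this
  rw [this, Matrix.zero_kronecker]

/-- Centering changes each layer by a constant vector, which every incidence matrix kills. -/
theorem measMat_mul_centerMat (H : Fin T → SimpleGraph (Fin n)) (o : ∀ t, EdgeOrientation (H t)) :
    measMat H o * centerMat n T = measMat H o := by
  classical
  have h : ∀ v, (measMat H o * centerMat n T) *ᵥ v = measMat H o *ᵥ v := by
    intro v
    rw [← sub_eq_zero, ← Matrix.mulVec_mulVec, ← Matrix.mulVec_sub]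
    refine eq_zero_of_sqNorm_eq_zero ?_
    rw [sqNorm_measMat_mulVec]
    refine Finset.sum_eq_zero fun t _ => ?_
    have : (fun i => (centerMat n T *ᵥ v - v) (t, i)) = fun _ => -((∑ j, v (t, j)) / n) := by
      funext i
      rw [Pi.sub_apply, centerMat_mulVec_apply]
      ring
    rw [this, incidence_mulVec_const]
    simp [sqNorm]
  exact Matrix.ext_of_mulVec_single fun i => h _

end Blocks

/-! ### Spectral gaps of the complete graph and of the star -/

section SpectralGap

variable {n T : ℕ}

theorem sum_sub_mean_sq (hT : 1 ≤ T) (z : Fin T → ℝ) :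
    ∑ t, (z t - (∑ s, z s) / T) ^ 2 = ∑ t, z t ^ 2 - (∑ s, z s) ^ 2 / T := by
  have hT0 : (T : ℝ) ≠ 0 := by positivity
  have : ∀ t, (z t - (∑ s, z s) / T) ^ 2 =
      z t ^ 2 - 2 * ((∑ s, z s) / T) * z t + ((∑ s, z s) / T) ^ 2 := fun t => by ring
  simp only [this, Finset.sum_add_distrib, Finset.sum_sub_distrib, ← Finset.mul_sum,
    Finset.sum_const, Finset.card_univ, Fintype.card_fin, nsmul_eq_mul]
  field_simp
  ring

/-- In fact an equality: the Laplacian of the complete graph is `T` times the projection off the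
constants. -/
theorem spectralGap_top (hT : 1 ≤ T) [Fintype (⊤ : SimpleGraph (Fin T)).edgeSet]
    (oG : EdgeOrientation (⊤ : SimpleGraph (Fin T))) (z : Fin T → ℝ) :
    T * ∑ t, (z t - (∑ s, z s) / T) ^ 2 ≤ sqNorm (incidence ⊤ oG *ᵥ z) := by
  classical
  have hT0 : (T : ℝ) ≠ 0 := by positivity
  have h1 := two_mul_sqNorm_incidence_mulVec ⊤ oG z
  have h2 : ∀ u v : Fin T, (if (⊤ : SimpleGraph (Fin T)).Adj u v then (1 : ℝ) else 0) *
      (z u - z v) ^ 2 = z u ^ 2 - 2 * z u * z v + z v ^ 2 := by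
    intro u v
    by_cases huv : u = v
    · subst huv
      simp
      ring
    · simp [huv]
      ring
  simp only [h2, Finset.sum_add_distrib, Finset.sum_sub_distrib, ← Finset.mul_sum,
    Finset.sum_const, Finset.card_univ, Fintype.card_fin, nsmul_eq_mul, ← Finset.sum_mul] at h1
  rw [sum_sub_mean_sq hT, mul_sub, mul_div_cancel₀ _ hT0]
  exact le_of_eq (by linarith)

/-- The energy of `z` on the star is `∑ (z v - z r)²`, and the mean minimises the sum of squared
deviations from a point. The slack is `(∑ z - T z r)² / T`. -/
theorem spectralGap_star (hT : 1 ≤ T) (r : Fin T) [Fintype (SimpleGraph.starGraph r).edgeSet]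
    (oG : EdgeOrientation (SimpleGraph.starGraph r)) (z : Fin T → ℝ) :
    1 * ∑ t, (z t - (∑ s, z s) / T) ^ 2 ≤ sqNorm (incidence (SimpleGraph.starGraph r) oG *ᵥ z) := by
  classical
  have hT0 : (0 : ℝ) < T := by positivity
  have h1 := two_mul_sqNorm_incidence_mulVec _ oG z
  have h2 : ∀ u v : Fin T, (if (SimpleGraph.starGraph r).Adj u v then (1 : ℝ) else 0) *
      (z u - z v) ^ 2 = (if u = r then (z r - z v) ^ 2 else 0) +
        (if v = r then (z u - z r) ^ 2 else 0) := by
    intro u v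
    simp only [SimpleGraph.starGraph_adj]
    by_cases huv : u = v
    · subst huv
      by_cases hu : u = r <;> simp [hu]
    · by_cases hu : u = r
      · subst hu
        simp [huv, Ne.symm huv]
      · by_cases hv : v = r
        · subst hv
          simp [huv]
        · simp [hu, hv]
  have h3 : ∑ u, ∑ v, (if u = r then (z r - z v) ^ 2 else 0) = ∑ v, (z r - z v) ^ 2 := by
    rw [Finset.sum_comm]
    simp
  simp only [h2, Finset.sum_add_distrib, h3, Finset.sum_ite_eq', Finset.mem_univ, if_true] at h1
  have h4 : ∑ v, (z r - z v) ^ 2 = ∑ v, (z v - z r) ^ 2 :=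
    Finset.sum_congr rfl fun v _ => by ring
  have h5 : ∑ v, (z v - z r) ^ 2 = ∑ t, z t ^ 2 - 2 * (∑ t, z t) * z r + T * z r ^ 2 := by
    have : ∀ v, (z v - z r) ^ 2 = z v ^ 2 - 2 * z r * z v + z r ^ 2 := fun v => by ring
    simp only [this, Finset.sum_add_distrib, Finset.sum_sub_distrib, ← Finset.mul_sum,
      Finset.sum_const, Finset.card_univ, Fintype.card_fin, nsmul_eq_mul]
    ring
  rw [one_mul, sum_sub_mean_sq hT]
  have h6 : 0 ≤ ((∑ t, z t) - T * z r) ^ 2 / T := by positivity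
  have h7 : ((∑ t, z t) - T * z r) ^ 2 / T =
      (∑ t, z t) ^ 2 / T - 2 * (∑ t, z t) * z r + T * z r ^ 2 := by
    field_simp
    ring
  linarith

theorem devProj_le_smoothMat (G : SimpleGraph (Fin T)) [Fintype G.edgeSet]
    (oG : EdgeOrientation G) {lam : ℝ}
    (hgap : ∀ z : Fin T → ℝ, lam * ∑ t, (z t - (∑ s, z s) / T) ^ 2 ≤ sqNorm (incidence G oG *ᵥ z))
    {u : Fin T × Fin n → ℝ} (hu : centerMat n T *ᵥ u = u) :
    lam * sqNorm (devProj n T *ᵥ u) ≤ sqNorm (smoothMat n G oG *ᵥ u) := by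
  rw [sqNorm_smoothMat_mulVec, sqNorm, Fintype.sum_prod_type, Finset.sum_comm, Finset.mul_sum]
  refine Finset.sum_le_sum fun i _ => ?_
  simp only [devProj_mulVec_apply hu]
  exact hgap fun t => u (t, i)

end SpectralGap

open scoped Classical in
/-- The error of the estimator for fixed measurement graphs, in terms of a uniform bound on the
Laplacians of the layers and of the spectral gap of their sum. -/
theorem sqError_le_of_laplacian_bounds {n T : ℕ} (hT : 1 ≤ T) {G : SimpleGraph (Fin T)}
    {oG : EdgeOrientation G} {H : Fin T → SimpleGraph (Fin n)}
    {o : ∀ (_ : Fin T) (K : SimpleGraph (Fin n)), EdgeOrientation K} {μ lam g κ S : ℝ}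
    (hlam : 0 < lam) (hκ : 0 < κ) (hμ : 0 < μ) (hg0 : 0 ≤ g) (hg : 2 * g ≤ μ * lam)
    (hgap : ∀ z : Fin T → ℝ, lam * ∑ t, (z t - (∑ s, z s) / T) ^ 2 ≤ sqNorm (incidence G oG *ᵥ z))
    (hup : ∀ t (z : Fin n → ℝ), sqNorm (incidence (H t) (o t (H t)) *ᵥ z) ≤ g * sqNorm z)
    (hlow : ∀ z : Fin n → ℝ, ∑ i, z i = 0 →
      κ * sqNorm z ≤ ∑ t, sqNorm (incidence (H t) (o t (H t)) *ᵥ z))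
    {x : Fin T × Fin n → ℝ} (hx : ∀ t, ∑ i, x (t, i) = 0)
    (hS : sqNorm (smoothMat n G oG *ᵥ x) ≤ S) :
    ∃ R : Matrix (Fin T × Fin n) (MeasIdx H) ℝ,
      frobSq R ≤ g * (4 * n * T ^ 2 / κ ^ 2 + 4 * (n * T) / (μ * lam) ^ 2) ∧
      ∀ η, sqError G oG o μ x H η ≤
        2 * (S / lam * (1 + g * T / κ)) + 2 * sqNorm (R *ᵥ noiseVec H η) := by
  have hT0 : (0 : ℝ) < T := by positivity
  have hPx : centerMat n T *ᵥ x = x := by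
    funext ⟨t, i⟩
    rw [centerMat_mulVec_apply, hx]
    simp
  -- The constant is `κ / T` because `(z, …, z)` has squared norm `T ‖z‖²`, while `C` maps it to
  -- squared norm `∑ₜ ‖Cₜ z‖² ≥ κ ‖z‖²`.
  obtain ⟨b, hb, R, hR, hRη, hRf⟩ := penalized_lsq_error (P := centerMat n T)
    (Q := meanProj n T) (Q' := devProj n T) (M := smoothMat n G oG)
    (C := measMat H fun t => o t (H t)) (κ := κ / T) hlam (div_pos hκ hT0) hμ hg0 hg
    (meanProj_transpose n T) (devProj_transpose n T) (meanProj_mul_self n T)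
    (devProj_mul_self n T) (meanProj_mul_devProj n T) (centerMat_eq n T)
    (measMat_mul_centerMat H _) (smoothMat_mul_meanProj G oG)
    (fun u hu => devProj_le_smoothMat G oG hgap hu)
    (by
      intro u
      rw [sqNorm_measMat_mulVec, sqNorm, Fintype.sum_prod_type, Finset.mul_sum]
      exact Finset.sum_le_sum fun t _ => hup t fun i => u (t, i))
    (by
      intro u
      obtain ⟨z, hz, hzu⟩ := exists_meanProj_mulVec_eq u
      rw [hzu, sqNorm_measMat_mulVec, sqNorm, Fintype.sum_prod_type]
      simp only [Finset.sum_const, Finset.card_univ, Fintype.card_fin, nsmul_eq_mul]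
      refine le_trans (le_of_eq ?_) (hlow z hz)
      rw [← mul_assoc, div_mul_cancel₀ _ hT0.ne']
      rfl) hPx hS
  refine ⟨R, hRf.trans (mul_le_mul_of_nonneg_left (add_le_add ?_ ?_) hg0), fun η => ?_⟩
  · rw [div_pow, div_div_eq_mul_div]
    have := trace_meanProj_le n T
    gcongr
  · have := trace_devProj_le n T
    gcongr
  · have h1 : estimator G oG H (fun t => o t (H t)) μ
        (observation H (fun t => o t (H t)) x η) - x = b + R *ᵥ noiseVec H η := by
      rw [← hRη, hR]
      rfl
    rw [sqError, h1]
    refine (sqNorm_add_le _ _).trans ?_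
    have e : S / lam * (1 + g / (κ / T)) = S / lam * (1 + g * T / κ) := by
      rw [div_div_eq_mul_div]
    rw [e] at hb
    linarith

/-! ### Concentration of sums of independent indicators -/

section Concentration

variable {Ω : Type*} [MeasurableSpace Ω] {P : Measure Ω} [IsProbabilityMeasure P]
  {J : Type*} [Fintype J] {A : J → Set Ω}

/-- The number of events which occur. -/
noncomputable def eventCount (A : J → Set Ω) (ω : Ω) : ℝ :=
  ∑ j, (A j).indicator (fun _ => (1 : ℝ)) ω

/-- The moment generating function is exactly `1 + P(B)(e^s - 1)`; bounding it by an exponential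
yields Poisson-type tails depending only on the expected count. -/
theorem mgf_indicator_le {B : Set Ω} (hB : MeasurableSet B) (s : ℝ) :
    mgf (B.indicator fun _ => (1 : ℝ)) P s ≤ Real.exp (P.real B * (Real.exp s - 1)) := by
  have h1 : ∀ ω, Real.exp (s * B.indicator (fun _ => (1 : ℝ)) ω) =
      1 + B.indicator (fun _ => Real.exp s - 1) ω := by
    intro ω
    by_cases h : ω ∈ B <;> simp [h]
  rw [mgf]
  simp only [h1]
  rw [integral_add (integrable_const _) ((integrable_const _).indicator hB),
    integral_indicator_const _ hB]
  simp only [integral_const, probReal_univ, smul_eq_mul, mul_one]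
  linarith [Real.add_one_le_exp (P.real B * (Real.exp s - 1))]

theorem mgf_eventCount_le (hA : ∀ j, MeasurableSet (A j)) (hind : iIndepSet A P) (s : ℝ) :
    mgf (eventCount A) P s ≤ Real.exp ((∑ j, P.real (A j)) * (Real.exp s - 1)) := by
  have h1 : eventCount A = ∑ j, (A j).indicator fun _ => (1 : ℝ) := by
    funext ω
    simp [eventCount]
  rw [h1, hind.iIndepFun_indicator.mgf_sum (fun j => measurable_const.indicator (hA j)),
    Finset.sum_mul, Real.exp_sum]
  exact Finset.prod_le_prod (fun _ _ => mgf_nonneg) fun j _ => mgf_indicator_le (hA j) s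

omit [IsProbabilityMeasure P] in
theorem measurable_eventCount (hA : ∀ j, MeasurableSet (A j)) : Measurable (eventCount A) :=
  Finset.measurable_fun_sum _ fun j _ => measurable_const.indicator (hA j)

theorem integrable_exp_eventCount (hA : ∀ j, MeasurableSet (A j)) (s : ℝ) :
    Integrable (fun ω => Real.exp (s * eventCount A ω)) P := by
  refine Integrable.of_bound (C := Real.exp (|s| * Fintype.card J))
    (((measurable_eventCount hA).const_mul s).exp.aestronglyMeasurable) (ae_of_all _ fun ω => ?_)
  rw [Real.norm_eq_abs, Real.abs_exp, Real.exp_le_exp]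
  have h0 : 0 ≤ eventCount A ω :=
    Finset.sum_nonneg fun j _ => Set.indicator_nonneg (fun _ _ => zero_le_one) _
  have h1 : eventCount A ω ≤ Fintype.card J := by
    calc eventCount A ω ≤ ∑ _j : J, (1 : ℝ) :=
          Finset.sum_le_sum fun j _ => Set.indicator_le_self' (fun _ _ => zero_le_one) _
      _ = Fintype.card J := by simp
  exact mul_le_mul (le_abs_self s) h1 h0 (abs_nonneg s)

/-- Chernoff's bound for the upper tail. -/
theorem eventCount_upper_tail (hA : ∀ j, MeasurableSet (A j)) (hind : iIndepSet A P) {m : ℝ}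
    (hm : ∑ j, P.real (A j) ≤ m) :
    P.real {ω | 4 * m ≤ eventCount A ω} ≤ Real.exp (-2 * m) := by
  have h := measure_ge_le_exp_mul_mgf (μ := P) (X := eventCount A) (t := 1) (4 * m) zero_le_one
    (integrable_exp_eventCount hA 1)
  refine h.trans ((mul_le_mul_of_nonneg_left (mgf_eventCount_le hA hind 1)
    (Real.exp_pos _).le).trans ?_)
  rw [← Real.exp_add, Real.exp_le_exp]
  have h0 : 0 ≤ ∑ j, P.real (A j) := Finset.sum_nonneg fun _ _ => measureReal_nonneg
  -- The exponent is at most `-4m + (e - 1) m`, and `e < 3`.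
  nlinarith [Real.exp_one_lt_three, Real.exp_one_gt_two]

/-- Chernoff's bound for the lower tail. -/
theorem eventCount_lower_tail (hA : ∀ j, MeasurableSet (A j)) (hind : iIndepSet A P) {m : ℝ}
    (hm : ∑ j, P.real (A j) = m) :
    P.real {ω | eventCount A ω ≤ m / 4} ≤ Real.exp (-(m / 3)) := by
  have h := measure_le_le_exp_mul_mgf (μ := P) (X := eventCount A) (t := -1) (m / 4)
    (by norm_num) (integrable_exp_eventCount hA (-1))
  refine h.trans ((mul_le_mul_of_nonneg_left (mgf_eventCount_le hA hind (-1))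
    (Real.exp_pos _).le).trans ?_)
  rw [← Real.exp_add, Real.exp_le_exp, hm]
  have h0 : 0 ≤ m := hm ▸ Finset.sum_nonneg fun _ _ => measureReal_nonneg
  -- The exponent is `m/4 - (1 - 1/e) m`, about `-0.38 m`.
  nlinarith [Real.exp_neg_one_lt_d9]

/-- Hoeffding's inequality. -/
theorem eventCount_hoeffding (hA : ∀ j, MeasurableSet (A j)) (hind : iIndepSet A P) {m s : ℝ}
    {k : ℕ} (hm : ∑ j, P.real (A j) ≤ m) (hs : 0 ≤ s) (hJ : 0 < Fintype.card J)
    (hk : Fintype.card J ≤ k) :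
    P.real {ω | m + s ≤ eventCount A ω} ≤ Real.exp (-(2 * s ^ 2 / k)) := by
  have hsub : ∀ j ∈ Finset.univ, HasSubgaussianMGF
      (fun ω => (A j).indicator (fun _ => (1 : ℝ)) ω - P.real (A j)) ((1 / 2) ^ 2) P := by
    intro j _
    have := hasSubgaussianMGF_of_mem_Icc (μ := P) (a := 0) (b := 1)
      (X := (A j).indicator fun _ => (1 : ℝ)) (measurable_const.indicator (hA j)).aemeasurable
      (ae_of_all _ fun ω => by by_cases h : ω ∈ A j <;> simp [h])
    rw [integral_indicator_const _ (hA j)] at this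
    simpa using this
  have hind' : iIndepFun (fun j ω => (A j).indicator (fun _ => (1 : ℝ)) ω - P.real (A j)) P :=
    hind.iIndepFun_indicator.comp (fun j (y : ℝ) => y - P.real (A j))
      fun j => measurable_id.sub_const _
  have h := HasSubgaussianMGF.measure_sum_ge_le_of_iIndepFun hind' hsub hs
  refine (measureReal_mono (fun ω hω => ?_)).trans (h.trans ?_)
  · simp only [Set.mem_ofPred_eq, Finset.sum_sub_distrib] at hω ⊢
    rw [eventCount] at hω
    linarith
  · rw [Real.exp_le_exp, neg_div, neg_le_neg_iff]
    have hJ' : (0 : ℝ) < Fintype.card J := by exact_mod_cast hJ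
    have hk' : (Fintype.card J : ℝ) ≤ k := by exact_mod_cast hk
    have e : (2 * ((∑ _j : J, ((1 / 2) ^ 2 : ℝ≥0) : ℝ≥0) : ℝ)) = Fintype.card J / 2 := by
      simp
      ring
    rw [e, div_div_eq_mul_div, mul_comm (2 : ℝ)]
    exact div_le_div_of_nonneg_left (by positivity) hJ' hk'

end Concentration

/-! ### Linear images of subgaussian vectors -/

section Subgaussian

theorem lintegral_exp_sq_div_four_gaussianReal :
    ∫⁻ g, ENNReal.ofReal (Real.exp (g ^ 2 / 4)) ∂(gaussianReal 0 1) = ENNReal.ofReal √2 := by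
  rw [gaussianReal_of_var_ne_zero _ one_ne_zero,
    lintegral_withDensity_eq_lintegral_mul _ (measurable_gaussianPDF 0 1) (by fun_prop)]
  have h1 : ∀ g : ℝ, (gaussianPDF 0 1 * fun g => ENNReal.ofReal (Real.exp (g ^ 2 / 4))) g =
      ENNReal.ofReal ((√(2 * Real.pi))⁻¹ * Real.exp (-(1 / 4) * g ^ 2)) := by
    intro g
    rw [Pi.mul_apply, gaussianPDF, ← ENNReal.ofReal_mul (gaussianPDFReal_nonneg 0 1 g),
      gaussianPDFReal, mul_assoc, ← Real.exp_add]
    congr 2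
    · simp
    · congr 1
      simp
      ring
  simp only [h1]
  rw [← ofReal_integral_eq_lintegral_ofReal
    ((integrable_exp_neg_mul_sq (by norm_num)).const_mul _) (ae_of_all _ fun g => by positivity),
    integral_const_mul, integral_gaussian]
  congr 1
  rw [← Real.sqrt_inv, ← Real.sqrt_mul (by positivity)]
  congr 1
  have := Real.pi_pos
  field_simp
  norm_num

variable {Ω : Type*} [MeasurableSpace Ω] {P : Measure Ω} [IsProbabilityMeasure P]

/-- Linearise the square with an independent standard Gaussian `g`: `exp(Y²/(4c))` is the average
over `g` of `exp(s Y g)` with `s² = 1/(2c)`. After exchanging the integrals, the subgaussian bound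
leaves the Gaussian integral of `exp(g²/4)`, which is `√2`. -/
theorem lintegral_exp_sq_le_of_hasSubgaussianMGF {Y : Ω → ℝ} {c : ℝ≥0}
    (hY : HasSubgaussianMGF Y c P) :
    ∫⁻ ω, ENNReal.ofReal (Real.exp (Y ω ^ 2 / (4 * c))) ∂P ≤ ENNReal.ofReal √2 := by
  rcases eq_or_ne c 0 with rfl | hc
  · simp
  have hc0 : (0 : ℝ) < c := by positivity
  set s : ℝ := (√(2 * c))⁻¹ with hs
  have hs2 : s ^ 2 = 1 / (2 * c) := by
    rw [hs, inv_pow, Real.sq_sqrt (by positivity), one_div]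
  have h1 : ∀ ω, ENNReal.ofReal (Real.exp (Y ω ^ 2 / (4 * c))) =
      ∫⁻ g, ENNReal.ofReal (Real.exp (s * Y ω * g)) ∂(gaussianReal 0 1) := by
    intro ω
    rw [← ofReal_integral_eq_lintegral_ofReal (integrable_exp_mul_gaussianReal _)
      (ae_of_all _ fun g => (Real.exp_pos _).le)]
    have := congrFun (mgf_fun_id_gaussianReal (μ := 0) (v := 1)) (s * Y ω)
    rw [mgf] at this
    rw [this, mul_pow, hs2]
    congr 2
    simp
    field_simp
    norm_num
  simp only [h1]
  have hmeas : AEMeasurable (Function.uncurry fun ω g => ENNReal.ofReal (Real.exp (s * Y ω * g)))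
      (P.prod (gaussianReal 0 1)) := by
    have := (hY.aemeasurable).comp_fst (ν := gaussianReal 0 1)
    exact (((this.const_mul s).mul measurable_snd.aemeasurable).exp).ennreal_ofReal
  rw [lintegral_lintegral_swap hmeas, ← lintegral_exp_sq_div_four_gaussianReal]
  refine lintegral_mono fun g => ?_
  have h2 : ∀ ω, s * Y ω * g = s * g * Y ω := fun ω => by ring
  simp only [h2]
  rw [← ofReal_integral_eq_lintegral_ofReal (hY.integrable_exp_mul _)
    (ae_of_all _ fun g => (Real.exp_pos _).le)]
  refine ENNReal.ofReal_le_ofReal ((hY.mgf_le (s * g)).trans (le_of_eq ?_))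
  rw [mul_pow, hs2]
  congr 1
  field_simp
  ring

variable {ι m : Type*} [Fintype ι] [Fintype m] {Y : Ω → m → ℝ} {σ : ℝ≥0}

omit [IsProbabilityMeasure P] in
theorem sqNorm_normalize {r : m → ℝ} (hr : sqNorm r ≠ 0) : sqNorm ((√(sqNorm r))⁻¹ • r) = 1 := by
  rw [sqNorm_smul, inv_pow, Real.sq_sqrt (sqNorm_nonneg r), inv_mul_cancel₀ hr]

theorem lintegral_exp_dotProduct_sq_le (hY : IsSubgaussianVec Y σ P) (r : m → ℝ) :
    ∫⁻ ω, ENNReal.ofReal (Real.exp ((r ⬝ᵥ Y ω) ^ 2 / (4 * σ ^ 2 * sqNorm r))) ∂P ≤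
      ENNReal.ofReal √2 := by
  by_cases hr : sqNorm r = 0
  · simp [hr]
  refine le_trans (le_of_eq ?_) (lintegral_exp_sq_le_of_hasSubgaussianMGF
    (hY _ (sqNorm_normalize hr)))
  refine lintegral_congr fun ω => ?_
  rw [smul_dotProduct, smul_eq_mul, mul_pow, inv_pow, Real.sq_sqrt (sqNorm_nonneg r)]
  congr 2
  push_cast
  rw [← div_eq_inv_mul, div_div, mul_comm (sqNorm r)]

omit [IsProbabilityMeasure P] in
theorem dotProduct_ae_eq_zero (hY : IsSubgaussianVec Y 0 P) (r : m → ℝ) :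
    ∀ᵐ ω ∂P, r ⬝ᵥ Y ω = 0 := by
  by_cases hr : sqNorm r = 0
  · exact ae_of_all _ fun ω => by rw [eq_zero_of_sqNorm_eq_zero hr, zero_dotProduct]
  have h := hY _ (sqNorm_normalize hr)
  rw [zero_pow two_ne_zero] at h
  filter_upwards [h.ae_eq_zero_of_hasSubgaussianMGF_zero] with ω hω
  rw [smul_dotProduct, smul_eq_mul, Pi.zero_apply] at hω
  have : √(sqNorm r) ≠ 0 := (Real.sqrt_pos.2 (lt_of_le_of_ne (sqNorm_nonneg r) (Ne.symm hr))).ne'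
  exact (mul_eq_zero.1 hω).resolve_left (inv_ne_zero this)

omit [IsProbabilityMeasure P] in
theorem frobSq_nonneg (R : Matrix ι m ℝ) : 0 ≤ frobSq R :=
  Finset.sum_nonneg fun _ _ => sqNorm_nonneg _

-- Measurability of `Y` is not part of `IsSubgaussianVec`; it is recovered direction by direction
-- from the normalised vectors.
omit [IsProbabilityMeasure P] in
theorem aemeasurable_dotProduct (hY : IsSubgaussianVec Y σ P) (r : m → ℝ) :
    AEMeasurable (fun ω => r ⬝ᵥ Y ω) P := by
  by_cases hr : sqNorm r = 0
  · rw [eq_zero_of_sqNorm_eq_zero hr]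
    simp only [zero_dotProduct]
    exact aemeasurable_const
  have h := ((hY _ (sqNorm_normalize hr)).aemeasurable).const_mul (√(sqNorm r))
  refine h.congr (ae_of_all _ fun ω => ?_)
  have : √(sqNorm r) ≠ 0 := (Real.sqrt_pos.2 (lt_of_le_of_ne (sqNorm_nonneg r) (Ne.symm hr))).ne'
  simp only [smul_dotProduct, smul_eq_mul]
  field_simp

/-- Tail bound for the squared norm of a linear image of a subgaussian vector. -/
theorem measure_sqNorm_mulVec_le (hY : IsSubgaussianVec Y σ P) (R : Matrix ι m ℝ) {δ : ℝ}
    (hδ0 : 0 < δ) (hδ : δ < Real.exp (-1)) :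
    P {ω | 8 * σ ^ 2 * frobSq R * Real.log (1 / δ) < sqNorm (R *ᵥ Y ω)} ≤ ENNReal.ofReal δ := by
  have hZ : ∀ ω, sqNorm (R *ᵥ Y ω) = ∑ i, (R i ⬝ᵥ Y ω) ^ 2 := fun ω => rfl
  rcases eq_or_ne σ 0 with rfl | hσ
  · have h0 : ∀ᵐ ω ∂P, ∀ i, R i ⬝ᵥ Y ω = 0 := ae_all_iff.2 fun i => dotProduct_ae_eq_zero hY (R i)
    have : P {ω | 8 * ((0 : ℝ≥0) : ℝ) ^ 2 * frobSq R * Real.log (1 / δ) < sqNorm (R *ᵥ Y ω)} = 0 := by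
      refine measure_mono_null ?_ (ae_iff.1 h0)
      intro ω hω hall
      simp only [Set.mem_ofPred_eq, hZ] at hω
      simp [hall] at hω
    rw [this]
    exact zero_le
  have hσ0 : (0 : ℝ) < σ := by positivity
  have hlog : 1 < Real.log (1 / δ) := by
    rw [one_div, Real.log_inv]
    have := Real.log_lt_log hδ0 hδ
    rw [Real.log_exp] at this
    linarith
  rcases (frobSq_nonneg R).eq_or_lt with hV | hV
  · have hrow : ∀ i, R i = 0 := fun i => eq_zero_of_sqNorm_eq_zero
      ((Finset.sum_eq_zero_iff_of_nonneg fun _ _ => sqNorm_nonneg _).1 hV.symm i (Finset.mem_univ i))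
    have : {ω | 8 * (σ : ℝ) ^ 2 * frobSq R * Real.log (1 / δ) < sqNorm (R *ᵥ Y ω)} = ∅ := by
      ext ω
      simp [hZ, hrow, ← hV]
    rw [this, measure_empty]
    exact zero_le
  set V := frobSq R with hVdef
  set w : ι → ℝ := fun i => sqNorm (R i) / V
  have hw0 : ∀ i, 0 ≤ w i := fun i => div_nonneg (sqNorm_nonneg _) hV.le
  have hw1 : ∑ i, w i = 1 := by
    rw [← Finset.sum_div]
    exact div_self hV.ne'
  have hpt : ∀ ω, ENNReal.ofReal (Real.exp (sqNorm (R *ᵥ Y ω) / (4 * σ ^ 2 * V))) ≤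
      ∑ i, ENNReal.ofReal (w i) *
        ENNReal.ofReal (Real.exp ((R i ⬝ᵥ Y ω) ^ 2 / (4 * σ ^ 2 * sqNorm (R i)))) := by
    intro ω
    simp only [← ENNReal.ofReal_mul (hw0 _)]
    rw [← ENNReal.ofReal_sum_of_nonneg fun i _ => mul_nonneg (hw0 i) (Real.exp_pos _).le]
    refine ENNReal.ofReal_le_ofReal ?_
    -- Jensen's inequality with weights `‖Rᵢ‖² / ‖R‖_F²`: the rows of `R` may be arbitrarily
    -- dependent, and only one-dimensional bounds are needed.
    have hj := convexOn_exp.map_sum_le (t := Finset.univ) (w := w)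
      (p := fun i => (R i ⬝ᵥ Y ω) ^ 2 / (4 * σ ^ 2 * sqNorm (R i))) (fun i _ => hw0 i) hw1
      fun i _ => Set.mem_univ _
    simp only [smul_eq_mul] at hj
    refine le_trans (le_of_eq ?_) hj
    rw [hZ, Finset.sum_div]
    congr 1
    refine Finset.sum_congr rfl fun i _ => ?_
    by_cases hr : sqNorm (R i) = 0
    · rw [eq_zero_of_sqNorm_eq_zero hr]
      simp
    · simp only [w]
      field_simp
  have hint : ∫⁻ ω, ENNReal.ofReal (Real.exp (sqNorm (R *ᵥ Y ω) / (4 * σ ^ 2 * V))) ∂P ≤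
      ENNReal.ofReal √2 := by
    refine (lintegral_mono hpt).trans ?_
    have hm : ∀ i, AEMeasurable (fun ω => ENNReal.ofReal
        (Real.exp ((R i ⬝ᵥ Y ω) ^ 2 / (4 * σ ^ 2 * sqNorm (R i))))) P := fun i =>
      ((((aemeasurable_dotProduct hY (R i)).pow_const 2).div_const _).exp).ennreal_ofReal
    rw [lintegral_finsetSum' _ fun i _ => (hm i).const_mul _]
    calc ∑ i, ∫⁻ ω, ENNReal.ofReal (w i) * ENNReal.ofReal
          (Real.exp ((R i ⬝ᵥ Y ω) ^ 2 / (4 * σ ^ 2 * sqNorm (R i)))) ∂P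
        ≤ ∑ i, ENNReal.ofReal (w i) * ENNReal.ofReal √2 := by
          refine Finset.sum_le_sum fun i _ => ?_
          rw [lintegral_const_mul'' _ (hm i)]
          gcongr
          exact lintegral_exp_dotProduct_sq_le hY (R i)
      _ = ENNReal.ofReal √2 := by
          rw [← Finset.sum_mul, ← ENNReal.ofReal_sum_of_nonneg fun i _ => hw0 i, hw1,
            ENNReal.ofReal_one, one_mul]
  have hmeas : AEMeasurable (fun ω => ENNReal.ofReal
      (Real.exp (sqNorm (R *ᵥ Y ω) / (4 * σ ^ 2 * V)))) P := by
    simp only [hZ]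
    exact (((Finset.aemeasurable_fun_sum _ fun i _ =>
      (aemeasurable_dotProduct hY (R i)).pow_const 2).div_const _).exp).ennreal_ofReal
  -- Markov's inequality at level `δ⁻²` gives `√2 δ²`, which is below `δ` because `δ < e⁻¹ < 1/2`.
  have hmarkov := meas_ge_le_lintegral_div hmeas
    (ε := ENNReal.ofReal (Real.exp (2 * Real.log (1 / δ))))
    (by simpa using Real.exp_pos _) ENNReal.ofReal_ne_top
  refine (measure_mono fun ω hω => ?_).trans (hmarkov.trans ?_)
  · simp only [Set.mem_ofPred_eq] at hω ⊢
    refine ENNReal.ofReal_le_ofReal (Real.exp_le_exp.2 ?_)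
    rw [le_div_iff₀ (by positivity)]
    linarith
  · refine (ENNReal.div_le_div_right hint _).trans ?_
    rw [← ENNReal.ofReal_div_of_pos (Real.exp_pos _)]
    refine ENNReal.ofReal_le_ofReal ?_
    have e : Real.exp (2 * Real.log (1 / δ)) = (1 / δ) ^ 2 := by
      rw [mul_comm, Real.exp_mul, Real.exp_log (by positivity)]
      norm_cast
    rw [e, div_pow, one_pow, div_div_eq_mul_div, div_one]
    have h2 : √2 < 2 := by
      rw [Real.sqrt_lt' two_pos]
      norm_num
    have h3 := Real.exp_neg_one_lt_half
    nlinarith [Real.sqrt_nonneg 2]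

end Subgaussian

/-! ### Laplacians of Erdős-Rényi graphs -/

section RandomGraph

variable {n T : ℕ}

open scoped Classical in
/-- The entries of the adjacency matrix. -/
noncomputable def adjInd {V : Type*} (K : SimpleGraph V) (u v : V) : ℝ := if K.Adj u v then 1 else 0

theorem adjInd_nonneg {V : Type*} (K : SimpleGraph V) (u v : V) : 0 ≤ adjInd K u v := by
  unfold adjInd
  split <;> simp

theorem adjInd_le_one {V : Type*} (K : SimpleGraph V) (u v : V) : adjInd K u v ≤ 1 := by
  unfold adjInd
  split <;> simp

theorem adjInd_symm {V : Type*} (K : SimpleGraph V) (u v : V) : adjInd K u v = adjInd K v u := by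
  classical
  unfold adjInd
  exact if_congr (K.adj_comm u v) rfl rfl

theorem adjInd_self {V : Type*} (K : SimpleGraph V) (u : V) : adjInd K u u = 0 := by
  simp [adjInd]

theorem two_mul_sqNorm_incidence_eq_adjInd {V : Type*} [Fintype V] (K : SimpleGraph V)
    [Fintype K.edgeSet] (o : EdgeOrientation K) (z : V → ℝ) :
    2 * sqNorm (incidence K o *ᵥ z) = ∑ u, ∑ v, adjInd K u v * (z u - z v) ^ 2 := by
  classical
  exact two_mul_sqNorm_incidence_mulVec K o z

theorem sqNorm_incidence_le_of_degree_le {V : Type*} [Fintype V] {K : SimpleGraph V}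
    [Fintype K.edgeSet] (o : EdgeOrientation K) {d : ℝ} (hd : ∀ u, ∑ v, adjInd K u v ≤ d)
    (z : V → ℝ) : sqNorm (incidence K o *ᵥ z) ≤ 2 * d * sqNorm z := by
  have h0 := two_mul_sqNorm_incidence_eq_adjInd K o z
  have e1 : ∑ u, ∑ v, adjInd K u v * z u ^ 2 ≤ d * sqNorm z := by
    rw [sqNorm, Finset.mul_sum]
    refine Finset.sum_le_sum fun u _ => ?_
    rw [← Finset.sum_mul]
    exact mul_le_mul_of_nonneg_right (hd u) (sq_nonneg _)
  have e2 : ∑ u, ∑ v, adjInd K u v * z v ^ 2 ≤ d * sqNorm z := by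
    rw [Finset.sum_comm]
    refine le_trans (le_of_eq ?_) e1
    exact Finset.sum_congr rfl fun u _ => Finset.sum_congr rfl fun v _ => by rw [adjInd_symm]
  have e3 : ∑ u, ∑ v, adjInd K u v * (z u - z v) ^ 2 ≤
      2 * ∑ u, ∑ v, adjInd K u v * z u ^ 2 + 2 * ∑ u, ∑ v, adjInd K u v * z v ^ 2 := by
    simp only [Finset.mul_sum, ← Finset.sum_add_distrib]
    refine Finset.sum_le_sum fun u _ => Finset.sum_le_sum fun v _ => ?_
    have := mul_nonneg (adjInd_nonneg K u v) (sq_nonneg (z u + z v))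
    linarith
  linarith

variable {Ω : Type*} [MeasurableSpace Ω] {P : Measure Ω} [IsProbabilityMeasure P]
  {𝒢 : Ω → Fin T → SimpleGraph (Fin n)} {p : Fin T → ℝ}

/-- The event that a given pair is an edge of a given layer. -/
def edgeEvent (𝒢 : Ω → Fin T → SimpleGraph (Fin n))
    (q : Fin T × (⊤ : SimpleGraph (Fin n)).edgeSet) : Set Ω :=
  {ω | (q.2 : Sym2 (Fin n)) ∈ (𝒢 ω q.1).edgeSet}

/-- A pair of distinct items, as an edge of the complete graph. -/
def pairEdge {u v : Fin n} (h : u ≠ v) : (⊤ : SimpleGraph (Fin n)).edgeSet :=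
  ⟨s(u, v), by simpa using h⟩

omit [MeasurableSpace Ω] in
theorem indicator_edgeEvent (t : Fin T) {u v : Fin n} (h : u ≠ v) (ω : Ω) :
    (edgeEvent 𝒢 (t, pairEdge h)).indicator (fun _ => (1 : ℝ)) ω = adjInd (𝒢 ω t) u v := by
  classical
  rw [Set.indicator_apply]
  rfl

omit [IsProbabilityMeasure P] in
theorem IsErdosRenyiFamily.pSum_nonneg (hER : IsErdosRenyiFamily P 𝒢 p) : 0 ≤ pSum p :=
  Finset.sum_nonneg fun t _ => (hER.p_mem t).1

/-- The weights of the union of the layers. -/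
noncomputable def unionWeight (H : Fin T → SimpleGraph (Fin n)) (u v : Fin n) : ℝ :=
  ∑ t, adjInd (H t) u v

omit [IsProbabilityMeasure P] in
theorem IsErdosRenyiFamily.iIndepSet_edgeEvent (hER : IsErdosRenyiFamily P 𝒢 p) {J : Type*}
    {e : J → Fin T × (⊤ : SimpleGraph (Fin n)).edgeSet} (he : Function.Injective e) :
    iIndepSet (fun j => edgeEvent 𝒢 (e j)) P :=
  iIndepSet.precomp (s := edgeEvent 𝒢) he hER.indep

omit [IsProbabilityMeasure P] in
theorem IsErdosRenyiFamily.prob_edgeEvent (hER : IsErdosRenyiFamily P 𝒢 p)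
    (q : Fin T × (⊤ : SimpleGraph (Fin n)).edgeSet) : P.real (edgeEvent 𝒢 q) = p q.1 :=
  hER.prob_edge q.1 q.2

omit [IsProbabilityMeasure P] in
theorem IsErdosRenyiFamily.le_pMax (hER : IsErdosRenyiFamily P 𝒢 p) (t : Fin T) :
    0 ≤ p t ∧ p t ≤ pMax p :=
  ⟨(hER.p_mem t).1, le_ciSup (f := p) (Set.finite_range p).bddAbove t⟩

/-- The degree of `u` is a sum of `n - 1` independent indicators, one for each other item, so
Hoeffding's inequality applies. -/
theorem layer_degree_tail (hER : IsErdosRenyiFamily P 𝒢 p) (hn : 2 ≤ n) (t : Fin T) (u : Fin n)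
    {s : ℝ} (hs : 0 ≤ s) :
    P.real {ω | n * pMax p + s ≤ ∑ v, adjInd (𝒢 ω t) u v} ≤ Real.exp (-(2 * s ^ 2 / n)) := by
  have hne : ∀ v : ↥(({u} : Finset (Fin n))ᶜ), u ≠ v := fun v h =>
    Finset.mem_compl.1 v.2 (Finset.mem_singleton.2 h.symm)
  set e : ↥(({u} : Finset (Fin n))ᶜ) → Fin T × (⊤ : SimpleGraph (Fin n)).edgeSet :=
    fun v => (t, pairEdge (hne v)) with he
  have hinj : Function.Injective e := by
    intro v v' h
    have h1 : s(u, (v : Fin n)) = s(u, (v' : Fin n)) := congrArg Subtype.val (Prod.ext_iff.1 h).2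
    exact Subtype.ext (Sym2.congr_right.1 h1)
  have hcard : Fintype.card ↥(({u} : Finset (Fin n))ᶜ) = n - 1 := by
    simp
  have hp : ∑ v, P.real (edgeEvent 𝒢 (e v)) ≤ n * pMax p := by
    have h0 : 0 ≤ pMax p := (hER.le_pMax t).1.trans (hER.le_pMax t).2
    calc ∑ v, P.real (edgeEvent 𝒢 (e v)) ≤ ∑ _v : ↥(({u} : Finset (Fin n))ᶜ), pMax p :=
          Finset.sum_le_sum fun v _ => (hER.prob_edgeEvent _).trans_le (hER.le_pMax t).2
      _ = ((n - 1 : ℕ) : ℝ) * pMax p := by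
          rw [Finset.sum_const, Finset.card_univ, hcard, nsmul_eq_mul]
      _ ≤ n * pMax p := by
          gcongr
          omega
  have h := eventCount_hoeffding (P := P) (A := fun v => edgeEvent 𝒢 (e v)) (k := n)
    (fun v => hER.measurableSet_edge _ _) (hER.iIndepSet_edgeEvent hinj) hp hs
    (by omega) (by omega)
  refine le_trans (le_of_eq ?_) h
  congr 1
  ext ω
  have : ∑ v, adjInd (𝒢 ω t) u v = eventCount (fun v => edgeEvent 𝒢 (e v)) ω := by
    simp only [eventCount, he, indicator_edgeEvent]
    rw [Finset.sum_coe_sort (({u} : Finset (Fin n))ᶜ) fun v => adjInd (𝒢 ω t) u v,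
      ← Finset.sum_add_sum_compl {u}, Finset.sum_singleton, adjInd_self, zero_add]
  simp only [Set.mem_ofPred_eq, this]

/-- The pairs of items separated by a set, in every layer. -/
def cutPair (A : Finset (Fin n)) (j : Fin T × ↥A × ↥Aᶜ) :
    Fin T × (⊤ : SimpleGraph (Fin n)).edgeSet :=
  (j.1, pairEdge (u := j.2.1) (v := j.2.2) fun h =>
    Finset.mem_compl.1 j.2.2.2 (h ▸ j.2.1.2))

/-- Transfers the independence of the edge events to the pairs across a cut. Edges are unordered,
but a swap is excluded since `A` and its complement are disjoint. -/
theorem cutPair_injective (A : Finset (Fin n)) :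
    Function.Injective (cutPair (T := T) A) := by
  rintro ⟨t, a, b⟩ ⟨t', a', b'⟩ h
  have h1 : s((a : Fin n), (b : Fin n)) = s((a' : Fin n), (b' : Fin n)) :=
    congrArg Subtype.val (Prod.ext_iff.1 h).2
  have h2 : t = t' := (Prod.ext_iff.1 h).1
  rcases Sym2.eq_iff.1 h1 with ⟨h3, h4⟩ | ⟨h3, -⟩
  · rw [h2, Subtype.ext h3, Subtype.ext h4]
  · exact absurd a.2 (h3 ▸ Finset.mem_compl.1 b'.2)

omit [MeasurableSpace Ω] in
theorem eventCount_cutPair (A : Finset (Fin n)) (ω : Ω) :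
    eventCount (fun j => edgeEvent 𝒢 (cutPair A j)) ω =
      ∑ a ∈ A, ∑ b ∈ Aᶜ, unionWeight (𝒢 ω) a b := by
  simp only [eventCount, cutPair, indicator_edgeEvent, unionWeight]
  rw [Fintype.sum_prod_type]
  simp only [Fintype.sum_prod_type]
  have h : ∀ t, ∑ a : A, ∑ b : ↥Aᶜ, adjInd (𝒢 ω t) a b =
      ∑ a ∈ A, ∑ b ∈ Aᶜ, adjInd (𝒢 ω t) a b := by
    intro t
    rw [← Finset.sum_coe_sort A]
    exact Finset.sum_congr rfl fun a _ =>
      Finset.sum_coe_sort Aᶜ fun b => adjInd (𝒢 ω t) a b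
  simp only [h]
  rw [Finset.sum_comm]
  exact Finset.sum_congr rfl fun a _ => Finset.sum_comm

omit [IsProbabilityMeasure P] in
theorem sum_prob_cutPair (hER : IsErdosRenyiFamily P 𝒢 p) (A : Finset (Fin n)) :
    ∑ j, P.real (edgeEvent 𝒢 (cutPair A j)) = pSum p * (A.card * (n - A.card)) := by
  simp only [hER.prob_edgeEvent, cutPair]
  rw [Fintype.sum_prod_type]
  simp only [Finset.sum_const, Finset.card_univ, Fintype.card_prod, Fintype.card_coe,
    Finset.card_compl, Fintype.card_fin, nsmul_eq_mul]
  rw [← Finset.mul_sum, Nat.cast_mul,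
    Nat.cast_sub (by simpa using Finset.card_le_univ A), pSum, mul_comm]

/-- As `A` contains at most half of the items, the expected cut is at least `n p_sum |A| / 2`. The
bound is geometric in `|A|`, which lets the union bound over all sets sum up. -/
theorem cut_lower_tail (hER : IsErdosRenyiFamily P 𝒢 p) {A : Finset (Fin n)}
    (hA : 2 * A.card ≤ n) :
    P.real {ω | ∑ a ∈ A, ∑ b ∈ Aᶜ, unionWeight (𝒢 ω) a b < n * pSum p / 8 * A.card} ≤
      Real.exp (-(n * pSum p / 6)) ^ A.card := by
  have h := eventCount_lower_tail (P := P) (A := fun j => edgeEvent 𝒢 (cutPair A j))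
    (fun v => hER.measurableSet_edge _ _)
    (hER.iIndepSet_edgeEvent (cutPair_injective A)) (sum_prob_cutPair hER A)
  have hA' : 2 * (A.card : ℝ) ≤ n := by exact_mod_cast hA
  have h0 : 0 ≤ pSum p := hER.pSum_nonneg
  have hkey : n * pSum p / 2 * A.card ≤ pSum p * (A.card * (n - A.card)) := by
    have : 0 ≤ pSum p * A.card * (n - 2 * A.card) := by
      have : 0 ≤ (n : ℝ) - 2 * A.card := by linarith
      positivity
    linarith
  refine (measureReal_mono fun ω hω => ?_).trans (h.trans ?_)
  · simp only [Set.mem_ofPred_eq] at hω ⊢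
    rw [eventCount_cutPair]
    linarith
  · rw [← Real.exp_nat_mul, Real.exp_le_exp]
    linarith

theorem union_degree_tail (hER : IsErdosRenyiFamily P 𝒢 p) (u : Fin n) :
    P.real {ω | 4 * (n * pSum p) ≤ ∑ v, unionWeight (𝒢 ω) u v} ≤
      Real.exp (-2 * (n * pSum p)) := by
  have hm : ∑ j, P.real (edgeEvent 𝒢 (cutPair {u} j)) ≤ n * pSum p := by
    rw [sum_prob_cutPair hER, Finset.card_singleton, Nat.cast_one]
    nlinarith [hER.pSum_nonneg]
  have h := eventCount_upper_tail (P := P) (A := fun j => edgeEvent 𝒢 (cutPair {u} j))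
    (fun v => hER.measurableSet_edge _ _)
    (hER.iIndepSet_edgeEvent (cutPair_injective {u})) hm
  refine le_trans (le_of_eq ?_) h
  congr 1
  ext ω
  have : ∑ v, unionWeight (𝒢 ω) u v = eventCount (fun j => edgeEvent 𝒢 (cutPair {u} j)) ω := by
    rw [eventCount_cutPair, Finset.sum_singleton, ← Finset.sum_add_sum_compl {u},
      Finset.sum_singleton]
    simp [unionWeight, adjInd_self]
  simp only [Set.mem_ofPred_eq, this]

/-- Deterministic consequence of Cheeger's inequality for the union of the layers. -/
theorem spectralGap_of_cuts {H : Fin T → SimpleGraph (Fin n)} [∀ t, Fintype (H t).edgeSet]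
    (o : ∀ t, EdgeOrientation (H t)) {q : ℝ} (hq : 0 < q)
    (hcut : ∀ A : Finset (Fin n), 2 * A.card ≤ n →
      q / 8 * A.card ≤ ∑ a ∈ A, ∑ b ∈ Aᶜ, unionWeight H a b)
    (hdeg : ∀ u, ∑ v, unionWeight H u v ≤ 4 * q) {z : Fin n → ℝ} (hz : ∑ i, z i = 0) :
    -- Cheeger's inequality with expansion `q/8`, degrees `4q` and an energy equal to twice the
    -- Laplacian form: `(q/8)² / (2 · 4q) = q/512`.
    q / 512 * sqNorm z ≤ ∑ t, sqNorm (incidence (H t) (o t) *ᵥ z) := by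
  have h := cheeger (w := unionWeight H)
    (fun u v => Finset.sum_nonneg fun t _ => adjInd_nonneg _ _ _)
    (fun u v => Finset.sum_congr rfl fun t _ => adjInd_symm _ _ _) (h := q / 8) (d := 4 * q)
    (by positivity) (by positivity) (by simpa using hcut) hdeg hz
  have hE : ∑ u, ∑ v, unionWeight H u v * (z u - z v) ^ 2 =
      2 * ∑ t, sqNorm (incidence (H t) (o t) *ᵥ z) := by
    rw [Finset.mul_sum]
    simp only [two_mul_sqNorm_incidence_eq_adjInd, unionWeight, Finset.sum_mul]
    rw [Finset.sum_congr rfl fun u _ => Finset.sum_comm, Finset.sum_comm]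
  rw [hE] at h
  have h2 : q * (q / 512 * sqNorm z) ≤ q * ∑ t, sqNorm (incidence (H t) (o t) *ᵥ z) := by
    rw [sqNorm]
    linarith
  exact le_of_mul_le_mul_left h2 hq

/-- With high probability, the sum of the Laplacians of the layers has a spectral gap of order
`n * pSum p`. -/
theorem union_spectralGap_prob (hER : IsErdosRenyiFamily P 𝒢 p) (hn : 2 ≤ n) {δ : ℝ}
    (hδ0 : 0 < δ) (hδ : δ < Real.exp (-1)) (hp : 24 * (Real.log (n / δ) / n) ≤ pSum p) :
    P.real {ω | ¬ ((∀ A : Finset (Fin n), 2 * A.card ≤ n →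
        n * pSum p / 8 * A.card ≤ ∑ a ∈ A, ∑ b ∈ Aᶜ, unionWeight (𝒢 ω) a b) ∧
      ∀ u, ∑ v, unionWeight (𝒢 ω) u v ≤ 4 * (n * pSum p))} ≤ δ := by
  have hn0 : (0 : ℝ) < n := by positivity
  have hn1 : (2 : ℝ) ≤ n := by exact_mod_cast hn
  have hδ2 : δ < 1 / 2 := hδ.trans Real.exp_neg_one_lt_half
  have hL : 24 * Real.log (n / δ) ≤ n * pSum p := by
    have := mul_le_mul_of_nonneg_left hp hn0.le
    rwa [show (n : ℝ) * (24 * (Real.log (n / δ) / n)) = 24 * Real.log (n / δ) by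
      field_simp] at this
  have hlog : 0 < Real.log (n / δ) := Real.log_pos (by rw [one_lt_div hδ0]; linarith)
  set r := δ / n with hr
  have hr0 : 0 < r := div_pos hδ0 hn0
  have hexp : Real.exp (-(4 * Real.log (n / δ))) = r ^ 4 := by
    rw [← mul_neg, ← Real.log_inv, inv_div, mul_comm, Real.exp_mul, Real.exp_log hr0]
    norm_cast
  set q := Real.exp (-(n * pSum p / 6)) with hq
  have hqr : q ≤ r ^ 4 := by
    rw [hq, ← hexp, Real.exp_le_exp]
    linarith
  have hq0 : 0 < q := Real.exp_pos _
  -- The constant `24 = 6 · 4` yields the fourth power of `r = δ/n`: one factor pays for the union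
  -- over vertices and the others supply the slack `1/8`.
  have hr4 : n * r ^ 4 ≤ δ / 8 := by
    have h1 : r ≤ δ := div_le_self hδ0.le (by linarith)
    have h2 : n * r = δ := by rw [hr]; field_simp
    have h3 : r ^ 3 ≤ δ ^ 3 := pow_le_pow_left₀ hr0.le h1 3
    have h4 : δ ^ 3 ≤ (1 / 2) ^ 3 := pow_le_pow_left₀ hδ0.le hδ2.le 3
    calc n * r ^ 4 = δ * r ^ 3 := by rw [← h2]; ring
      _ ≤ δ * (1 / 8) := by
          refine mul_le_mul_of_nonneg_left (h3.trans (h4.trans ?_)) hδ0.le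
          norm_num
      _ = δ / 8 := by ring
  set 𝒜 : Finset (Finset (Fin n)) := Finset.univ.filter fun A => A.Nonempty ∧ 2 * A.card ≤ n
    with h𝒜
  set bad : Finset (Fin n) → Set Ω := fun A =>
    {ω | ∑ a ∈ A, ∑ b ∈ Aᶜ, unionWeight (𝒢 ω) a b < n * pSum p / 8 * A.card} with hbad
  set badv : Fin n → Set Ω := fun u => {ω | 4 * (n * pSum p) ≤ ∑ v, unionWeight (𝒢 ω) u v}
    with hbadv
  have hsub : {ω | ¬ ((∀ A : Finset (Fin n), 2 * A.card ≤ n →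
        n * pSum p / 8 * A.card ≤ ∑ a ∈ A, ∑ b ∈ Aᶜ, unionWeight (𝒢 ω) a b) ∧
      ∀ u, ∑ v, unionWeight (𝒢 ω) u v ≤ 4 * (n * pSum p))} ⊆
      (⋃ A ∈ 𝒜, bad A) ∪ ⋃ u ∈ Finset.univ, badv u := by
    intro ω hω
    by_contra hcon
    refine hω ⟨fun A hA => ?_, fun u => ?_⟩
    · rcases A.eq_empty_or_nonempty with rfl | hne
      · simp
      · by_contra hlt
        refine hcon (Or.inl (Set.mem_biUnion (x := A) ?_ (not_le.1 hlt)))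
        simp [h𝒜, hne, hA]
    · by_contra hlt
      exact hcon (Or.inr (Set.mem_biUnion (x := u) (Finset.mem_coe.2 (Finset.mem_univ u))
        (not_le.1 hlt).le))
  -- By the binomial theorem the sum over nonempty sets is at most `(1 + q)^n - 1 ≤ e^{nq} - 1 ≤
  -- 2nq`.
  have h1 : ∑ A ∈ 𝒜, P.real (bad A) ≤ δ / 4 := by
    have hall : ∑ A : Finset (Fin n), q ^ A.card = (q + 1) ^ n := by
      have := Fintype.sum_pow_mul_eq_add_pow (Fin n) q 1
      simpa using this
    have hle : ∑ A ∈ 𝒜, q ^ A.card ≤ (q + 1) ^ n - 1 := by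
      have hins : ∑ A ∈ insert ∅ 𝒜, q ^ A.card ≤ (q + 1) ^ n := by
        rw [← hall]
        exact Finset.sum_le_sum_of_subset_of_nonneg (Finset.subset_univ _)
          fun _ _ _ => pow_nonneg hq0.le _
      rw [Finset.sum_insert (by simp [h𝒜])] at hins
      simp only [Finset.card_empty, pow_zero] at hins
      linarith
    have hx : n * q ≤ δ / 8 := (mul_le_mul_of_nonneg_left hqr hn0.le).trans hr4
    have hpow : (q + 1) ^ n ≤ Real.exp (n * q) := by
      rw [Real.exp_nat_mul]
      exact pow_le_pow_left₀ (by positivity) (Real.add_one_le_exp q) n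
    have hexp2 : Real.exp (n * q) ≤ 1 + 2 * (n * q) := by
      have hx0 : 0 ≤ n * q := by positivity
      have := Real.abs_exp_sub_one_sub_id_le (x := n * q) (by rw [abs_of_nonneg hx0]; linarith)
      have := (abs_le.1 this).2
      nlinarith
    calc ∑ A ∈ 𝒜, P.real (bad A) ≤ ∑ A ∈ 𝒜, q ^ A.card :=
          Finset.sum_le_sum fun A hA => cut_lower_tail hER (by simp [h𝒜] at hA; exact hA.2)
      _ ≤ δ / 4 := by linarith
  have h2 : ∑ u, P.real (badv u) ≤ δ / 8 := by
    calc ∑ u, P.real (badv u) ≤ ∑ _u : Fin n, r ^ 4 := by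
          refine Finset.sum_le_sum fun u _ => (union_degree_tail hER u).trans ?_
          rw [← hexp, Real.exp_le_exp]
          linarith
      _ = n * r ^ 4 := by simp
      _ ≤ δ / 8 := hr4
  calc _ ≤ P.real ((⋃ A ∈ 𝒜, bad A) ∪ ⋃ u ∈ Finset.univ, badv u) := measureReal_mono hsub
    _ ≤ ∑ A ∈ 𝒜, P.real (bad A) + ∑ u, P.real (badv u) :=
        (measureReal_union_le _ _).trans
          (add_le_add (measureReal_biUnion_finset_le _ _) (measureReal_biUnion_finset_le _ _))
    _ ≤ δ := by linarith

/-- With high probability, the Laplacians of all the layers are bounded by `gam n p δ ^ 2`. -/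
theorem layer_degree_prob (hER : IsErdosRenyiFamily P 𝒢 p) (hn : 2 ≤ n) (hT : 1 ≤ T) {δ : ℝ}
    (hδ0 : 0 < δ) (hδ : δ < 1) :
    P.real {ω | ¬ ∀ t u, 2 * ∑ v, adjInd (𝒢 ω t) u v ≤ gam n p δ ^ 2} ≤ δ := by
  have hn0 : (0 : ℝ) < n := by positivity
  have hT0 : (0 : ℝ) < T := by positivity
  have hnT : (1 : ℝ) ≤ n * T := by
    have h1 : (1 : ℝ) ≤ T := by exact_mod_cast hT
    have h2 : (1 : ℝ) ≤ n := by exact_mod_cast (by omega : 1 ≤ n)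
    exact one_le_mul_of_one_le_of_one_le h2 h1
  have hpm : 0 ≤ pMax p := (hER.le_pMax ⟨0, hT⟩).1.trans (hER.le_pMax ⟨0, hT⟩).2
  set L := Real.log (n * T / δ) with hL
  have hL0 : 0 ≤ L := Real.log_nonneg (by rw [le_div_iff₀ hδ0]; linarith)
  -- Chosen so that the Hoeffding bound `exp(-2s²/n)` equals `δ/(nT)`. Then `2s = √(2nL)` is the
  -- square of the fourth root in `gam`.
  set s := √(n * L / 2) with hs
  have hs0 : 0 ≤ s := Real.sqrt_nonneg _
  have hs2 : s ^ 2 = n * L / 2 := Real.sq_sqrt (by positivity)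
  rcases le_total (√(2 * n * pMax p) + (2 * n * L) ^ (1 / 4 : ℝ)) √(2 * n) with hcase | hcase
  · have hg : 2 * (n * pMax p + s) ≤ gam n p δ ^ 2 := by
      rw [gam, min_eq_left hcase]
      have h1 : √(2 * n * pMax p) ^ 2 = 2 * n * pMax p := Real.sq_sqrt (by positivity)
      have h2 : ((2 * n * L) ^ (1 / 4 : ℝ)) ^ 2 = 2 * s := by
        rw [← Real.rpow_natCast, ← Real.rpow_mul (by positivity)]
        have : 2 * s = √(2 * n * L) := by
          rw [hs, ← Real.sqrt_sq (zero_le_two : (0 : ℝ) ≤ 2), ← Real.sqrt_mul (by positivity)]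
          congr 1
          rw [Real.sqrt_sq (zero_le_two : (0 : ℝ) ≤ 2)]
          ring
        rw [this, Real.sqrt_eq_rpow]
        norm_num
      have h3 : 0 ≤ √(2 * n * pMax p) * (2 * n * L) ^ (1 / 4 : ℝ) := by positivity
      rw [← hL] at *
      nlinarith
    have hsub : {ω | ¬ ∀ t u, 2 * ∑ v, adjInd (𝒢 ω t) u v ≤ gam n p δ ^ 2} ⊆
        ⋃ i : Fin T × Fin n, {ω | n * pMax p + s ≤ ∑ v, adjInd (𝒢 ω i.1) i.2 v} := by
      intro ω hω
      simp only [Set.mem_ofPred_eq, not_forall, not_le] at hω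
      obtain ⟨t, u, h⟩ := hω
      refine Set.mem_iUnion.2 ⟨(t, u), ?_⟩
      simp only [Set.mem_ofPred_eq]
      linarith
    refine (measureReal_mono hsub).trans ((measureReal_iUnion_fintype_le _).trans ?_)
    have hexp : Real.exp (-(2 * s ^ 2 / n)) = δ / (n * T) := by
      rw [hs2, show 2 * (n * L / 2) / (n : ℝ) = L by field_simp, hL, ← Real.log_inv, inv_div,
        Real.exp_log (by positivity)]
    calc _ ≤ ∑ _i : Fin T × Fin n, δ / (n * T) :=
          Finset.sum_le_sum fun i _ => (layer_degree_tail hER hn i.1 i.2 hs0).trans_eq hexp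
      _ = δ := by
          simp
          field_simp
  -- Here nothing is random: every degree is at most `n`.
  · have hg : gam n p δ ^ 2 = 2 * n := by
      rw [gam, min_eq_right hcase, Real.sq_sqrt (by positivity)]
    have : {ω | ¬ ∀ t u, 2 * ∑ v, adjInd (𝒢 ω t) u v ≤ gam n p δ ^ 2} = ∅ := by
      ext ω
      simp only [Set.mem_ofPred_eq, Set.mem_empty_iff_false, iff_false, not_not]
      intro t u
      rw [hg]
      have : ∑ v, adjInd (𝒢 ω t) u v ≤ ∑ _v : Fin n, (1 : ℝ) :=
        Finset.sum_le_sum fun v _ => adjInd_le_one _ _ _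
      simp at this
      linarith
    rw [this, measureReal_empty]
    exact hδ0.le

end RandomGraph

/-! ### High probability error bounds -/

section ErrorBounds

variable {n T : ℕ} {Ω : Type*} [MeasurableSpace Ω] {P : Measure Ω} [IsProbabilityMeasure P]
  {G : SimpleGraph (Fin T)} {oG : EdgeOrientation G} {𝒢 : Ω → Fin T → SimpleGraph (Fin n)}
  {p : Fin T → ℝ} {η : Ω → Fin T → Sym2 (Fin n) → ℝ} {σ : ℝ≥0} {x : Fin T × Fin n → ℝ} {S : ℝ}

-- A family of graphs is determined by its finitely many edge indicators, so one may condition on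
-- its exact value.
omit [IsProbabilityMeasure P] in
theorem IsErdosRenyiFamily.measurableSet_eq (hER : IsErdosRenyiFamily P 𝒢 p)
    (H : Fin T → SimpleGraph (Fin n)) : MeasurableSet {ω | 𝒢 ω = H} := by
  have h : {ω | 𝒢 ω = H} = ⋂ t, ⋂ e : (⊤ : SimpleGraph (Fin n)).edgeSet,
      {ω | (e : Sym2 (Fin n)) ∈ (𝒢 ω t).edgeSet ↔ (e : Sym2 (Fin n)) ∈ (H t).edgeSet} := by
    ext ω
    simp only [Set.mem_ofPred_eq, Set.mem_iInter]
    constructor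
    · rintro rfl t e
      rfl
    · intro h
      funext t
      ext u v
      by_cases huv : u = v
      · simp [huv]
      · exact h t (pairEdge huv)
  rw [h]
  refine MeasurableSet.iInter fun t => MeasurableSet.iInter fun e => ?_
  by_cases he : (e : Sym2 (Fin n)) ∈ (H t).edgeSet
  · simpa [he] using hER.measurableSet_edge t e
  · simp only [he, iff_false]
    exact (hER.measurableSet_edge t e).compl

open scoped Classical in
/-- If, for each of the possible values `H` of the random graphs, a linear image of the noise
bounds the error, then the error is small with high probability. -/
theorem noise_tail_of_conditional (hER : IsErdosRenyiFamily P 𝒢 p)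
    (hN : IsSubgaussianNoise P 𝒢 η σ)
    (R : ∀ H : Fin T → SimpleGraph (Fin n), Matrix (Fin T × Fin n) (MeasIdx H) ℝ) {δ : ℝ}
    (hδ0 : 0 < δ) (hδ : δ < Real.exp (-1)) :
    P.real {ω | 8 * σ ^ 2 * frobSq (R (𝒢 ω)) * Real.log (1 / δ) <
      sqNorm (R (𝒢 ω) *ᵥ noiseVec (𝒢 ω) (η ω))} ≤ δ := by
  set bad : (Fin T → SimpleGraph (Fin n)) → Set Ω := fun H =>
    {ω | 8 * σ ^ 2 * frobSq (R H) * Real.log (1 / δ) < sqNorm (R H *ᵥ noiseVec H (η ω))} with hbad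
  have hsub : {ω | 8 * σ ^ 2 * frobSq (R (𝒢 ω)) * Real.log (1 / δ) <
      sqNorm (R (𝒢 ω) *ᵥ noiseVec (𝒢 ω) (η ω))} ⊆
      ⋃ H ∈ (Finset.univ : Finset (Fin T → SimpleGraph (Fin n))), {ω | 𝒢 ω = H} ∩ bad H := by
    intro ω hω
    exact Set.mem_biUnion (x := 𝒢 ω) (Finset.mem_coe.2 (Finset.mem_univ _)) ⟨rfl, hω⟩
  -- Given `𝒢 = H`, the matrix `R H` is deterministic and the subgaussian tail bound applies under
  -- the conditional measure.
  have hone : ∀ H, P ({ω | 𝒢 ω = H} ∩ bad H) ≤ P {ω | 𝒢 ω = H} * ENNReal.ofReal δ := by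
    intro H
    by_cases h0 : P {ω | 𝒢 ω = H} = 0
    · rw [h0, zero_mul]
      exact (measure_mono Set.inter_subset_left).trans_eq h0
    · have hprob : IsProbabilityMeasure (ProbabilityTheory.cond P {ω | 𝒢 ω = H}) :=
        cond_isProbabilityMeasure h0
      have h := measure_sqNorm_mulVec_le (hN.subgaussian H h0) (R H) hδ0 hδ
      rw [cond_apply (hER.measurableSet_eq H)] at h
      calc P ({ω | 𝒢 ω = H} ∩ bad H)
          = P {ω | 𝒢 ω = H} * ((P {ω | 𝒢 ω = H})⁻¹ * P ({ω | 𝒢 ω = H} ∩ bad H)) := by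
            rw [← mul_assoc, ENNReal.mul_inv_cancel h0 (measure_ne_top _ _), one_mul]
        _ ≤ _ := by gcongr
  have hsum : ∑ H, P {ω | 𝒢 ω = H} ≤ 1 := by
    have := sum_measure_preimage_singleton (μ := P) (f := 𝒢) Finset.univ
      fun H _ => hER.measurableSet_eq H
    exact this.trans_le prob_le_one
  refine ENNReal.toReal_le_of_le_ofReal hδ0.le ?_
  calc _ ≤ P (⋃ H ∈ (Finset.univ : Finset (Fin T → SimpleGraph (Fin n))),
        {ω | 𝒢 ω = H} ∩ bad H) := measure_mono hsub
    _ ≤ ∑ H, P ({ω | 𝒢 ω = H} ∩ bad H) := measure_biUnion_finset_le _ _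
    _ ≤ ∑ H, P {ω | 𝒢 ω = H} * ENNReal.ofReal δ := Finset.sum_le_sum fun H _ => hone H
    _ ≤ 1 * ENNReal.ofReal δ := by
        rw [← Finset.sum_mul]
        gcongr
    _ = ENNReal.ofReal δ := one_mul _

theorem log_div_pos {δ : ℝ} (hn : 1 ≤ n) (hT : 1 ≤ T) (hδ0 : 0 < δ) (hδ : δ < 1) :
    0 < Real.log (n * T / δ) := by
  have h1 : (1 : ℝ) ≤ T := by exact_mod_cast hT
  have h2 : (1 : ℝ) ≤ n := by exact_mod_cast hn
  exact Real.log_pos (by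
    rw [one_lt_div hδ0]
    linarith [one_le_mul_of_one_le_of_one_le h2 h1])

theorem gam_pos {δ : ℝ} (hn : 1 ≤ n) (hT : 1 ≤ T) (hδ0 : 0 < δ) (hδ : δ < 1) :
    0 < gam n p δ := by
  have hn0 : (0 : ℝ) < n := by positivity
  have hL := log_div_pos hn hT hδ0 hδ
  refine lt_min (add_pos_of_nonneg_of_pos (Real.sqrt_nonneg _) ?_) (Real.sqrt_pos.2 (by positivity))
  exact Real.rpow_pos_of_pos (by positivity) _

-- Both choices of layer graph enter only through the gap `lam` and the condition `2γ² ≤ μ lam`.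
open scoped Classical in
theorem sqError_prob (hM : Model P G oG 𝒢 p η σ x S)
    (o : ∀ (_ : Fin T) (K : SimpleGraph (Fin n)), EdgeOrientation K) (hn : 2 ≤ n) (hT : 1 ≤ T)
    {δ : ℝ} (hδ0 : 0 < δ) (hδ : δ < Real.exp (-1))
    (hp : 24 * (Real.log (n / δ) / n) ≤ pSum p) (hq : 0 < pSum p) {lam μ : ℝ} (hlam : 0 < lam)
    (hgap : ∀ z : Fin T → ℝ, lam * ∑ t, (z t - (∑ s, z s) / T) ^ 2 ≤ sqNorm (incidence G oG *ᵥ z))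
    (hμ : 2 * gam n p δ ^ 2 ≤ μ * lam) :
    P.real {ω | ¬ sqError G oG o μ x (𝒢 ω) (η ω) ≤
      2 * (S / lam * (1 + gam n p δ ^ 2 * T / (n * pSum p / 512))) +
      16 * σ ^ 2 * (gam n p δ ^ 2 * (4 * n * T ^ 2 / (n * pSum p / 512) ^ 2 +
        4 * (n * T) / (μ * lam) ^ 2)) * Real.log (1 / δ)} ≤ 3 * δ := by
  have hδ1 : δ < 1 := hδ.trans (Real.exp_neg_one_lt_half.trans (by norm_num))
  have hn0 : (0 : ℝ) < n := by positivity
  have hγ : 0 < gam n p δ := gam_pos (by omega) hT hδ0 hδ1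
  have hμ0 : 0 < μ := by
    by_contra hcon
    have := mul_nonpos_of_nonpos_of_nonneg (not_lt.1 hcon) hlam.le
    nlinarith
  have hlog : 0 ≤ Real.log (1 / δ) := Real.log_nonneg (by rw [le_div_iff₀ hδ0]; linarith)
  set g := gam n p δ ^ 2 with hg
  set κ := n * pSum p / 512 with hκdef
  have hκ : 0 < κ := by positivity
  set V := g * (4 * n * T ^ 2 / κ ^ 2 + 4 * (n * T) / (μ * lam) ^ 2) with hV
  set E₁ : (Fin T → SimpleGraph (Fin n)) → Prop := fun H =>
    ∀ t u, 2 * ∑ v, adjInd (H t) u v ≤ g with hE₁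
  set E₂ : (Fin T → SimpleGraph (Fin n)) → Prop := fun H =>
    (∀ A : Finset (Fin n), 2 * A.card ≤ n →
        n * pSum p / 8 * A.card ≤ ∑ a ∈ A, ∑ b ∈ Aᶜ, unionWeight H a b) ∧
      ∀ u, ∑ v, unionWeight H u v ≤ 4 * (n * pSum p) with hE₂
  -- The matrix must be selected from the graphs alone, before the noise, for the conditional tail
  -- bound to apply. Off the good graphs any choice will do.
  have hdet : ∀ H : Fin T → SimpleGraph (Fin n), ∃ R : Matrix (Fin T × Fin n) (MeasIdx H) ℝ,
      E₁ H → E₂ H → frobSq R ≤ V ∧ ∀ η, sqError G oG o μ x H η ≤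
        2 * (S / lam * (1 + g * T / κ)) + 2 * sqNorm (R *ᵥ noiseVec H η) := by
    intro H
    by_cases hH : E₁ H ∧ E₂ H
    · obtain ⟨R, hR1, hR2⟩ := sqError_le_of_laplacian_bounds (o := o) (H := H) hT hlam hκ hμ0
        (sq_nonneg _) hμ hgap
        (fun t z => by
          have := sqNorm_incidence_le_of_degree_le (o t (H t)) (d := g / 2)
            (fun u => by linarith [hH.1 t u]) z
          rwa [mul_div_cancel₀ _ (two_ne_zero : (2 : ℝ) ≠ 0)] at this)
        (fun z hz => spectralGap_of_cuts (fun t => o t (H t)) (by positivity) hH.2.1 hH.2.2 hz)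
        hM.centered hM.smooth
      exact ⟨R, fun _ _ => ⟨hR1, hR2⟩⟩
    · exact ⟨0, fun h1 h2 => absurd ⟨h1, h2⟩ hH⟩
  choose R hR using hdet
  have hb1 := layer_degree_prob hM.erdosRenyi hn hT hδ0 hδ1
  have hb2 := union_spectralGap_prob hM.erdosRenyi hn hδ0 hδ hp
  have hb3 := noise_tail_of_conditional hM.erdosRenyi hM.noise R hδ0 hδ
  refine (measureReal_mono (μ := P) (s₂ := {ω | ¬ E₁ (𝒢 ω)} ∪ ({ω | ¬ E₂ (𝒢 ω)} ∪
    {ω | 8 * σ ^ 2 * frobSq (R (𝒢 ω)) * Real.log (1 / δ) <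
      sqNorm (R (𝒢 ω) *ᵥ noiseVec (𝒢 ω) (η ω))})) ?_).trans ?_
  · intro ω hω
    by_contra hcon
    simp only [Set.mem_union, Set.mem_ofPred_eq, not_or, not_not, not_lt] at hcon
    obtain ⟨c1, c2, c3⟩ := hcon
    obtain ⟨hf, he⟩ := hR (𝒢 ω) c1 c2
    refine hω ((he (η ω)).trans (add_le_add le_rfl ?_))
    have h1 : 8 * σ ^ 2 * frobSq (R (𝒢 ω)) * Real.log (1 / δ) ≤
        8 * σ ^ 2 * V * Real.log (1 / δ) := by gcongr
    linarith
  · refine (measureReal_union_le _ _).trans ?_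
    have := measureReal_union_le (μ := P) {ω | ¬ E₂ (𝒢 ω)}
      {ω | 8 * σ ^ 2 * frobSq (R (𝒢 ω)) * Real.log (1 / δ) <
        sqNorm (R (𝒢 ω) *ᵥ noiseVec (𝒢 ω) (η ω))}
    linarith

-- With a single item there are no edges and the centered signal is zero. This settles the case
-- excluded by the assumption `2 ≤ n` of the probabilistic estimates.
omit [MeasurableSpace Ω] [IsProbabilityMeasure P] in
theorem sqError_eq_zero_of_one {T : ℕ} {G : SimpleGraph (Fin T)} {oG : EdgeOrientation G}
    {x : Fin T × Fin 1 → ℝ} (hx : ∀ t, ∑ i, x (t, i) = 0)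
    (o : ∀ (_ : Fin T) (K : SimpleGraph (Fin 1)), EdgeOrientation K) (μ : ℝ)
    (H : Fin T → SimpleGraph (Fin 1)) (η : Fin T → Sym2 (Fin 1) → ℝ) :
    sqError G oG o μ x H η = 0 := by
  have hemp : IsEmpty (MeasIdx H) := by
    refine ⟨fun r => ?_⟩
    obtain ⟨t, e, he⟩ := r
    induction e using Sym2.ind with
    | _ a b => exact (show (H t).Adj a b from he).ne (Subsingleton.elim a b)
  have hx0 : x = 0 := by
    funext ⟨t, i⟩
    have := hx t
    rw [Fin.sum_univ_one] at this
    rw [Subsingleton.elim i 0, this]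
    rfl
  rw [sqError, estimator, hx0]
  simp [sqNorm, Matrix.mulVec, dotProduct]

end ErrorBounds

/-! ### Choice of the regularization parameter and the explicit bounds -/

section MainBounds

/-- Positive reals are cubes, in a form adapted to exponents which are multiples of `1 / 3`. -/
theorem exists_cube_root {y : ℝ} (hy : 0 < y) :
    ∃ a : ℝ, 0 < a ∧ y = a ^ 3 ∧ y ^ (1 / 3 : ℝ) = a ∧ y ^ (2 / 3 : ℝ) = a ^ 2 := by
  refine ⟨y ^ (1 / 3 : ℝ), Real.rpow_pos_of_pos hy _, ?_, rfl, ?_⟩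
  · rw [← Real.rpow_natCast, ← Real.rpow_mul hy.le]
    norm_num
  · rw [← Real.rpow_natCast, ← Real.rpow_mul hy.le]
    norm_num

/-- Adding `θ - z ≤ μ` and `z ≤ w ≤ μ` shows that the subtracted term in `μ` costs only a factor
two. -/
theorem half_le_of_max_le {θ z w μ : ℝ} (hμ : μ = max (θ - z) w) (hw : z ≤ w) : θ / 2 ≤ μ := by
  have h1 := le_max_left (θ - z) w
  have h2 := le_max_right (θ - z) w
  rw [← hμ] at h1 h2
  linarith

/-- Decreasing in `μ`, so it suffices to insert the lower bound, whose factor `1/2` becomes the `4`.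
Writing all variables as cubes turns the fractional powers into a rational identity; `σ = 0` is
separate, as the cube roots must be positive. -/
theorem noise_term_complete {n T σ γ q S μ : ℝ} (hn : 0 < n) (hT : 0 < T) (hσ : 0 ≤ σ)
    (hγ : 0 < γ) (hq : 0 < q) (hS : 0 < S)
    (hμ : n ^ (2 / 3 : ℝ) * σ ^ (2 / 3 : ℝ) * γ ^ (2 / 3 : ℝ) *
      (q / (T ^ 2 * S)) ^ (1 / 3 : ℝ) / 2 ≤ μ) :
    σ ^ 2 * (γ ^ 2 * (n * T / (μ * T) ^ 2)) ≤ 4 * (σ ^ (2 / 3 : ℝ) * γ ^ (2 / 3 : ℝ) *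
      T ^ (1 / 3 : ℝ) * S ^ (2 / 3 : ℝ) / (n ^ (1 / 3 : ℝ) * q ^ (2 / 3 : ℝ))) := by
  rcases hσ.eq_or_lt with rfl | hσ
  · rw [Real.zero_rpow (by norm_num)]
    simp
  obtain ⟨a, ha, rfl, ea1, ea2⟩ := exists_cube_root hn
  obtain ⟨t, ht, rfl, et1, et2⟩ := exists_cube_root hT
  obtain ⟨s, hs, rfl, es1, es2⟩ := exists_cube_root hσ
  obtain ⟨c, hc, rfl, ec1, ec2⟩ := exists_cube_root hγ
  obtain ⟨b, hb, rfl, eb1, eb2⟩ := exists_cube_root hq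
  obtain ⟨d, hd, rfl, ed1, ed2⟩ := exists_cube_root hS
  have e : (b ^ 3 / ((t ^ 3) ^ 2 * d ^ 3)) ^ (1 / 3 : ℝ) = b / (t ^ 2 * d) := by
    rw [show b ^ 3 / ((t ^ 3) ^ 2 * d ^ 3) = (b / (t ^ 2 * d)) ^ 3 by field_simp,
      ← Real.rpow_natCast, ← Real.rpow_mul (by positivity)]
    norm_num
  rw [ea2, es2, ec2, e] at hμ
  rw [es2, ec2, et1, ed2, ea1, eb2]
  have hθ : 0 < a ^ 2 * s ^ 2 * c ^ 2 * (b / (t ^ 2 * d)) / 2 := by positivity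
  calc (s ^ 3) ^ 2 * ((c ^ 3) ^ 2 * (a ^ 3 * t ^ 3 / (μ * t ^ 3) ^ 2))
      ≤ (s ^ 3) ^ 2 * ((c ^ 3) ^ 2 * (a ^ 3 * t ^ 3 /
          (a ^ 2 * s ^ 2 * c ^ 2 * (b / (t ^ 2 * d)) / 2 * t ^ 3) ^ 2)) := by gcongr
    _ = _ := by
      field_simp
      norm_num

theorem noise_term_star {n T σ γ q S μ : ℝ} (hn : 0 < n) (hT : 0 < T) (hσ : 0 ≤ σ)
    (hγ : 0 < γ) (hq : 0 < q) (hS : 0 < S)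
    (hμ : n ^ (2 / 3 : ℝ) * σ ^ (2 / 3 : ℝ) * γ ^ (2 / 3 : ℝ) * (q / S) ^ (1 / 3 : ℝ) / 2 ≤ μ) :
    σ ^ 2 * (γ ^ 2 * (n * T / (μ * 1) ^ 2)) ≤ 4 * (σ ^ (2 / 3 : ℝ) * γ ^ (2 / 3 : ℝ) *
      T * S ^ (2 / 3 : ℝ) / (n ^ (1 / 3 : ℝ) * q ^ (2 / 3 : ℝ))) := by
  rcases hσ.eq_or_lt with rfl | hσ
  · rw [Real.zero_rpow (by norm_num)]
    simp
  obtain ⟨a, ha, rfl, ea1, ea2⟩ := exists_cube_root hn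
  obtain ⟨s, hs, rfl, es1, es2⟩ := exists_cube_root hσ
  obtain ⟨c, hc, rfl, ec1, ec2⟩ := exists_cube_root hγ
  obtain ⟨b, hb, rfl, eb1, eb2⟩ := exists_cube_root hq
  obtain ⟨d, hd, rfl, ed1, ed2⟩ := exists_cube_root hS
  have e : (b ^ 3 / d ^ 3) ^ (1 / 3 : ℝ) = b / d := by
    rw [← div_pow, ← Real.rpow_natCast, ← Real.rpow_mul (by positivity)]
    norm_num
  rw [ea2, es2, ec2, e] at hμ
  rw [es2, ec2, ed2, ea1, eb2]
  have hθ : 0 < a ^ 2 * s ^ 2 * c ^ 2 * (b / d) / 2 := by positivity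
  calc (s ^ 3) ^ 2 * ((c ^ 3) ^ 2 * (a ^ 3 * T / (μ * 1) ^ 2))
      ≤ (s ^ 3) ^ 2 * ((c ^ 3) ^ 2 * (a ^ 3 * T /
          (a ^ 2 * s ^ 2 * c ^ 2 * (b / d) / 2 * 1) ^ 2)) := by gcongr
    _ = _ := by
      field_simp
      norm_num

theorem pSum_pos_of_le {n T : ℕ} {p : Fin T → ℝ} {δ : ℝ} (hn : 1 ≤ n) (hδ0 : 0 < δ)
    (hδ : δ < Real.exp (-1)) (hp : 24 * (Real.log (n / δ) / n) ≤ pSum p) : 0 < pSum p := by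
  have hn1 : (1 : ℝ) ≤ n := by exact_mod_cast hn
  have hδ1 : δ < 1 := hδ.trans (Real.exp_neg_one_lt_half.trans (by norm_num))
  have hlog : 0 < Real.log (n / δ) := Real.log_pos (by rw [one_lt_div hδ0]; linarith)
  refine lt_of_lt_of_le ?_ hp
  positivity

/-- Here `512` is the loss in the spectral gap and `1048576 = 4 · 512²`; the largest resulting
constant, `16 · 1048576`, is below `10 ^ 8`. -/
theorem combined_bound {a₁ a₂ b₁ b₂ c₁ c₂ s l : ℝ} (ha1 : 0 ≤ a₁) (ha2 : 0 ≤ a₂) (hb2 : 0 ≤ b₂)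
    (hl : 0 ≤ l) (hc1 : c₁ = 1048576 * b₂) (hc2 : s * c₂ ≤ 4 * b₁) (hb1 : 0 ≤ b₁) :
    2 * (a₁ + 512 * a₂) + 16 * (c₁ + 4 * (s * c₂)) * l ≤
      10 ^ 8 * (a₁ + a₂ + (b₁ + b₂) * l) := by
  have h1 : (s * c₂) * l ≤ 4 * b₁ * l := mul_le_mul_of_nonneg_right hc2 hl
  have h2 : 0 ≤ b₂ * l := mul_nonneg hb2 hl
  have h3 : 0 ≤ b₁ * l := mul_nonneg hb1 hl
  rw [hc1]
  nlinarith

variable {n T : ℕ} {Ω : Type*} [MeasurableSpace Ω] {P : Measure Ω} [IsProbabilityMeasure P]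
  {𝒢 : Ω → Fin T → SimpleGraph (Fin n)} {p : Fin T → ℝ} {η : Ω → Fin T → Sym2 (Fin n) → ℝ}
  {σ : ℝ≥0} {x : Fin T × Fin n → ℝ} {S : ℝ}

theorem boundComplete_nonneg {n T : ℕ} {p : Fin T → ℝ} {σ S δ : ℝ} (hσ : 0 ≤ σ) (hS : 0 ≤ S)
    (hγ : 0 ≤ gam n p δ) (hp : 0 ≤ pSum p) (hl : 0 ≤ Real.log (1 / δ)) :
    0 ≤ boundComplete n p σ S δ := by
  unfold boundComplete
  positivity

theorem boundStar_nonneg {n T : ℕ} {p : Fin T → ℝ} {σ S δ : ℝ} (hσ : 0 ≤ σ) (hS : 0 ≤ S)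
    (hγ : 0 ≤ gam n p δ) (hp : 0 ≤ pSum p) (hl : 0 ≤ Real.log (1 / δ)) :
    0 ≤ boundStar n p σ S δ := by
  unfold boundStar
  positivity

theorem complete_error_prob {oG : EdgeOrientation (⊤ : SimpleGraph (Fin T))}
    (hM : Model P ⊤ oG 𝒢 p η σ x S)
    (o : ∀ (_ : Fin T) (K : SimpleGraph (Fin n)), EdgeOrientation K) (hn : 1 ≤ n) (hT : 1 ≤ T)
    {δ : ℝ} (hδ0 : 0 < δ) (hδ : δ < Real.exp (-1))
    (hp : 24 * (Real.log (n / δ) / n) ≤ pSum p) :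
    P.real {ω | ¬ sqError ⊤ oG o (muComplete 2 n p σ S δ) x (𝒢 ω) (η ω) ≤
      10 ^ 8 * boundComplete n p σ S δ} ≤ 3 * δ := by
  classical
  have hδ1 : δ < 1 := hδ.trans (Real.exp_neg_one_lt_half.trans (by norm_num))
  have hγ : 0 < gam n p δ := gam_pos hn hT hδ0 hδ1
  have hq := pSum_pos_of_le hn hδ0 hδ hp
  have hlog : 0 ≤ Real.log (1 / δ) := Real.log_nonneg (by rw [le_div_iff₀ hδ0]; linarith)
  have hn0 : (0 : ℝ) < n := by positivity
  have hT0 : (0 : ℝ) < T := by positivity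
  have hS := hM.S_pos
  rcases hn.eq_or_lt with rfl | hn2
  · simp only [sqError_eq_zero_of_one hM.centered]
    have := boundComplete_nonneg σ.2 hS.le hγ.le hq.le hlog
    have hle : 0 ≤ 10 ^ 8 * boundComplete 1 p σ S δ := by positivity
    simp only [hle, not_true_eq_false, Set.ofPred_false, measureReal_empty]
    positivity
  set μ := muComplete 2 n p σ S δ with hμ
  have hμ1 : 2 / T * (n * pSum p / T + gam n p δ ^ 2) ≤ μ := le_max_right _ _
  have hμT : 2 * (n * pSum p / T + gam n p δ ^ 2) ≤ μ * T := by
    have := mul_le_mul_of_nonneg_right hμ1 hT0.le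
    rwa [show 2 / (T : ℝ) * (n * pSum p / T + gam n p δ ^ 2) * T =
      2 * (n * pSum p / T + gam n p δ ^ 2) by field_simp] at this
  have hz : 0 ≤ n * pSum p / T := by positivity
  have hhalf := half_le_of_max_le (rfl : μ = max _ _) (by
    have : n * pSum p / (T : ℝ) ^ 2 = 1 / T * (n * pSum p / T) := by field_simp
    rw [this, div_mul_eq_mul_div, div_mul_eq_mul_div]
    refine div_le_div_of_nonneg_right ?_ hT0.le
    nlinarith [sq_nonneg (gam n p δ)])
  have hnoise := noise_term_complete hn0 hT0 σ.2 hγ hq hS hhalf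
  have h := sqError_prob hM o hn2 hT hδ0 hδ hp hq hT0 (fun z => by convert spectralGap_top hT oG z) (μ := μ)
    (by linarith)
  refine le_trans (measureReal_mono (μ := P) fun ω hω => ?_) h
  simp only [Set.mem_ofPred_eq] at hω ⊢
  refine fun hle => hω (hle.trans ?_)
  rw [boundComplete]
  refine le_trans (le_of_eq ?_) (combined_bound (s := (σ : ℝ) ^ 2)
    (c₂ := gam n p δ ^ 2 * (n * T / (μ * T) ^ 2)) (a₁ := S / T)
    (a₂ := gam n p δ ^ 2 / (n * pSum p) * S) (by positivity) (by positivity) (by positivity) hlog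
    rfl hnoise (by positivity))
  have hμT0 : μ * T ≠ 0 := by
    have := sq_pos_of_pos hγ
    exact (lt_of_lt_of_le (by linarith) hμT).ne'
  have hμ0 : μ ≠ 0 := left_ne_zero_of_mul hμT0
  field_simp
  ring

theorem star_error_prob {r : Fin T} {oG : EdgeOrientation (SimpleGraph.starGraph r)}
    (hM : Model P (SimpleGraph.starGraph r) oG 𝒢 p η σ x S)
    (o : ∀ (_ : Fin T) (K : SimpleGraph (Fin n)), EdgeOrientation K) (hn : 1 ≤ n) (hT : 1 ≤ T)
    {δ : ℝ} (hδ0 : 0 < δ) (hδ : δ < Real.exp (-1))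
    (hp : 24 * (Real.log (n / δ) / n) ≤ pSum p) :
    P.real {ω | ¬ sqError (SimpleGraph.starGraph r) oG o (muStar 2 n p σ S δ) x (𝒢 ω) (η ω) ≤
      10 ^ 8 * boundStar n p σ S δ} ≤ 3 * δ := by
  classical
  have hδ1 : δ < 1 := hδ.trans (Real.exp_neg_one_lt_half.trans (by norm_num))
  have hγ : 0 < gam n p δ := gam_pos hn hT hδ0 hδ1
  have hq := pSum_pos_of_le hn hδ0 hδ hp
  have hlog : 0 ≤ Real.log (1 / δ) := Real.log_nonneg (by rw [le_div_iff₀ hδ0]; linarith)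
  have hn0 : (0 : ℝ) < n := by positivity
  have hT0 : (0 : ℝ) < T := by positivity
  have hS := hM.S_pos
  rcases hn.eq_or_lt with rfl | hn2
  · simp only [sqError_eq_zero_of_one hM.centered]
    have := boundStar_nonneg σ.2 hS.le hγ.le hq.le hlog
    have hle : 0 ≤ 10 ^ 8 * boundStar 1 p σ S δ := by positivity
    simp only [hle, not_true_eq_false, Set.ofPred_false, measureReal_empty]
    positivity
  set μ := muStar 2 n p σ S δ with hμ
  have hμ1 : 2 * (n * pSum p / T + gam n p δ ^ 2) ≤ μ := le_max_right _ _
  have hz : 0 ≤ n * pSum p / T := by positivity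
  have hhalf := half_le_of_max_le (rfl : μ = max _ _)
    (by nlinarith [sq_nonneg (gam n p δ)])
  have hnoise := noise_term_star hn0 hT0 σ.2 hγ hq hS hhalf
  have h := sqError_prob hM o hn2 hT hδ0 hδ hp hq one_pos (fun z => by convert spectralGap_star hT r oG z) (μ := μ)
    (by linarith)
  refine le_trans (measureReal_mono (μ := P) fun ω hω => ?_) h
  simp only [Set.mem_ofPred_eq] at hω ⊢
  refine fun hle => hω (hle.trans ?_)
  rw [boundStar]
  refine le_trans (le_of_eq ?_) (combined_bound (s := (σ : ℝ) ^ 2)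
    (c₂ := gam n p δ ^ 2 * (n * T / (μ * 1) ^ 2)) (a₁ := S)
    (a₂ := gam n p δ ^ 2 / (n * pSum p) * T * S) (by positivity) (by positivity) (by positivity)
    hlog rfl hnoise (by positivity))
  have hμ0 : μ ≠ 0 := by
    have := sq_pos_of_pos hγ
    exact (lt_of_lt_of_le (by linarith) hμ1).ne'
  field_simp
  ring

theorem le_measureReal_of_compl_le {Q : Ω → Prop} {a : ℝ} (h : P.real {ω | ¬ Q ω} ≤ a) :
    1 - a ≤ P.real {ω | Q ω} := by
  have h1 := measureReal_union_le (μ := P) {ω | Q ω} {ω | ¬ Q ω}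
  have h2 : {ω | Q ω} ∪ {ω | ¬ Q ω} = Set.univ := by
    ext ω
    simpa using em (Q ω)
  rw [h2, probReal_univ] at h1
  linarith

end MainBounds

/-! ### Weak consistency -/

section Consistency

/-- Once `log(nT/δ) ≥ 2n`, the fourth root alone exceeds `√(2n)`. This removes the dependence of `μ`
on `δ` for large `T`. -/
theorem gam_eq_sqrt {n T : ℕ} (p : Fin T → ℝ) {δ : ℝ} (hL : 2 * (n : ℝ) ≤ Real.log (n * T / δ)) :
    gam n p δ = √(2 * n) := by
  refine min_eq_right ((?_ : √(2 * (n : ℝ)) ≤ (2 * n * Real.log (n * T / δ)) ^ (1 / 4 : ℝ)).trans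
    (le_add_of_nonneg_left (Real.sqrt_nonneg _)))
  have h0 : (0 : ℝ) ≤ 2 * n := by positivity
  calc √(2 * (n : ℝ)) = ((2 * n : ℝ) ^ (2 : ℕ)) ^ (1 / 4 : ℝ) := by
        rw [Real.sqrt_eq_rpow, ← Real.rpow_natCast, ← Real.rpow_mul h0]
        norm_num
    _ ≤ (2 * n * Real.log (n * T / δ)) ^ (1 / 4 : ℝ) := by
        refine Real.rpow_le_rpow (by positivity) ?_ (by norm_num)
        rw [sq]
        exact mul_le_mul_of_nonneg_left hL h0

theorem eventually_gam_eq {n : ℕ} (hn : 1 ≤ n) {δ : ℝ} (hδ : 0 < δ) {T : ℕ → ℕ}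
    (hT : Tendsto T atTop atTop) (p : ∀ k, Fin (T k) → ℝ) :
    ∀ᶠ k in atTop, gam n (p k) δ = √(2 * n) := by
  have hn0 : (0 : ℝ) < n := by positivity
  have h1 : Tendsto (fun k => (n : ℝ) * T k / δ) atTop atTop :=
    ((tendsto_natCast_atTop_atTop.comp hT).const_mul_atTop hn0).atTop_div_const hδ
  filter_upwards [(Real.tendsto_log_atTop.comp h1).eventually_ge_atTop (2 * n)] with k hk
  exact gam_eq_sqrt (p k) hk

theorem rpow_two_thirds_div {T S q : ℝ} (hT : 0 < T) (hS : 0 < S) (hq : 0 < q) :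
    (S / (T * q)) ^ (2 / 3 : ℝ) = T ^ (1 / 3 : ℝ) * S ^ (2 / 3 : ℝ) / q ^ (2 / 3 : ℝ) / T := by
  rw [Real.div_rpow hS.le (by positivity), Real.mul_rpow hT.le hq.le]
  have h : T = T ^ (1 / 3 : ℝ) * T ^ (2 / 3 : ℝ) := by
    rw [← Real.rpow_add hT]
    norm_num
  have h1 : 0 < T ^ (1 / 3 : ℝ) := Real.rpow_pos_of_pos hT _
  have h2 : 0 < T ^ (2 / 3 : ℝ) := Real.rpow_pos_of_pos hT _
  have h3 : 0 < q ^ (2 / 3 : ℝ) := Real.rpow_pos_of_pos hq _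
  nth_rewrite 3 [h]
  field_simp

/-- The common shape of the bounds on the mean squared error, for fixed `n`. -/
noncomputable def mseBound (n : ℕ) (σ δ ρ τ : ℝ) : ℝ :=
  3 * ρ + (σ ^ (2 / 3 : ℝ) * √(2 * n) ^ (2 / 3 : ℝ) / (n : ℝ) ^ (1 / 3 : ℝ) * ρ ^ (2 / 3 : ℝ) +
    2 * σ ^ 2 * τ) * Real.log (1 / δ)

/-- With `γ² = 2n`, the second term contributes `2S / p_sum`, and `p_sum ≤ T` bounds `S/T` by one
more `S / p_sum`; this is the coefficient `3` in `mseBound`. -/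
theorem boundComplete_le {n T : ℕ} {p : Fin T → ℝ} {σ S δ : ℝ} (hn : 1 ≤ n) (hT : 1 ≤ T)
    (hS : 0 < S) (hq : 0 < pSum p) (hqT : pSum p ≤ T) (hγ : gam n p δ = √(2 * n)) :
    boundComplete n p σ S δ ≤ T * mseBound n σ δ (S / (T * pSum p)) (T / pSum p ^ 2) := by
  have hn0 : (0 : ℝ) < n := by positivity
  have hT0 : (0 : ℝ) < T := by positivity
  rw [boundComplete, mseBound, rpow_two_thirds_div hT0 hS hq, hγ, Real.sq_sqrt (by positivity)]
  have h1 : S / T ≤ S / pSum p := div_le_div_of_nonneg_left hS.le hq hqT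
  have h2 : 2 * (n : ℝ) / (n * pSum p) * S = 2 * (S / pSum p) := by field_simp
  have h3 : (T : ℝ) * (3 * (S / (T * pSum p))) = 3 * (S / pSum p) := by field_simp
  have h4 : (T : ℝ) * (σ ^ (2 / 3 : ℝ) * √(2 * n) ^ (2 / 3 : ℝ) / (n : ℝ) ^ (1 / 3 : ℝ) *
      ((T : ℝ) ^ (1 / 3 : ℝ) * S ^ (2 / 3 : ℝ) / pSum p ^ (2 / 3 : ℝ) / T) +
      2 * σ ^ 2 * (T / pSum p ^ 2)) =
      σ ^ (2 / 3 : ℝ) * √(2 * n) ^ (2 / 3 : ℝ) * (T : ℝ) ^ (1 / 3 : ℝ) * S ^ (2 / 3 : ℝ) /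
        ((n : ℝ) ^ (1 / 3 : ℝ) * pSum p ^ (2 / 3 : ℝ)) +
      σ ^ 2 * (2 * n) * (T : ℝ) ^ 2 / (n * pSum p ^ 2) := by
    have := (Real.rpow_pos_of_pos hn0 (1 / 3 : ℝ)).ne'
    have := (Real.rpow_pos_of_pos hq (2 / 3 : ℝ)).ne'
    field_simp
  rw [mul_add, h3, ← mul_assoc (T : ℝ) (_ + 2 * σ ^ 2 * _), h4, h2]
  linarith

theorem boundStar_le {n T : ℕ} {p : Fin T → ℝ} {σ S δ : ℝ} (hn : 1 ≤ n) (hT : 1 ≤ T)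
    (hS : 0 < S) (hq : 0 < pSum p) (hqT : pSum p ≤ T) (hγ : gam n p δ = √(2 * n)) :
    boundStar n p σ S δ ≤ T * mseBound n σ δ (S / pSum p) (T / pSum p ^ 2) := by
  have hn0 : (0 : ℝ) < n := by positivity
  have hT0 : (0 : ℝ) < T := by positivity
  rw [boundStar, mseBound, Real.div_rpow hS.le hq.le, hγ, Real.sq_sqrt (by positivity)]
  have h1 : S ≤ T * (S / pSum p) := by
    rw [← mul_div_assoc, le_div_iff₀ hq, mul_comm (T : ℝ)]
    exact mul_le_mul_of_nonneg_left hqT hS.le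
  have h2 : 2 * (n : ℝ) / (n * pSum p) * T * S = 2 * (T * (S / pSum p)) := by field_simp
  have h4 : (T : ℝ) * (σ ^ (2 / 3 : ℝ) * √(2 * n) ^ (2 / 3 : ℝ) / (n : ℝ) ^ (1 / 3 : ℝ) *
      (S ^ (2 / 3 : ℝ) / pSum p ^ (2 / 3 : ℝ)) + 2 * σ ^ 2 * (T / pSum p ^ 2)) =
      σ ^ (2 / 3 : ℝ) * √(2 * n) ^ (2 / 3 : ℝ) * T * S ^ (2 / 3 : ℝ) /
        ((n : ℝ) ^ (1 / 3 : ℝ) * pSum p ^ (2 / 3 : ℝ)) +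
      σ ^ 2 * (2 * n) * (T : ℝ) ^ 2 / (n * pSum p ^ 2) := by
    have := (Real.rpow_pos_of_pos hn0 (1 / 3 : ℝ)).ne'
    have := (Real.rpow_pos_of_pos hq (2 / 3 : ℝ)).ne'
    field_simp
  rw [mul_add, ← mul_assoc (T : ℝ) (_ + 2 * σ ^ 2 * _), h4, h2]
  linarith

theorem tendsto_mseBound (n : ℕ) (σ δ : ℝ) {ρ τ : ℕ → ℝ} (hρ : Tendsto ρ atTop (𝓝 0))
    (hτ : Tendsto τ atTop (𝓝 0)) :
    Tendsto (fun k => mseBound n σ δ (ρ k) (τ k)) atTop (𝓝 0) := by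
  have h1 : Tendsto (fun k => ρ k ^ (2 / 3 : ℝ)) atTop (𝓝 0) := by
    have := hρ.rpow_const (p := (2 / 3 : ℝ)) (Or.inr (by norm_num))
    rwa [Real.zero_rpow (by norm_num)] at this
  have := (hρ.const_mul 3).add (((h1.const_mul (σ ^ (2 / 3 : ℝ) * √(2 * n) ^ (2 / 3 : ℝ) /
    (n : ℝ) ^ (1 / 3 : ℝ))).add (hτ.const_mul (2 * σ ^ 2))).mul_const (Real.log (1 / δ)))
  simpa [mseBound] using this

theorem tendsto_zero_of_eventually_le {f : ℕ → ℝ} (h0 : ∀ k, 0 ≤ f k)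
    (h : ∀ δ, 0 < δ → δ < Real.exp (-1) → ∀ᶠ k in atTop, f k ≤ 3 * δ) :
    Tendsto f atTop (𝓝 0) := by
  refine tendsto_order.2 ⟨fun a ha => Eventually.of_forall fun k => ha.trans_le (h0 k),
    fun a ha => ?_⟩
  have he := Real.exp_pos (-1)
  have h1 := min_le_left (a / 6) (Real.exp (-1) / 2)
  have h2 := min_le_right (a / 6) (Real.exp (-1) / 2)
  filter_upwards [h (min (a / 6) (Real.exp (-1) / 2)) (by positivity) (by linarith)] with k hk
  linarith

theorem measureReal_mse_le {Ω : Type*} [MeasurableSpace Ω] {P : Measure Ω}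
    [IsProbabilityMeasure P] {f : Ω → ℝ} {T B ε b : ℝ} (hT : 0 < T)
    (h : P.real {ω | ¬ f ω ≤ 10 ^ 8 * B} ≤ b) {m : ℝ} (hB : B ≤ T * m) (hm : m < ε / 10 ^ 8) :
    P.real {ω | ε ≤ 1 / T * f ω} ≤ b := by
  refine le_trans (measureReal_mono (μ := P) fun ω hω => ?_) h
  simp only [Set.mem_ofPred_eq] at hω ⊢
  intro hle
  rw [one_div, inv_mul_eq_div, le_div_iff₀ hT] at hω
  rw [lt_div_iff₀ (by norm_num)] at hm
  have := mul_lt_mul_of_pos_left hm hT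
  nlinarith

variable {n : ℕ} {σ : ℝ≥0} {δ : ℝ} {T : ℕ → ℕ} {Ω : ℕ → Type*} [∀ k, MeasurableSpace (Ω k)]
  {P : ∀ k, Measure (Ω k)} [∀ k, IsProbabilityMeasure (P k)]
  {𝒢 : ∀ k, Ω k → Fin (T k) → SimpleGraph (Fin n)} {p : ∀ k, Fin (T k) → ℝ}
  {η : ∀ k, Ω k → Fin (T k) → Sym2 (Fin n) → ℝ} {x : ∀ k, Fin (T k) × Fin n → ℝ} {S : ℕ → ℝ}

/-- The consequences of `√T = o(pSum)`. -/
theorem pSum_asymptotics (hT : Tendsto T atTop atTop) (hp : ∀ k t, p k t ∈ Set.Icc (0 : ℝ) 1)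
    (ho : (fun k => √(T k : ℝ)) =o[atTop] fun k => pSum (p k)) :
    Tendsto (fun k => pSum (p k)) atTop atTop ∧
      Tendsto (fun k => (T k : ℝ) / pSum (p k) ^ 2) atTop (𝓝 0) ∧
      ∀ k, pSum (p k) ≤ T k := by
  have h0 : ∀ k, 0 ≤ pSum (p k) := fun k => Finset.sum_nonneg fun t _ => (hp k t).1
  refine ⟨?_, ?_, fun k => ?_⟩
  · have hsq : Tendsto (fun k => √(T k : ℝ)) atTop atTop :=
      Real.tendsto_sqrt_atTop.comp (tendsto_natCast_atTop_atTop.comp hT)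
    refine tendsto_atTop_mono' _ ?_ hsq
    filter_upwards [ho.bound one_pos] with k hk
    rwa [one_mul, Real.norm_of_nonneg (Real.sqrt_nonneg _), Real.norm_of_nonneg (h0 k)] at hk
  · have := ho.tendsto_div_nhds_zero.pow 2
    simpa [div_pow] using this
  · calc pSum (p k) ≤ ∑ _t : Fin (T k), (1 : ℝ) := Finset.sum_le_sum fun t _ => (hp k t).2
      _ = T k := by simp

theorem complete_consistent
    (o : ∀ k, ∀ (_ : Fin (T k)) (K : SimpleGraph (Fin n)), EdgeOrientation K) (hn : 1 ≤ n)
    (hδ0 : 0 < δ) (hT : Tendsto T atTop atTop)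
    (oG : ∀ k, EdgeOrientation (⊤ : SimpleGraph (Fin (T k))))
    (hM : ∀ k, Model (P k) ⊤ (oG k) (𝒢 k) (p k) (η k) σ (x k) (S k))
    (ho : (fun k => max (S k / T k) √(T k : ℝ)) =o[atTop] (fun k => pSum (p k))) {ε : ℝ}
    (hε : 0 < ε) :
    Tendsto (fun k => (P k).real {ω | ε ≤ 1 / (T k : ℝ) *
      sqError ⊤ (oG k) (o k) (muComplete 2 n (p k) σ (S k) δ) (x k) (𝒢 k ω) (η k ω)}) atTop
      (𝓝 0) := by
  have ho1 : (fun k => S k / (T k : ℝ)) =o[atTop] fun k => pSum (p k) :=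
    (Asymptotics.IsBigO.of_norm_le fun k => by
      rw [Real.norm_of_nonneg (div_nonneg (hM k).S_pos.le (Nat.cast_nonneg _))]
      exact le_max_left _ _).trans_isLittleO ho
  have ho2 : (fun k => √(T k : ℝ)) =o[atTop] fun k => pSum (p k) :=
    (Asymptotics.IsBigO.of_norm_le fun k => by
      rw [Real.norm_of_nonneg (Real.sqrt_nonneg _)]
      exact le_max_right _ _).trans_isLittleO ho
  obtain ⟨hp_top, hτ, hpT⟩ := pSum_asymptotics hT (fun k => (hM k).erdosRenyi.p_mem) ho2
  have hρ : Tendsto (fun k => S k / (T k * pSum (p k))) atTop (𝓝 0) := by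
    simpa only [div_div] using ho1.tendsto_div_nhds_zero
  refine tendsto_zero_of_eventually_le (fun k => measureReal_nonneg) fun δ' hδ' hδ'e => ?_
  filter_upwards [eventually_gam_eq hn hδ0 hT p, eventually_gam_eq hn hδ' hT p,
    hT.eventually_ge_atTop 1, hp_top.eventually_ge_atTop (24 * (Real.log (n / δ') / n)),
    (tendsto_mseBound n σ δ' hρ hτ).eventually_lt_const (show 0 < ε / 10 ^ 8 by positivity)]
    with k hg hg' hTk hpk hmse
  -- The estimator tuned with `δ` is also the one tuned with `δ'`, so its failure probability is at
  -- most `3δ'` for every small `δ'`.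
  have hμ : muComplete 2 n (p k) σ (S k) δ = muComplete 2 n (p k) σ (S k) δ' := by
    simp only [muComplete, hg, hg']
  rw [hμ]
  exact measureReal_mse_le (by exact_mod_cast hTk)
    (complete_error_prob (hM k) (o k) hn hTk hδ' hδ'e hpk)
    (boundComplete_le hn hTk (hM k).S_pos (pSum_pos_of_le hn hδ' hδ'e hpk) (hpT k) hg') hmse

theorem star_consistent
    (o : ∀ k, ∀ (_ : Fin (T k)) (K : SimpleGraph (Fin n)), EdgeOrientation K) (hn : 1 ≤ n)
    (hδ0 : 0 < δ) (hT : Tendsto T atTop atTop) (r : ∀ k, Fin (T k))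
    (oG : ∀ k, EdgeOrientation (SimpleGraph.starGraph (r k)))
    (hM : ∀ k, Model (P k) (SimpleGraph.starGraph (r k)) (oG k) (𝒢 k) (p k) (η k) σ (x k) (S k))
    (ho : (fun k => max (S k) √(T k : ℝ)) =o[atTop] (fun k => pSum (p k))) {ε : ℝ}
    (hε : 0 < ε) :
    Tendsto (fun k => (P k).real {ω | ε ≤ 1 / (T k : ℝ) *
      sqError (SimpleGraph.starGraph (r k)) (oG k) (o k) (muStar 2 n (p k) σ (S k) δ) (x k)
        (𝒢 k ω) (η k ω)}) atTop (𝓝 0) := by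
  have ho1 : S =o[atTop] fun k => pSum (p k) :=
    (Asymptotics.IsBigO.of_norm_le fun k => by
      rw [Real.norm_of_nonneg (hM k).S_pos.le]
      exact le_max_left _ _).trans_isLittleO ho
  have ho2 : (fun k => √(T k : ℝ)) =o[atTop] fun k => pSum (p k) :=
    (Asymptotics.IsBigO.of_norm_le fun k => by
      rw [Real.norm_of_nonneg (Real.sqrt_nonneg _)]
      exact le_max_right _ _).trans_isLittleO ho
  obtain ⟨hp_top, hτ, hpT⟩ := pSum_asymptotics hT (fun k => (hM k).erdosRenyi.p_mem) ho2
  have hρ : Tendsto (fun k => S k / pSum (p k)) atTop (𝓝 0) := ho1.tendsto_div_nhds_zero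
  refine tendsto_zero_of_eventually_le (fun k => measureReal_nonneg) fun δ' hδ' hδ'e => ?_
  filter_upwards [eventually_gam_eq hn hδ0 hT p, eventually_gam_eq hn hδ' hT p,
    hT.eventually_ge_atTop 1, hp_top.eventually_ge_atTop (24 * (Real.log (n / δ') / n)),
    (tendsto_mseBound n σ δ' hρ hτ).eventually_lt_const (show 0 < ε / 10 ^ 8 by positivity)]
    with k hg hg' hTk hpk hmse
  have hμ : muStar 2 n (p k) σ (S k) δ = muStar 2 n (p k) σ (S k) δ' := by
    simp only [muStar, hg, hg']
  rw [hμ]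
  exact measureReal_mse_le (by exact_mod_cast hTk)
    (star_error_prob (hM k) (o k) hn hTk hδ' hδ'e hpk)
    (boundStar_le hn hTk (hM k).S_pos (pSum_pos_of_le hn hδ' hδ'e hpk) (hpT k) hg') hmse

end Consistency

end TransSync

theorem mainTheorem5 :
    ∃ c₁ c₂ c₃ : ℝ, 0 < c₁ ∧ 0 < c₂ ∧ 0 < c₃ ∧
      -- the high-probability error bounds
      (∀ (n T : ℕ) (Ω : Type*) [MeasurableSpace Ω] (P : Measure Ω) [IsProbabilityMeasure P]
        (𝒢 : Ω → Fin T → SimpleGraph (Fin n)) (p : Fin T → ℝ)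
        (η : Ω → Fin T → Sym2 (Fin n) → ℝ) (σ : ℝ≥0) (x : Fin T × Fin n → ℝ) (S δ : ℝ)
        (o : ∀ (_ : Fin T) (K : SimpleGraph (Fin n)), TransSync.EdgeOrientation K),
        1 ≤ n → 1 ≤ T → 0 < δ → δ < Real.exp (-1) →
        c₁ * (Real.log (n / δ) / n) ≤ TransSync.pSum p →
        (∀ oG : TransSync.EdgeOrientation (⊤ : SimpleGraph (Fin T)),
          TransSync.Model P ⊤ oG 𝒢 p η σ x S →
          1 - 3 * δ ≤ P.real {ω |
            TransSync.sqError ⊤ oG o (TransSync.muComplete c₂ n p σ S δ) x (𝒢 ω) (η ω) ≤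
              c₃ * TransSync.boundComplete n p σ S δ}) ∧
        (∀ (r : Fin T) (oG : TransSync.EdgeOrientation (SimpleGraph.starGraph r)),
          TransSync.Model P (SimpleGraph.starGraph r) oG 𝒢 p η σ x S →
          1 - 3 * δ ≤ P.real {ω |
            TransSync.sqError (SimpleGraph.starGraph r) oG o
                (TransSync.muStar c₂ n p σ S δ) x (𝒢 ω) (η ω) ≤
              c₃ * TransSync.boundStar n p σ S δ})) ∧
      -- weak consistency as the number of layers grows, for fixed `n`, `σ` and `δ`
      (∀ (n : ℕ) (σ : ℝ≥0) (δ : ℝ) (T : ℕ → ℕ) (Ω : ℕ → Type*)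
        [∀ k, MeasurableSpace (Ω k)] (P : ∀ k, Measure (Ω k)) [∀ k, IsProbabilityMeasure (P k)]
        (𝒢 : ∀ k, Ω k → Fin (T k) → SimpleGraph (Fin n)) (p : ∀ k, Fin (T k) → ℝ)
        (η : ∀ k, Ω k → Fin (T k) → Sym2 (Fin n) → ℝ)
        (x : ∀ k, Fin (T k) × Fin n → ℝ) (S : ℕ → ℝ)
        (o : ∀ k, ∀ (_ : Fin (T k)) (K : SimpleGraph (Fin n)), TransSync.EdgeOrientation K),
        1 ≤ n → 0 < δ → δ < Real.exp (-1) → Tendsto T atTop atTop →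
        (∀ oG : ∀ k, TransSync.EdgeOrientation (⊤ : SimpleGraph (Fin (T k))),
          (∀ k, TransSync.Model (P k) ⊤ (oG k) (𝒢 k) (p k) (η k) σ (x k) (S k)) →
          (fun k => max (S k / T k) √(T k : ℝ)) =o[atTop] (fun k => TransSync.pSum (p k)) →
          ∀ ε : ℝ, 0 < ε → Tendsto (fun k => (P k).real {ω | ε ≤ 1 / (T k : ℝ) *
            TransSync.sqError ⊤ (oG k) (o k) (TransSync.muComplete c₂ n (p k) σ (S k) δ)
              (x k) (𝒢 k ω) (η k ω)}) atTop (𝓝 0)) ∧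
        (∀ (r : ∀ k, Fin (T k))
          (oG : ∀ k, TransSync.EdgeOrientation (SimpleGraph.starGraph (r k))),
          (∀ k, TransSync.Model (P k) (SimpleGraph.starGraph (r k)) (oG k) (𝒢 k) (p k) (η k) σ
            (x k) (S k)) →
          (fun k => max (S k) √(T k : ℝ)) =o[atTop] (fun k => TransSync.pSum (p k)) →
          ∀ ε : ℝ, 0 < ε → Tendsto (fun k => (P k).real {ω | ε ≤ 1 / (T k : ℝ) *
            TransSync.sqError (SimpleGraph.starGraph (r k)) (oG k) (o k)
              (TransSync.muStar c₂ n (p k) σ (S k) δ) (x k) (𝒢 k ω) (η k ω)}) atTop (𝓝 0))) := by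
  -- `24` serves the union bound over cuts, `2` the condition `2γ² ≤ μλ`, and `10 ^ 8` absorbs the
  -- numerical constants.
  refine ⟨24, 2, 10 ^ 8, by norm_num, by norm_num, by norm_num, ?_, ?_⟩
  · intro n T Ω _ P _ 𝒢 p η σ x S δ o hn hT hδ0 hδ hp
    exact ⟨fun oG hM => TransSync.le_measureReal_of_compl_le
        (TransSync.complete_error_prob hM o hn hT hδ0 hδ hp),
      fun r oG hM => TransSync.le_measureReal_of_compl_le
        (TransSync.star_error_prob hM o hn hT hδ0 hδ hp)⟩
  · intro n σ δ T Ω _ P _ 𝒢 p η x S o hn hδ0 _ hT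
    exact ⟨fun oG hM ho ε hε => TransSync.complete_consistent o hn hδ0 hT oG hM ho hε,
      fun r oG hM ho ε hε => TransSync.star_consistent o hn hδ0 hT r oG hM ho hε⟩
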